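/- **Setting.** Let $d\ge 3$, let $D$ be a probability distribution on $\mathbb S^{d-1}\times\{+1,-1\}$ whose marginal on the unit sphere $\mathbb S^{d-1}\subset\mathbb R^d$ is uniform, and write $h_w(x)=\mathrm{sign}(w\cdot x)$ and $\mathrm{err}(h)=\mathbb P_{(X,Y)\sim D}[h(X)\neq Y]$. Let $\eta\in[0,\tfrac12)$ and $u\in\mathbb S^{d-1}$, and suppose that $D$ satisfies the $\eta$-bounded noise condition with respect to $u$: $\mathbb P[Y\neq \mathrm{sign}(u\cdot x)\mid X=x]\le\eta$ for almost every $x$. Let $v_0\in\mathbb S^{d-1}$ have angle $\theta(v_0,u)\le\frac{\pi}{2}$ with $u$, and let $\epsilon,\delta\in(0,1)$. For $k\ge1$ put $$m_k=\Big\lceil \tfrac{(3200\pi)^3 d}{(1-2\eta)^2}\Big(\ln\tfrac{(3200\pi)^3 d}{(1-2\eta)^2}+\ln\tfrac{k(k+1)}{\delta}\Big)\Big\rceil,\qquad b_k=\frac{1}{2(600\pi)^2\ln\frac{m_k^2k(k+1)}{\delta}}\cdot\frac{2^{-k}\pi(1-2\eta)}{\sqrt d}.$$ **Algorithm.** PASSIVE-PERCEPTRON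 runs epochs $k=1,\dots,\lceil\log_2\frac1\epsilon\rceil$, starting from $v_0$. Epoch $k$ starts with $w_0=v_{k-1}$ and performs, for $t=0,\dots,m_k-1$: draw labeled examples i.i.d. from $D$ until one, $(x_t,y_t)$, satisfies $\frac{b_k}{2}\le w_t\cdot x_t\le b_k$; then set $w_{t+1}=w_t-2\cdot\mathbf 1\{y_t\,(w_t\cdot x_t)<0\}\,(w_t\cdot x_t)\,x_t$. Its result is $v_k=w_{m_k}$, and the output $v$ is the result of the last epoch. Running time is counted in unit-cost steps of a real RAM: arithmetic operations on reals, comparisons, storing a coordinate, reading a schedule entry and advancing a loop counter cost $1$ each, receiving an example costs $d+1$, and computing $\lceil\log_2\frac1\epsilon\rceil$ costs $3(\lceil\log_2\frac1\epsilon\rceil+1)$. **Claim.** There is an absolute constant $C>0$ such that in every such situation, with probability at least $1-\delta$ over the examples drawn, PASSIVE-PERCEPTRON halts with an output $v\in\mathbb S^{d-1}$ and 1. $\mathrm{err}(h_v)\le \mathrm{err}(h_u)+\epsilon$; 2. the number of labeled examples drawn is at most $C\,\frac{d}{(1-2\eta)^3\epsilon}\,\Lambda$; 3. the running time is at most $C\,\frac{d^2}{(1-2\eta)^3\epsilon}\,\Lambda$,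 where $\Lambda=\Big(\ln\frac{d}{(1-2\eta)^2}+\ln\frac1\delta+\ln\big(1+\ln\frac1\epsilon\big)\Big)^2\Big(1+\ln\frac1\epsilon\Big)$. (These are the bounds $\tilde O\big(\frac{d}{(1-2\eta)^3\epsilon}\big)$ and $\tilde O\big(\frac{d^2}{(1-2\eta)^3\epsilon}\big)$ with the logarithmic factors written out.) -/

import Mathlib

open MeasureTheory ProbabilityTheory

namespace PassivePerceptron

/-! ### The learning problem -/

/-- The unit sphere of `ℝ^d`, the instance space. -/
abbrev Sphere (d : ℕ) : Type := Metric.sphere (0 : EuclideanSpace ℝ (Fin d)) 1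

/-- The label space `{+1, -1}`. -/
abbrev Label : Type := ℤˣ

/-- Labeled examples `(x, y)`. -/
abbrev Example (d : ℕ) : Type := Sphere d × Label

/-- The set `{+1, -1}` carries the discrete `σ`-algebra (needed to condition on the instance). -/
instance instDiscreteLabel : DiscreteMeasurableSpace Label where
  forall_measurableSet s := by
    refine ⟨Units.val '' s, MeasurableSet.of_discrete, ?_⟩
    exact Set.preimage_image_eq s Units.val_injective

/-- The uniform distribution on the unit sphere: normalized surface measure. -/
noncomputable def uniformSphere (d : ℕ) : Measure (Sphere d) :=
  ((volume : Measure (EuclideanSpace ℝ (Fin d))).toSphere Set.univ)⁻¹ •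
    (volume : Measure (EuclideanSpace ℝ (Fin d))).toSphere

/-- The sign of a real number as a label, with `sgn 0 = +1`. -/
noncomputable def sgn (r : ℝ) : Label := if 0 ≤ r then 1 else -1

/-- The homogeneous halfspace `h_w(x) = sign(w · x)`. -/
noncomputable def halfspace {d : ℕ} (w : EuclideanSpace ℝ (Fin d)) (x : Sphere d) : Label :=
  sgn (inner ℝ w (x : EuclideanSpace ℝ (Fin d)))

/-- The error rate `P_{(X, Y) ∼ D}[h(X) ≠ Y]`. -/
noncomputable def err {d : ℕ} (D : Measure (Example d)) (h : Sphere d → Label) : ℝ :=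
  D.real {z | h z.1 ≠ z.2}

/-- `η`-bounded noise with respect to `u`: `P[Y ≠ sign(u · x) | X = x] ≤ η` for (almost) all `x`.
Here `D.condKernel x` is the conditional distribution of the label given `X = x`, which is
determined up to a null set of instances `x`. -/
def BoundedNoise {d : ℕ} (D : Measure (Example d)) [IsFiniteMeasure D] (η : ℝ)
    (u : EuclideanSpace ℝ (Fin d)) : Prop :=
  ∀ᵐ x ∂D.fst, (D.condKernel x).real {y | y ≠ halfspace u x} ≤ η

/-! ### Computations that draw examples and count their steps

The cost model is the real RAM with unit cost: an arithmetic operation on real numbers, a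
comparison, storing a coordinate, reading an entry of an input table and advancing a loop counter
cost one step each; receiving an example costs `d + 1` steps (its `d` coordinates and its label). -/

/-- What a halting computation leaves behind: its value, the number of labeled examples that it
drew, and the number of steps that it made. -/
structure Outcome (α : Type) where
  val : α
  draws : ℕ
  time : ℕ

/-- A computation with access to a stream of labeled examples, which it consumes from the front;
`none` means that it runs forever on this stream. -/
def Comp (d : ℕ) (α : Type) : Type := (ℕ → Example d) → Option (Outcome α)

namespace Comp

variable {d : ℕ} {α β σ ι : Type}

/-- Return a value without doing anything. -/
def ret (a : α) : Comp d α := fun _ => some ⟨a, 0, 0⟩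

/-- Sequential composition: the second computation reads the stream where the first one stopped,
and draws and steps add up. -/
def andThen (p : Comp d α) (f : α → Comp d β) : Comp d β := fun ω =>
  (p ω).bind fun r =>
    (f r.val fun i => ω (r.draws + i)).map fun s =>
      ⟨s.val, r.draws + s.draws, r.time + s.time⟩

instance : Monad (Comp d) where
  pure := ret
  bind := andThen

/-- Draw the next labeled example. -/
def draw : Comp d (Example d) := fun ω => some ⟨ω 0, 1, d + 1⟩

/-- An elementary operation with result `a`: one step. -/
def unit (a : α) : Comp d α := fun _ => some ⟨a, 0, 1⟩

/-- Real addition, one step. -/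
noncomputable def add (x y : ℝ) : Comp d ℝ := unit (x + y)

/-- Real subtraction, one step. -/
noncomputable def sub (x y : ℝ) : Comp d ℝ := unit (x - y)

/-- Real multiplication, one step. -/
noncomputable def mul (x y : ℝ) : Comp d ℝ := unit (x * y)

/-- Real division, one step. -/
noncomputable def div (x y : ℝ) : Comp d ℝ := unit (x / y)

/-- Comparison `x ≤ y`, one step. -/
noncomputable def le (x y : ℝ) : Comp d Bool := unit (decide (x ≤ y))

/-- Comparison `x < y`, one step. -/
noncomputable def lt (x y : ℝ) : Comp d Bool := unit (decide (x < y))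

/-- Overwrite the coordinate `i` of a vector, one step. -/
noncomputable def store (v : EuclideanSpace ℝ (Fin d)) (i : Fin d) (a : ℝ) :
    Comp d (EuclideanSpace ℝ (Fin d)) :=
  unit (WithLp.toLp 2 (Function.update (fun j => v j) i a))

/-- `for i in l do s ← body i s`, with one step per round for advancing the loop counter. -/
def forEach : List ι → σ → (ι → σ → Comp d σ) → Comp d σ
  | [], s, _ => pure s
  | i :: l, s, body => do
      let i ← unit i
      let s ← body i s
      forEach l s body

/-- At most `n` rounds of `body`, up to the first one that returns `some a`; running forever if
there is none. -/
def attempts (body : Comp d (Option α)) : ℕ → Comp d α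
  | 0 => fun _ => none
  | n + 1 => do
      match ← body with
      | some a => pure a
      | none => attempts body n

open Classical in
/-- Repeat `body` until it returns `some a`, and return `a`. -/
noncomputable def repeatUntil (body : Comp d (Option α)) : Comp d α := fun ω =>
  if h : ∃ n, (attempts body n ω).isSome then attempts body (Nat.find h) ω else none

/-- The inner product, computed coordinate by coordinate. -/
noncomputable def dot (w x : EuclideanSpace ℝ (Fin d)) : Comp d ℝ :=
  forEach (List.finRange d) 0 fun i s => do
    let p ← mul (w i) (x i)
    add s p

/-- The vector `w - c x`, computed coordinate by coordinate. -/
noncomputable def subMul (w : EuclideanSpace ℝ (Fin d)) (c : ℝ) (x : EuclideanSpace ℝ (Fin d)) :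
    Comp d (EuclideanSpace ℝ (Fin d)) :=
  forEach (List.finRange d) w fun i v => do
    let p ← mul c (x i)
    let a ← sub (w i) p
    store v i a

/-- The number `⌈log₂ (1 / ε)⌉`. It is charged three steps (a comparison, a doubling, and a counter
increment) for each member of the sequence `ε, 2 ε, 4 ε, …` up to the first one that is at least
`1`. -/
noncomputable def ceilLogInv (ε : ℝ) : Comp d ℕ := fun _ =>
  some ⟨⌈Real.logb 2 (1 / ε)⌉₊, 0, 3 * (⌈Real.logb 2 (1 / ε)⌉₊ + 1)⟩

end Comp

/-! ### The algorithm -/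

open PassivePerceptron.Comp

/-- Rejection sampling from `D` conditioned on `b / 2 ≤ w · x ≤ b`: repeat drawing an example until
it falls into the band. -/
noncomputable def sampleBand {d : ℕ} (w : EuclideanSpace ℝ (Fin d)) (b : ℝ) :
    Comp d (Example d) :=
  repeatUntil do
    let z ← draw
    let s ← dot w z.1
    let h ← div b 2
    let low ← le h s
    let high ← le s b
    if low && high then pure (some z) else pure none

/-- The modified Perceptron update `w - 2 · 1{y (w · x) < 0} (w · x) x`. -/
noncomputable def update {d : ℕ} (w : EuclideanSpace ℝ (Fin d)) (z : Example d) :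
    Comp d (EuclideanSpace ℝ (Fin d)) := do
  let s ← dot w z.1
  let p ← mul ((z.2 : ℤ) : ℝ) s
  if ← lt p 0 then
    let c ← mul 2 s
    subMul w c z.1
  else
    pure w

/-- PASSIVE-MODIFIED-PERCEPTRON: starting from `w₀`, make `m` updates, each on a fresh example from
the band of width parameter `b` around the current iterate. -/
noncomputable def passiveModifiedPerceptron {d : ℕ} (w₀ : EuclideanSpace ℝ (Fin d)) (m : ℕ)
    (b : ℝ) : Comp d (EuclideanSpace ℝ (Fin d)) :=
  forEach (List.range m) w₀ fun _ w => do
    let z ← sampleBand w b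
    update w z

/-- PASSIVE-PERCEPTRON: initial halfspace `v₀`, target error `ε`, sample schedule `m`,
band width schedule `b`; the epochs are `k = 1, …, ⌈log₂ (1 / ε)⌉`. -/
noncomputable def passivePerceptron {d : ℕ} (v₀ : EuclideanSpace ℝ (Fin d)) (ε : ℝ) (m : ℕ → ℕ)
    (b : ℕ → ℝ) : Comp d (EuclideanSpace ℝ (Fin d)) := do
  let k₀ ← ceilLogInv ε
  forEach (List.range' 1 k₀) v₀ fun k v => do
    let mk ← unit (m k)
    let bk ← unit (b k)
    passiveModifiedPerceptron v mk bk

/-! ### The schedules for bounded noise -/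

/-- The sample schedule
`m_k = ⌈(3200π)³ d / (1-2η)² · (ln ((3200π)³ d / (1-2η)²) + ln (k(k+1)/δ))⌉`. -/
noncomputable def sampleSchedule (d : ℕ) (η δ : ℝ) (k : ℕ) : ℕ :=
  ⌈(3200 * Real.pi) ^ 3 * d / (1 - 2 * η) ^ 2 *
    (Real.log ((3200 * Real.pi) ^ 3 * d / (1 - 2 * η) ^ 2) + Real.log (k * (k + 1) / δ))⌉₊

/-- The band width schedule
`b_k = 1 / (2 (600π)² ln (m_k² k(k+1)/δ)) · 2^{-k} π (1-2η) / √d`. -/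
noncomputable def bandSchedule (d : ℕ) (η δ : ℝ) (k : ℕ) : ℝ :=
  1 / (2 * (600 * Real.pi) ^ 2 *
      Real.log ((sampleSchedule d η δ k : ℝ) ^ 2 * (k * (k + 1)) / δ)) *
    ((1 / 2) ^ k * Real.pi * (1 - 2 * η) / Real.sqrt d)

/-- The logarithmic factor
`(ln (d/(1-2η)²) + ln (1/δ) + ln (1 + ln (1/ε)))² (1 + ln (1/ε))` of the complexity bounds. -/
noncomputable def logFactor (d : ℕ) (η ε δ : ℝ) : ℝ :=
  (Real.log (d / (1 - 2 * η) ^ 2) + Real.log (1 / δ) + Real.log (1 + Real.log (1 / ε))) ^ 2 *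
    (1 + Real.log (1 / ε))

end PassivePerceptron

/-! The quantity `1 - ⟪u, w⟫` is followed along the run. Inside the band `w·x > 0`, so a mistake
means label `-1`, and the update then raises `1 - ⟪u, w⟫` by `2 (w·x)(u·x)`. Write `u = c w + s v`
with `v` a unit vector orthogonal to `w`. On the band `u·x` equals `s (v·x)` up to an error `b`,
bounded noise makes the labels favour the sign of `u·x`, and `|v·x|` has conditional mean at least
`1/(2√d)`. Hence an accepted example lowers `1 - ⟪u, w⟫` on average by `(1-2η) b s/(4√d)`, up to an
error `2b²` (`integral_increment_le`).

An epoch that starts at angle `φ = π/2^k` is controlled by the potential `exp (lam (1 - ⟪u, w⟫))`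
with `lam = 8L/S`, where `S = 1 - cos φ` and `L` is the logarithm in the band width. The band is so
narrow that the drift beats the second-order terms: the potential contracts by a fixed factor, up to
an additive `3 exp L` that pays for iterates already close to `u` (`potential_contraction`).
Markov's inequality, at the end of the epoch and at the level `3S/2` that must not be reached
meanwhile, shows that the angle is halved except with probability `δ/(k(k+1))` (`FailBound.epoch`,
`FailBound.halve_angle`). Over `K` epochs these sum to `δ - δ/(K+1)` (`failBound_widths`); the
remaining `δ/(K+1)` is spent on the event of too many draws. A final angle of `π/2^(K+1)` leaves a
disagreement with `h_u` of mass at most `2^(-K) ≤ ε` (`lune_real_le`).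

The probability is handled by dynamic programming. Failure within a budget of `N` draws satisfies a
one-draw recursion in the iterate, the remaining band widths and `N`, and `FailBound` states a
supersolution of it. Its term `exp (length - μ N)` accounts for rejection sampling, whose acceptance
probability is at least `2μ` by `band_real_lower_bound`. The cost is deterministic given the number
of draws (`Reaches.passivePerceptron`).

All facts about the sphere come from its invariance under reflections: they yield second and fourth
moments, and polynomial minorants of `|y|` and `1/r` turn these into the bounds needed. -/

namespace PassivePerceptron

/-! ### Semantics and cost of the program. -/

namespace Comp

variable {d : ℕ} {α β σ ι : Type}

theorem bind_eq_some {p : Comp d α} {f : α → Comp d β} {ω : ℕ → Example d} {a : α} {b : β}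
    {n t n' t' : ℕ} (hp : p ω = some ⟨a, n, t⟩)
    (hf : f a (fun i => ω (n + i)) = some ⟨b, n', t'⟩) :
    (p >>= f) ω = some ⟨b, n + n', t + t'⟩ := by
  change (p ω).bind _ = _
  simp [hp, hf]

/-- The computation `p` halts with value `a` after `t` steps without drawing any example. -/
def Computes (p : Comp d α) (a : α) (t : ℕ) : Prop := ∀ ω, p ω = some ⟨a, 0, t⟩

theorem computes_pure (a : α) : Computes (pure a : Comp d α) a 0 := fun _ => rfl

theorem computes_unit (a : α) : Computes (unit a : Comp d α) a 1 := fun _ => rfl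

theorem Computes.bind {p : Comp d α} {f : α → Comp d β} {a : α} {b : β} {t t' : ℕ}
    (hp : Computes p a t) (hf : Computes (f a) b t') : Computes (p >>= f) b (t + t') := by
  intro ω
  exact bind_eq_some (hp ω) (hf _)

theorem Computes.bind_eq_some {p : Comp d α} {f : α → Comp d β} {ω : ℕ → Example d} {a : α}
    {b : β} {n t t' : ℕ} (hp : Computes p a t) (hf : f a ω = some ⟨b, n, t'⟩) :
    (p >>= f) ω = some ⟨b, n, t + t'⟩ := by
  have := Comp.bind_eq_some (f := f) (hp ω) (by simpa using hf)
  simpa using this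

theorem computes_forEach {body : ι → σ → Comp d σ} {g : ι → σ → σ} {c : ℕ}
    (h : ∀ i s, Computes (body i s) (g i s) c) (l : List ι) (s : σ) :
    Computes (forEach l s body) (l.foldl (fun s i => g i s) s) (l.length * (c + 1)) := by
  induction l generalizing s with
  | nil => simpa [forEach] using computes_pure s
  | cons i l ih =>
    have := (computes_unit i).bind (f := fun i => body i s >>= fun s => forEach l s body)
      ((h i s).bind (ih (g i s)))
    rw [List.foldl_cons, List.length_cons,
      show (l.length + 1) * (c + 1) = 1 + (c + l.length * (c + 1)) by ring]
    exact this

theorem computes_dot (w x : EuclideanSpace ℝ (Fin d)) :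
    Computes (dot w x : Comp d ℝ) (inner ℝ w x) (3 * d) := by
  have := computes_forEach (d := d) (body := fun (i : Fin d) s => do
    let p ← mul (w i) (x i)
    add s p) (g := fun i s => s + w i * x i) (c := 2)
    (fun i s => (computes_unit _).bind (computes_unit _)) (List.finRange d) 0
  have h2 : (List.finRange d).foldl (fun s i => s + w i * x i) 0 = inner ℝ w x := by
    rw [← List.foldl_map (f := fun i => w i * x i) (g := fun s a => s + a), ← List.sum_eq_foldl,
      ← Fin.sum_univ_def, PiLp.inner_apply]
    simp [mul_comm]
  rw [h2, List.length_finRange, mul_comm] at this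
  exact this

theorem foldl_update_apply (f : Fin d → ℝ) (l : List (Fin d)) (v : EuclideanSpace ℝ (Fin d))
    (j : Fin d) :
    (l.foldl (fun (v : EuclideanSpace ℝ (Fin d)) i =>
      WithLp.toLp 2 (Function.update (fun j => v j) i (f i))) v) j =
      if j ∈ l then f j else v j := by
  induction l generalizing v with
  | nil => simp
  | cons i l ih =>
    rw [List.foldl_cons, ih]
    by_cases hj : j ∈ l
    · simp [hj]
    · by_cases hji : j = i
      · subst hji; simp [hj]
      · simp [hj, hji]

theorem computes_subMul (w : EuclideanSpace ℝ (Fin d)) (c : ℝ) (x : EuclideanSpace ℝ (Fin d)) :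
    Computes (subMul w c x) (w - c • x) (4 * d) := by
  have := computes_forEach (d := d) (body := fun (i : Fin d) v => do
    let p ← mul c (x i)
    let a ← sub (w i) p
    store v i a)
    (g := fun i v => WithLp.toLp 2 (Function.update (fun j => v j) i (w i - c * x i))) (c := 3)
    (fun i s => (computes_unit _).bind ((computes_unit _).bind (computes_unit _)))
    (List.finRange d) w
  have h2 : (List.finRange d).foldl (fun (v : EuclideanSpace ℝ (Fin d)) i =>
      WithLp.toLp 2 (Function.update (fun j => v j) i (w i - c * x i))) w = w - c • x := by
    ext j
    rw [foldl_update_apply (fun i => w i - c * x i)]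
    simp
  rw [h2, List.length_finRange, mul_comm] at this
  exact this

theorem attempts_succ_eq {body : Comp d (Option α)} {n : ℕ} {ω : ℕ → Example d} {r : Outcome α}
    (h : attempts body n ω = some r) : attempts body (n + 1) ω = some r := by
  induction n generalizing ω r with
  | zero => simp [attempts] at h
  | succ n ih =>
    simp only [attempts] at h ⊢
    change (body ω).bind _ = _ at h
    change (body ω).bind _ = _
    rcases hb : body ω with _ | ⟨_ | a, k, t⟩
    · simp [hb] at h
    · simp only [hb, Option.bind_some, Option.map_eq_some_iff] at h ⊢
      obtain ⟨s, hs, rfl⟩ := h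
      exact ⟨s, ih hs, rfl⟩
    · rw [hb] at h
      exact h

theorem attempts_mono {body : Comp d (Option α)} {n m : ℕ} (hnm : n ≤ m) {ω : ℕ → Example d}
    {r : Outcome α} (h : attempts body n ω = some r) : attempts body m ω = some r := by
  induction hnm with
  | refl => exact h
  | step _ ih => exact attempts_succ_eq ih

/-- A larger limit on the attempts never changes an outcome already reached, so the least number of
rounds chosen by `Nat.find` and any other sufficient number give the same result. -/
theorem repeatUntil_eq_some_iff {body : Comp d (Option α)} {ω : ℕ → Example d} {r : Outcome α} :
    repeatUntil body ω = some r ↔ ∃ n, attempts body n ω = some r := by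
  classical
  constructor
  · intro h
    unfold repeatUntil at h
    split_ifs at h
    exact ⟨_, h⟩
  · rintro ⟨n, hn⟩
    have hex : ∃ n, (attempts body n ω).isSome := ⟨n, by simp [hn]⟩
    unfold repeatUntil
    rw [dif_pos hex]
    obtain ⟨s, hs⟩ := Option.isSome_iff_exists.1 (Nat.find_spec hex)
    have h1 := attempts_mono (le_max_left n (Nat.find hex)) hn
    have h2 := attempts_mono (le_max_right n (Nat.find hex)) hs
    rw [h1] at h2
    rw [← h2] at hs
    convert hs

theorem repeatUntil_of_some {body : Comp d (Option α)} {ω : ℕ → Example d} {a : α} {k t : ℕ}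
    (h : body ω = some ⟨some a, k, t⟩) : repeatUntil body ω = some ⟨a, k, t⟩ := by
  refine repeatUntil_eq_some_iff.2 ⟨1, ?_⟩
  simp only [attempts]
  exact bind_eq_some (n' := 0) (t' := 0) h rfl

theorem repeatUntil_of_none {body : Comp d (Option α)} {ω : ℕ → Example d} {k t : ℕ}
    {a : α} {k' t' : ℕ} (h : body ω = some ⟨none, k, t⟩)
    (hr : repeatUntil body (fun i => ω (k + i)) = some ⟨a, k', t'⟩) :
    repeatUntil body ω = some ⟨a, k + k', t + t'⟩ := by
  obtain ⟨n, hn⟩ := repeatUntil_eq_some_iff.1 hr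
  refine repeatUntil_eq_some_iff.2 ⟨n + 1, ?_⟩
  simp only [attempts]
  exact bind_eq_some h hn

end Comp

open PassivePerceptron.Comp

variable {d : ℕ}

/-- The tail of a stream of examples. -/
def tail (ω : ℕ → Example d) : ℕ → Example d := fun i => ω (i + 1)

theorem tail_eq (ω : ℕ → Example d) : tail ω = fun i => ω (1 + i) := by
  funext i; simp [tail, add_comm]

/-- The example `z` falls into the band of width parameter `b` around `w`. -/
def InBand (b : ℝ) (w : EuclideanSpace ℝ (Fin d)) (z : Example d) : Prop :=
  b / 2 ≤ inner ℝ w (z.1 : EuclideanSpace ℝ (Fin d)) ∧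
    inner ℝ w (z.1 : EuclideanSpace ℝ (Fin d)) ≤ b

open Classical in
/-- The value of the modified Perceptron update. -/
noncomputable def step (w : EuclideanSpace ℝ (Fin d)) (z : Example d) :
    EuclideanSpace ℝ (Fin d) :=
  if ((z.2 : ℤ) : ℝ) * inner ℝ w (z.1 : EuclideanSpace ℝ (Fin d)) < 0 then
    w - (2 * inner ℝ w (z.1 : EuclideanSpace ℝ (Fin d))) • (z.1 : EuclideanSpace ℝ (Fin d))
  else w

open Classical in
theorem sampleBand_body (w : EuclideanSpace ℝ (Fin d)) (b : ℝ) (ω : ℕ → Example d) :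
    (do
      let z ← draw
      let s ← dot w z.1
      let h ← div b 2
      let low ← le h s
      let high ← le s b
      if low && high then pure (some z) else pure none : Comp d (Option (Example d))) ω =
      some ⟨if InBand b w (ω 0) then some (ω 0) else none, 1, 4 * d + 4⟩ := by
  have key : Computes (do
      let s ← dot w (ω 0).1
      let h ← div b 2
      let low ← le h s
      let high ← le s b
      if low && high then pure (some (ω 0)) else pure none : Comp d (Option (Example d)))
      (if InBand b w (ω 0) then some (ω 0) else none) (3 * d + (1 + (1 + (1 + 0)))) := by
    refine (computes_dot w _).bind ((computes_unit _).bind ((computes_unit _).bind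
      ((computes_unit _).bind ?_)))
    unfold InBand
    by_cases h1 : b / 2 ≤ inner ℝ w ((ω 0).1 : EuclideanSpace ℝ (Fin d)) <;>
    by_cases h2 : inner ℝ w ((ω 0).1 : EuclideanSpace ℝ (Fin d)) ≤ b <;>
    simp [h1, h2, computes_pure]
  rw [show 4 * d + 4 = d + 1 + (3 * d + (1 + (1 + (1 + 0)))) by ring]
  change (draw >>= _) ω = some ⟨_, 1 + 0, _⟩
  exact bind_eq_some rfl (key _)

theorem sampleBand_of_inBand {w : EuclideanSpace ℝ (Fin d)} {b : ℝ} {ω : ℕ → Example d}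
    (h : InBand b w (ω 0)) : sampleBand w b ω = some ⟨ω 0, 1, 4 * d + 4⟩ := by
  have := sampleBand_body w b ω
  rw [if_pos h] at this
  exact repeatUntil_of_some this

theorem sampleBand_of_not_inBand {w : EuclideanSpace ℝ (Fin d)} {b : ℝ} {ω : ℕ → Example d}
    {z : Example d} {n t : ℕ} (h : ¬ InBand b w (ω 0))
    (hr : sampleBand w b (tail ω) = some ⟨z, n, t⟩) :
    sampleBand w b ω = some ⟨z, 1 + n, 4 * d + 4 + t⟩ := by
  have := sampleBand_body w b ω
  rw [if_neg h] at this
  rw [tail_eq] at hr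
  exact repeatUntil_of_none this hr

/-- The time depends on whether a mistake occurs; the worst case is `3d` for the inner product,
three elementary operations and `4d` for the vector update. -/
theorem update_eq (w : EuclideanSpace ℝ (Fin d)) (z : Example d) :
    ∃ t ≤ 7 * d + 3, Computes (update w z) (step w z) t := by
  by_cases h : ((z.2 : ℤ) : ℝ) * inner ℝ w (z.1 : EuclideanSpace ℝ (Fin d)) < 0
  · refine ⟨3 * d + (1 + (1 + (1 + 4 * d))), by omega, ?_⟩
    refine (computes_dot w _).bind ((computes_unit _).bind ((computes_unit _).bind ?_))
    simp only [h, decide_true, if_true, step]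
    exact (computes_unit _).bind (computes_subMul _ _ _)
  · refine ⟨3 * d + (1 + (1 + 0)), by omega, ?_⟩
    refine (computes_dot w _).bind ((computes_unit _).bind ((computes_unit _).bind ?_))
    simp only [h, decide_false, if_false, step]
    exact computes_pure _

/-- The modified Perceptron with band widths `bs`, seen draw by draw: on the stream `ω` it stops
at `v` after `n` draws. -/
inductive Reaches : List ℝ → EuclideanSpace ℝ (Fin d) → (ℕ → Example d) → ℕ →
    EuclideanSpace ℝ (Fin d) → Prop
  | nil (w ω) : Reaches [] w ω 0 w
  | reject {b bs w ω n v} : ¬ InBand b w (ω 0) → Reaches (b :: bs) w (tail ω) n v →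
      Reaches (b :: bs) w ω (n + 1) v
  | accept {b bs w ω n v} : InBand b w (ω 0) → Reaches bs (step w (ω 0)) (tail ω) n v →
      Reaches (b :: bs) w ω (n + 1) v

/-- The cut comes right after the last acceptance needed by `as`; rejections that follow it are
charged to `bs`. -/
theorem Reaches.append {as bs : List ℝ} {w v : EuclideanSpace ℝ (Fin d)} {ω : ℕ → Example d}
    {n : ℕ} (h : Reaches (as ++ bs) w ω n v) :
    ∃ n₁ n₂ w', n = n₁ + n₂ ∧ Reaches as w ω n₁ w' ∧ Reaches bs w' (fun i => ω (n₁ + i)) n₂ v := by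
  generalize hl : as ++ bs = l at h
  induction h generalizing as with
  | nil w ω =>
    obtain ⟨rfl, rfl⟩ := List.append_eq_nil_iff.1 hl
    exact ⟨0, 0, w, rfl, .nil _ _, .nil _ _⟩
  | @reject b cs w ω n v hb h ih =>
    rcases as with _ | ⟨a, as⟩
    · simp only [List.nil_append] at hl
      subst hl
      exact ⟨0, n + 1, w, by omega, .nil _ _, by simpa using Reaches.reject hb h⟩
    · obtain ⟨n₁, n₂, w', rfl, h1, h2⟩ := ih hl
      obtain ⟨rfl, rfl⟩ := List.cons.inj hl
      refine ⟨n₁ + 1, n₂, w', by omega, .reject hb h1, ?_⟩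
      convert h2 using 2
      simp only [tail]; congr 1; omega
  | @accept b cs w ω n v hb h ih =>
    rcases as with _ | ⟨a, as⟩
    · simp only [List.nil_append] at hl
      subst hl
      exact ⟨0, n + 1, w, by omega, .nil _ _, by simpa using Reaches.accept hb h⟩
    · obtain ⟨rfl, rfl⟩ := List.cons.inj hl
      obtain ⟨n₁, n₂, w', rfl, h1, h2⟩ := ih rfl
      refine ⟨n₁ + 1, n₂, w', by omega, .accept hb h1, ?_⟩
      convert h2 using 2
      simp only [tail]; congr 1; omega

theorem Reaches.sampleBand {b : ℝ} {bs : List ℝ} {w v : EuclideanSpace ℝ (Fin d)}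
    {ω : ℕ → Example d} {n : ℕ} (h : Reaches (b :: bs) w ω n v) :
    ∃ k z, k + 1 ≤ n ∧ sampleBand w b ω = some ⟨z, k + 1, (4 * d + 4) * (k + 1)⟩ ∧
      Reaches bs (step w z) (fun i => ω (k + 1 + i)) (n - (k + 1)) v := by
  generalize hl : b :: bs = l at h
  induction h with
  | nil => simp at hl
  | @reject b' cs w ω n v hb h ih =>
    obtain ⟨rfl, rfl⟩ := List.cons.inj hl
    obtain ⟨k, z, hk, h1, h2⟩ := ih rfl
    refine ⟨k + 1, z, by omega, ?_, ?_⟩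
    · rw [sampleBand_of_not_inBand hb h1]
      congr 2 <;> ring
    · rw [show n + 1 - (k + 1 + 1) = n - (k + 1) by omega]
      convert h2 using 2
      simp only [tail]; congr 1; omega
  | @accept b' cs w ω n v hb h ih =>
    obtain ⟨rfl, rfl⟩ := List.cons.inj hl
    refine ⟨0, ω 0, by omega, ?_, ?_⟩
    · rw [sampleBand_of_inBand hb]; simp
    · rw [show n + 1 - (0 + 1) = n by omega]
      convert h using 2
      simp only [tail]; congr 1; omega

/-- A draw costs `4d + 4` steps in the rejection loop, and an accepted one causes at most `7d + 3`
more and one loop step. Charging `11d + 8` to every draw covers both. -/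
theorem Reaches.modifiedPerceptron {ι : Type} {b : ℝ} {l : List ι}
    {w v : EuclideanSpace ℝ (Fin d)} {ω : ℕ → Example d} {n : ℕ}
    (h : Reaches (List.replicate l.length b) w ω n v) :
    ∃ t ≤ (11 * d + 8) * n,
      forEach l w (fun _ w => do
        let z ← PassivePerceptron.sampleBand w b
        update w z) ω = some ⟨v, n, t⟩ := by
  induction l generalizing w ω n with
  | nil =>
    cases h
    exact ⟨0, by simp, rfl⟩
  | cons i l ih =>
    rw [List.length_cons, List.replicate_succ] at h
    obtain ⟨k, z, hk, h1, h2⟩ := h.sampleBand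
    obtain ⟨t, ht, h3⟩ := ih h2
    obtain ⟨t', ht', h4⟩ := update_eq w z
    have h5 := bind_eq_some (f := fun z => update w z) h1 (h4 _)
    have h6 := bind_eq_some (f := fun w => forEach l w (fun _ w => do
        let z ← PassivePerceptron.sampleBand w b
        update w z)) h5 h3
    have h7 := (computes_unit i).bind_eq_some (f := fun _ => (do
        let z ← PassivePerceptron.sampleBand w b
        update w z) >>= fun w => forEach l w (fun _ w => do
        let z ← PassivePerceptron.sampleBand w b
        update w z)) h6
    obtain ⟨m, rfl⟩ : ∃ m, n = k + 1 + m := ⟨n - (k + 1), by omega⟩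
    refine ⟨1 + ((4 * d + 4) * (k + 1) + t' + t), ?_, ?_⟩
    · have : (11 * d + 8) * (k + 1 + m) = (11 * d + 8) * m + (4 * d + 4) * (k + 1) +
        (7 * d + 4) + (7 * d + 4) * k := by ring
      have h9 : 0 ≤ (7 * d + 4) * k := Nat.zero_le _
      rw [show k + 1 + m - (k + 1) = m by omega] at ht
      omega
    · refine h7.trans ?_
      congr 2
      omega

/-- The list of the band widths used by all the iterations of the epochs `l`. -/
def widths (m : ℕ → ℕ) (b : ℕ → ℝ) (l : List ℕ) : List ℝ :=
  l.flatMap fun k => List.replicate (m k) (b k)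

theorem Reaches.epochs {m : ℕ → ℕ} {b : ℕ → ℝ} {l : List ℕ} {w v : EuclideanSpace ℝ (Fin d)}
    {ω : ℕ → Example d} {n : ℕ} (h : Reaches (widths m b l) w ω n v) :
    ∃ t ≤ (11 * d + 8) * n + 3 * l.length,
      forEach l w (fun k v => do
        let mk ← unit (m k)
        let bk ← unit (b k)
        passiveModifiedPerceptron v mk bk) ω = some ⟨v, n, t⟩ := by
  induction l generalizing w ω n with
  | nil =>
    cases h
    exact ⟨0, by simp, rfl⟩
  | cons k l ih =>
    rw [widths, List.flatMap_cons] at h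
    obtain ⟨n₁, n₂, w', rfl, h1, h2⟩ := h.append
    rw [← List.length_range (n := m k)] at h1
    obtain ⟨t₁, ht₁, h1⟩ := h1.modifiedPerceptron
    obtain ⟨t₂, ht₂, h2⟩ := ih h2
    refine ⟨1 + (1 + (1 + t₁) + t₂), ?_, ?_⟩
    · rw [List.length_cons]
      have : (11 * d + 8) * (n₁ + n₂) = (11 * d + 8) * n₁ + (11 * d + 8) * n₂ := by ring
      omega
    · have h3 := (computes_unit (b k)).bind_eq_some (f := fun bk =>
        passiveModifiedPerceptron w (m k) bk) h1
      have h4 := (computes_unit (m k)).bind_eq_some (f := fun mk => unit (b k) >>= fun bk =>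
        passiveModifiedPerceptron w mk bk) h3
      have h5 := bind_eq_some (f := fun v => forEach l v (fun k v => do
        let mk ← unit (m k)
        let bk ← unit (b k)
        passiveModifiedPerceptron v mk bk)) h4 h2
      exact (computes_unit k).bind_eq_some (f := fun k => (unit (m k) >>= fun mk =>
        unit (b k) >>= fun bk => passiveModifiedPerceptron w mk bk) >>= fun v =>
        forEach l v (fun k v => do
        let mk ← unit (m k)
        let bk ← unit (b k)
        passiveModifiedPerceptron v mk bk)) h5

theorem Reaches.passivePerceptron {m : ℕ → ℕ} {b : ℕ → ℝ} {ε : ℝ}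
    {w v : EuclideanSpace ℝ (Fin d)} {ω : ℕ → Example d} {n : ℕ}
    (h : Reaches (widths m b (List.range' 1 ⌈Real.logb 2 (1 / ε)⌉₊)) w ω n v) :
    ∃ t ≤ (11 * d + 8) * n + 6 * ⌈Real.logb 2 (1 / ε)⌉₊ + 3,
      passivePerceptron w ε m b ω = some ⟨v, n, t⟩ := by
  obtain ⟨t, ht, h⟩ := h.epochs
  refine ⟨3 * (⌈Real.logb 2 (1 / ε)⌉₊ + 1) + t, ?_, ?_⟩
  · rw [List.length_range'] at ht
    omega
  · have h1 : Computes (ceilLogInv ε : Comp d ℕ) ⌈Real.logb 2 (1 / ε)⌉₊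
        (3 * (⌈Real.logb 2 (1 / ε)⌉₊ + 1)) := fun _ => rfl
    exact h1.bind_eq_some (f := fun k₀ => forEach (List.range' 1 k₀) w
      (fun k v => do
        let mk ← unit (m k)
        let bk ← unit (b k)
        passiveModifiedPerceptron v mk bk)) h

end PassivePerceptron


/-! ### The i.i.d. stream and the recursion for the failure probability. -/

namespace PassivePerceptron

/-- Put `z` in front of the stream `ω`. -/
def cons {X : Type*} (z : X) (ω : ℕ → X) : ℕ → X
  | 0 => z
  | n + 1 => ω n

theorem measurable_cons {X : Type*} [MeasurableSpace X] :
    Measurable fun p : X × (ℕ → X) => cons p.1 p.2 := by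
  rw [measurable_pi_iff]
  rintro (_ | n)
  · exact measurable_fst
  · exact (measurable_pi_apply n).comp measurable_snd

/-- The infinite product is determined by finite cylinders. Padding a cylinder with `univ` to an
initial segment of the coordinates makes it split into coordinate `0` and a cylinder in the tail. -/
theorem map_cons_prod_infinitePi {X : Type*} [MeasurableSpace X] (D : Measure X)
    [IsProbabilityMeasure D] :
    (D.prod (Measure.infinitePi fun _ : ℕ => D)).map (fun p => cons p.1 p.2) =
      Measure.infinitePi fun _ : ℕ => D := by
  classical
  refine Measure.eq_infinitePi _ fun s t ht => ?_
  obtain ⟨n, hn⟩ := s.exists_nat_subset_range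
  have hsub : s ⊆ Finset.range (n + 1) := hn.trans (Finset.range_mono (Nat.le_succ n))
  let t' : ℕ → Set X := fun i => if i ∈ s then t i else Set.univ
  have ht' : ∀ i, MeasurableSet (t' i) := fun i => by
    by_cases h : i ∈ s <;> simp [t', h, ht]
  have hprod : ∏ i ∈ s, D (t i) = ∏ i ∈ Finset.range (n + 1), D (t' i) := by
    rw [← Finset.prod_subset hsub (fun i _ hi => by simp [t', hi])]
    exact Finset.prod_congr rfl fun i hi => by simp [t', hi]
  have hset : (s : Set ℕ).pi t = (Finset.range (n + 1) : Set ℕ).pi t' := by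
    ext x
    simp only [Set.mem_pi, Finset.mem_coe, t']
    constructor
    · intro h i _
      by_cases hi : i ∈ s
      · simpa [hi] using h i hi
      · simp [hi]
    · intro h i hi
      simpa [hi] using h i (hsub hi)
  have hpre : (fun p : X × (ℕ → X) => cons p.1 p.2) ⁻¹' ((Finset.range (n + 1) : Set ℕ).pi t') =
      t' 0 ×ˢ ((Finset.range n : Set ℕ).pi fun i => t' (i + 1)) := by
    ext ⟨z, ω⟩
    simp only [Set.mem_preimage, Set.mem_pi, Finset.mem_coe, Finset.mem_range, Set.mem_prod]
    constructor
    · exact fun h => ⟨h 0 (by omega), fun i hi => h (i + 1) (by omega)⟩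
    · rintro ⟨h0, h⟩ (_ | i) hi
      · exact h0
      · exact h i (by omega)
  rw [hset, Measure.map_apply measurable_cons
    (MeasurableSet.pi (Finset.countable_toSet _) fun i _ => ht' i), hpre, Measure.prod_prod,
    Measure.infinitePi_pi _ (fun i _ => ht' _), hprod, Finset.prod_range_succ', mul_comm]

theorem infinitePi_apply_eq_lintegral {X : Type*} [MeasurableSpace X] (D : Measure X)
    [IsProbabilityMeasure D] {S : Set (ℕ → X)} (hS : MeasurableSet S) :
    Measure.infinitePi (fun _ : ℕ => D) S =
      ∫⁻ z, Measure.infinitePi (fun _ : ℕ => D) {ω | cons z ω ∈ S} ∂D := by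
  conv_lhs => rw [← map_cons_prod_infinitePi]
  rw [Measure.map_apply measurable_cons hS, Measure.prod_apply (measurable_cons hS)]
  rfl

variable {d : ℕ}

open Classical in
/-- Started at `w` with the band widths `bs`, the modified Perceptron does not stop in `G` within
`N` draws. -/
def Fails (G : Set (EuclideanSpace ℝ (Fin d))) :
    ℕ → List ℝ → EuclideanSpace ℝ (Fin d) → (ℕ → Example d) → Prop
  | _, [], w, _ => w ∉ G
  | 0, _ :: _, _, _ => True
  | N + 1, b :: bs, w, ω =>
    if InBand b w (ω 0) then Fails G N bs (step w (ω 0)) (tail ω)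
    else Fails G N (b :: bs) w (tail ω)

/-- The bridge from the probabilistic predicate to actual runs of the program. -/
theorem exists_reaches_of_not_fails {G : Set (EuclideanSpace ℝ (Fin d))} {N : ℕ} {bs : List ℝ}
    {w : EuclideanSpace ℝ (Fin d)} {ω : ℕ → Example d} (h : ¬ Fails G N bs w ω) :
    ∃ n ≤ N, ∃ v ∈ G, Reaches bs w ω n v := by
  induction N generalizing bs w ω with
  | zero =>
    cases bs with
    | nil => exact ⟨0, le_rfl, w, by simpa [Fails] using h, .nil _ _⟩
    | cons b bs => simp [Fails] at h
  | succ N ih =>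
    cases bs with
    | nil => exact ⟨0, by omega, w, by simpa [Fails] using h, .nil _ _⟩
    | cons b bs =>
      by_cases hb : InBand b w (ω 0)
      · rw [Fails, if_pos hb] at h
        obtain ⟨n, hn, v, hv, hr⟩ := ih h
        exact ⟨n + 1, by omega, v, hv, .accept hb hr⟩
      · rw [Fails, if_neg hb] at h
        obtain ⟨n, hn, v, hv, hr⟩ := ih h
        exact ⟨n + 1, by omega, v, hv, .reject hb hr⟩

theorem Reaches.le_length {bs : List ℝ} {w v : EuclideanSpace ℝ (Fin d)} {ω : ℕ → Example d}
    {n : ℕ} (h : Reaches bs w ω n v) : bs.length ≤ n := by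
  induction h with
  | nil => simp
  | reject _ _ ih => omega
  | accept _ _ ih => simpa using ih

theorem measurable_inner_example :
    Measurable fun p : EuclideanSpace ℝ (Fin d) × Example d =>
      inner ℝ p.1 (p.2.1 : EuclideanSpace ℝ (Fin d)) := by
  have : Measurable fun p : EuclideanSpace ℝ (Fin d) × Example d =>
      (p.2.1 : EuclideanSpace ℝ (Fin d)) := measurable_subtype_coe.comp measurable_snd.fst
  exact measurable_fst.inner this

theorem measurableSet_inBand_prod (b : ℝ) :
    MeasurableSet {p : EuclideanSpace ℝ (Fin d) × Example d | InBand b p.1 p.2} :=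
  (measurableSet_le measurable_const measurable_inner_example).inter
    (measurableSet_le measurable_inner_example measurable_const)

theorem measurableSet_inBand (b : ℝ) (w : EuclideanSpace ℝ (Fin d)) :
    MeasurableSet {z : Example d | InBand b w z} :=
  measurable_prodMk_left (measurableSet_inBand_prod b)

theorem measurable_step :
    Measurable fun p : EuclideanSpace ℝ (Fin d) × Example d => step p.1 p.2 := by
  classical
  have hx : Measurable fun p : EuclideanSpace ℝ (Fin d) × Example d =>
      (p.2.1 : EuclideanSpace ℝ (Fin d)) := measurable_subtype_coe.comp measurable_snd.fst
  have hy : Measurable fun p : EuclideanSpace ℝ (Fin d) × Example d => ((p.2.2 : ℤ) : ℝ) :=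
    (Measurable.of_discrete (f := fun y : Label => ((y : ℤ) : ℝ))).comp measurable_snd.snd
  have hi := measurable_inner_example (d := d)
  unfold step
  refine Measurable.ite (measurableSet_lt (hy.mul hi) measurable_const) ?_ measurable_fst
  exact measurable_fst.sub ((hi.const_mul 2).smul hx)

theorem measurable_tail : Measurable (tail : (ℕ → Example d) → ℕ → Example d) :=
  measurable_pi_iff.2 fun i => measurable_pi_apply (i + 1)

theorem measurableSet_fails {G : Set (EuclideanSpace ℝ (Fin d))} (hG : MeasurableSet G) (N : ℕ)
    (bs : List ℝ) :
    MeasurableSet {p : EuclideanSpace ℝ (Fin d) × (ℕ → Example d) | Fails G N bs p.1 p.2} := by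
  classical
  induction N generalizing bs with
  | zero =>
    cases bs with
    | nil => simp only [Fails]; exact measurable_fst hG.compl
    | cons b bs => simp [Fails]
  | succ N ih =>
    cases bs with
    | nil => simp only [Fails]; exact measurable_fst hG.compl
    | cons b bs =>
      have h0 : Measurable fun p : EuclideanSpace ℝ (Fin d) × (ℕ → Example d) => (p.1, p.2 0) :=
        measurable_fst.prodMk ((measurable_pi_apply 0).comp measurable_snd)
      have ht : Measurable fun p : EuclideanSpace ℝ (Fin d) × (ℕ → Example d) => tail p.2 :=
        measurable_tail.comp measurable_snd
      have hB := h0 (measurableSet_inBand_prod (d := d) b)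
      have h1 := ((measurable_step.comp h0).prodMk ht) (ih bs)
      have h2 := (measurable_fst.prodMk ht) (ih (b :: bs))
      convert (hB.inter h1).union (hB.compl.inter h2) using 1
      ext p
      by_cases hb : InBand b p.1 (p.2 0) <;> simp [Fails, hb]

-- The dynamic programming equation: after the first draw, the rest of the stream is again i.i.d.
-- from `D`, whatever was drawn.
open Classical in
theorem infinitePi_fails_cons (D : Measure (Example d)) [IsProbabilityMeasure D]
    {G : Set (EuclideanSpace ℝ (Fin d))} (hG : MeasurableSet G) (N : ℕ) (b : ℝ) (bs : List ℝ)
    (w : EuclideanSpace ℝ (Fin d)) :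
    Measure.infinitePi (fun _ : ℕ => D) {ω | Fails G (N + 1) (b :: bs) w ω} =
      ∫⁻ z, (if InBand b w z then
          Measure.infinitePi (fun _ : ℕ => D) {ω | Fails G N bs (step w z) ω}
        else Measure.infinitePi (fun _ : ℕ => D) {ω | Fails G N (b :: bs) w ω}) ∂D := by
  have hS : MeasurableSet {ω : ℕ → Example d | Fails G (N + 1) (b :: bs) w ω} :=
    measurable_prodMk_left (measurableSet_fails hG (N + 1) (b :: bs))
  rw [infinitePi_apply_eq_lintegral D hS]
  refine lintegral_congr fun z => ?_
  have : ∀ ω : ℕ → Example d, tail (cons z ω) = ω := fun ω => rfl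
  by_cases hb : InBand b w z
  · simp [Fails, cons, hb, this]
  · simp [Fails, cons, hb, this]

/-- From every unit vector `w` the run with band widths `bs` ends outside of `G`, or needs more
than `N` draws, with probability at most `Φ w + exp (length bs - μ N)`. -/
def FailBound (D : Measure (Example d)) [IsProbabilityMeasure D]
    (G : Set (EuclideanSpace ℝ (Fin d))) (μ : ℝ) (bs : List ℝ)
    (Φ : EuclideanSpace ℝ (Fin d) → ENNReal) : Prop :=
  ∀ (N : ℕ) (w : EuclideanSpace ℝ (Fin d)), ‖w‖ = 1 →
    Measure.infinitePi (fun _ : ℕ => D) {ω | Fails G N bs w ω} ≤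
      Φ w + ENNReal.ofReal (Real.exp (bs.length - μ * N))

/-- On a mistake the update is the reflection in the hyperplane orthogonal to the unit vector `x`.
-/
theorem norm_step {w : EuclideanSpace ℝ (Fin d)} (hw : ‖w‖ = 1) (z : Example d) :
    ‖step w z‖ = 1 := by
  unfold step
  split_ifs with h
  · have hz : ‖(z.1 : EuclideanSpace ℝ (Fin d))‖ = 1 := by simp
    rw [← sq_eq_sq₀ (norm_nonneg _) zero_le_one, ← real_inner_self_eq_norm_sq]
    simp only [inner_sub_left, inner_sub_right, inner_smul_left, inner_smul_right,
      real_inner_self_eq_norm_sq, hw, hz, real_inner_comm w]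
    simp
    ring
  · exact hw

theorem FailBound.nil (D : Measure (Example d)) [IsProbabilityMeasure D]
    (G : Set (EuclideanSpace ℝ (Fin d))) (μ : ℝ) (Φ : EuclideanSpace ℝ (Fin d) → ENNReal)
    (hΦ : ∀ w, ‖w‖ = 1 → w ∉ G → 1 ≤ Φ w) : FailBound D G μ [] Φ := by
  intro N w hw
  refine le_trans ?_ le_self_add
  by_cases hG : w ∈ G
  · have : {ω : ℕ → Example d | Fails G N [] w ω} = ∅ := by
      ext ω; cases N <;> simp [Fails, hG]
    simp [this]
  · exact prob_le_one.trans (hΦ w hw hG)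

theorem FailBound.mono {D : Measure (Example d)} [IsProbabilityMeasure D]
    {G : Set (EuclideanSpace ℝ (Fin d))} {μ : ℝ} {bs : List ℝ}
    {Φ Φ' : EuclideanSpace ℝ (Fin d) → ENNReal} (h : FailBound D G μ bs Φ)
    (hΦ : ∀ w, ‖w‖ = 1 → Φ w ≤ Φ' w ∨ 1 ≤ Φ' w) : FailBound D G μ bs Φ' := by
  intro N w hw
  rcases hΦ w hw with h1 | h1
  · exact (h N w hw).trans (by gcongr)
  · exact prob_le_one.trans (h1.trans le_self_add)

/-- With probability `p` a draw uses up one band width, and the budget drops by one in any case; the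
inequality makes `exp (length - μ N)` a supersolution of this recursion. It reduces to `e μ ≤ p (e -
1)`, which follows from `2 μ ≤ p` and `e ≥ 2`. -/
theorem exp_drop {p μ x : ℝ} (hp : 0 ≤ p) (hμ : 2 * μ ≤ p) :
    p * Real.exp x + (1 - p) * Real.exp (x + 1) ≤ Real.exp (x + 1 - μ) := by
  have h1 : Real.exp (x + 1) = Real.exp x * Real.exp 1 := Real.exp_add _ _
  have h2 : Real.exp (x + 1 - μ) = Real.exp x * Real.exp 1 * Real.exp (-μ) := by
    rw [sub_eq_add_neg, Real.exp_add, h1]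
  have h3 : 2 ≤ Real.exp 1 := by have := Real.add_one_le_exp (1 : ℝ); linarith
  have h4 : 1 - μ ≤ Real.exp (-μ) := by have := Real.add_one_le_exp (-μ); linarith
  have h5 := Real.exp_pos x
  rw [h1, h2]
  have h6 : p + (1 - p) * Real.exp 1 ≤ Real.exp 1 * Real.exp (-μ) := by
    have h7 : Real.exp 1 * (1 - μ) ≤ Real.exp 1 * Real.exp (-μ) := by gcongr
    nlinarith
  nlinarith

/-- Induction on the budget with `w` fixed: a rejection changes neither the iterate nor the widths,
so the induction hypothesis covers it, while an acceptance passes to the bound `Φ'` at the new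
iterate. Where `1 ≤ Φ w` nothing has to be shown, so the averaging inequality is needed only at the
remaining `w`. -/
theorem FailBound.cons {D : Measure (Example d)} [IsProbabilityMeasure D]
    {G : Set (EuclideanSpace ℝ (Fin d))} (hG : MeasurableSet G) {μ : ℝ} {b : ℝ} {bs : List ℝ}
    {Φ Φ' : EuclideanSpace ℝ (Fin d) → ENNReal} (h : FailBound D G μ bs Φ')
    (hμ : ∀ w, ‖w‖ = 1 → 2 * μ ≤ D.real {z | InBand b w z})
    (hΦ : ∀ w, ‖w‖ = 1 → 1 ≤ Φ w ∨
      ∫⁻ z in {z | InBand b w z}, Φ' (step w z) ∂D ≤ D {z | InBand b w z} * Φ w) :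
    FailBound D G μ (b :: bs) Φ := by
  classical
  intro N w hw
  rcases hΦ w hw with h1 | h1
  · exact prob_le_one.trans (h1.trans le_self_add)
  induction N with
  | zero =>
    refine prob_le_one.trans (le_trans ?_ le_add_self)
    rw [← ENNReal.ofReal_one]
    refine ENNReal.ofReal_le_ofReal (Real.one_le_exp ?_)
    simp only [Nat.cast_zero, mul_zero, sub_zero]
    positivity
  | succ N ih =>
    set B : Set (Example d) := {z | InBand b w z} with hB
    have hBm : MeasurableSet B := measurableSet_inBand b w
    set x : ℝ := bs.length - μ * N with hx
    have e1 : (((b :: bs).length : ℕ) : ℝ) - μ * N = x + 1 := by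
      simp only [List.length_cons, hx]; push_cast; ring
    have e2 : (((b :: bs).length : ℕ) : ℝ) - μ * (N + 1 : ℕ) = x + 1 - μ := by
      simp only [List.length_cons, hx]; push_cast; ring
    rw [e1] at ih
    rw [e2, infinitePi_fails_cons D hG]
    have hle : ∀ z, (if InBand b w z then
          Measure.infinitePi (fun _ : ℕ => D) {ω | Fails G N bs (step w z) ω}
        else Measure.infinitePi (fun _ : ℕ => D) {ω | Fails G N (b :: bs) w ω}) ≤
        B.indicator (fun z => Φ' (step w z) + ENNReal.ofReal (Real.exp x)) z +
        Bᶜ.indicator (fun _ => Φ w + ENNReal.ofReal (Real.exp (x + 1))) z := by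
      intro z
      by_cases hz : InBand b w z
      · have hz' : z ∈ B := hz
        simpa [hz, hz'] using h N (step w z) (norm_step hw z)
      · have hz' : z ∉ B := hz
        simpa [hz, hz'] using ih
    refine (lintegral_mono hle).trans ?_
    rw [lintegral_add_right _ (measurable_const.indicator hBm.compl), lintegral_indicator hBm,
      lintegral_indicator hBm.compl, lintegral_add_right _ measurable_const]
    simp only [lintegral_const, Measure.restrict_apply MeasurableSet.univ, Set.univ_inter]
    have hsum : D B + D Bᶜ = 1 := by rw [measure_add_measure_compl hBm, measure_univ]
    have key : ENNReal.ofReal (Real.exp x) * D B + ENNReal.ofReal (Real.exp (x + 1)) * D Bᶜ ≤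
        ENNReal.ofReal (Real.exp (x + 1 - μ)) := by
      rw [← ofReal_measureReal (μ := D) (s := B), ← ofReal_measureReal (μ := D) (s := Bᶜ),
        ← ENNReal.ofReal_mul (Real.exp_pos _).le, ← ENNReal.ofReal_mul (Real.exp_pos _).le,
        ← ENNReal.ofReal_add (by positivity) (by positivity)]
      refine ENNReal.ofReal_le_ofReal ?_
      rw [probReal_compl_eq_one_sub hBm]
      have := exp_drop (x := x) measureReal_nonneg (hμ w hw)
      linarith
    calc ∫⁻ z in B, Φ' (step w z) ∂D + ENNReal.ofReal (Real.exp x) * D B +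
          (Φ w + ENNReal.ofReal (Real.exp (x + 1))) * D Bᶜ
        ≤ D B * Φ w + ENNReal.ofReal (Real.exp x) * D B +
          (Φ w + ENNReal.ofReal (Real.exp (x + 1))) * D Bᶜ := by gcongr
      _ = Φ w * (D B + D Bᶜ) + (ENNReal.ofReal (Real.exp x) * D B +
          ENNReal.ofReal (Real.exp (x + 1)) * D Bᶜ) := by ring
      _ ≤ Φ w + ENNReal.ofReal (Real.exp (x + 1 - μ)) := by
          rw [hsum, mul_one]
          gcongr

end PassivePerceptron


/-! ### Symmetries of the uniform distribution on the sphere. -/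

namespace PassivePerceptron

open scoped InnerProductSpace Pointwise

variable {d : ℕ}

theorem mem_sphere_map (R : EuclideanSpace ℝ (Fin d) ≃ₗᵢ[ℝ] EuclideanSpace ℝ (Fin d))
    (x : Sphere d) : R x ∈ Metric.sphere (0 : EuclideanSpace ℝ (Fin d)) 1 := by
  rw [mem_sphere_zero_iff_norm, R.norm_map, norm_eq_of_mem_sphere]

/-- The action of a linear isometry on the unit sphere. -/
noncomputable def sphereEquiv
    (R : EuclideanSpace ℝ (Fin d) ≃ₗᵢ[ℝ] EuclideanSpace ℝ (Fin d)) :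
    Sphere d ≃ᵐ Sphere d where
  toFun x := ⟨R x, mem_sphere_map R x⟩
  invFun x := ⟨R.symm x, mem_sphere_map R.symm x⟩
  left_inv x := by simp
  right_inv x := by simp
  measurable_toFun := (R.continuous.measurable.comp measurable_subtype_coe).subtype_mk
  measurable_invFun := (R.symm.continuous.measurable.comp measurable_subtype_coe).subtype_mk

/-- Up to a constant, `toSphere` measures a set by the volume of the cone over it, and a linear
isometry carries cones to cones and preserves volume. -/
theorem measurePreserving_sphereEquiv
    (R : EuclideanSpace ℝ (Fin d) ≃ₗᵢ[ℝ] EuclideanSpace ℝ (Fin d)) :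
    MeasurePreserving (sphereEquiv R) (uniformSphere d) (uniformSphere d) := by
  suffices h : MeasurePreserving (sphereEquiv R)
      (volume : Measure (EuclideanSpace ℝ (Fin d))).toSphere
      (volume : Measure (EuclideanSpace ℝ (Fin d))).toSphere from h.smul_measure _
  refine ⟨(sphereEquiv R).measurable, ?_⟩
  ext s hs
  rw [Measure.map_apply (sphereEquiv R).measurable hs, Measure.toSphere_apply' _ hs,
    Measure.toSphere_apply' _ ((sphereEquiv R).measurable hs)]
  congr 1
  have h : Set.Ioo (0 : ℝ) 1 • ((↑) '' (sphereEquiv R ⁻¹' s) : Set (EuclideanSpace ℝ (Fin d))) =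
      R ⁻¹' (Set.Ioo (0 : ℝ) 1 • ((↑) '' s)) := by
    ext x
    simp only [Set.mem_smul, Set.mem_image, Set.mem_preimage, exists_exists_and_eq_and]
    constructor
    · rintro ⟨r, hr, y, hy, rfl⟩
      exact ⟨r, hr, sphereEquiv R y, hy, by simp [sphereEquiv]⟩
    · rintro ⟨r, hr, y, hy, hx⟩
      refine ⟨r, hr, (sphereEquiv R).symm y, by simpa using hy, R.injective ?_⟩
      rw [← hx, map_smul]
      simp [sphereEquiv]
  rw [h]
  exact R.measurePreserving.measure_preimage_equiv (f := R.toMeasurableEquiv) _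

/-- For unit vectors `p` and `q` with `⟪p, w⟫ = ⟪q, w⟫`, a measure preserving map of the sphere
that interchanges `⟪p, ·⟫` and `⟪q, ·⟫` and preserves `⟪w, ·⟫`. -/
theorem exists_measurePreserving_swap {p q w : EuclideanSpace ℝ (Fin d)} (hp : ‖p‖ = 1)
    (hq : ‖q‖ = 1) (hw : ⟪p, w⟫_ℝ = ⟪q, w⟫_ℝ) :
    ∃ f : Sphere d ≃ᵐ Sphere d, MeasurePreserving f (uniformSphere d) (uniformSphere d) ∧
      ∀ x : Sphere d, ⟪p, (f x : EuclideanSpace ℝ (Fin d))⟫_ℝ = ⟪q, (x : EuclideanSpace ℝ (Fin d))⟫_ℝ ∧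
        ⟪w, (f x : EuclideanSpace ℝ (Fin d))⟫_ℝ = ⟪w, (x : EuclideanSpace ℝ (Fin d))⟫_ℝ := by
  -- The reflection in the hyperplane orthogonal to `p - q` exchanges `p` and `q`, which have equal
  -- norms, and fixes `w`, which lies in the hyperplane.
  set R := Submodule.reflection (ℝ ∙ (p - q))ᗮ with hR
  refine ⟨sphereEquiv R, measurePreserving_sphereEquiv R, fun x => ?_⟩
  have hRp : R p = q := Submodule.reflection_sub (by rw [hp, hq])
  have hRw : R w = w := by
    refine Submodule.reflection_mem_subspace_eq_self ?_
    rw [Submodule.mem_orthogonal_singleton_iff_inner_right, inner_sub_left, hw, sub_self]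
  have hsymm : ∀ y : EuclideanSpace ℝ (Fin d), ⟪y, R x⟫_ℝ = ⟪R y, (x : EuclideanSpace ℝ (Fin d))⟫_ℝ := by
    intro y
    rw [← R.inner_map_map y, hR, Submodule.reflection_reflection]
  change ⟪p, R x⟫_ℝ = _ ∧ ⟪w, R x⟫_ℝ = _
  rw [hsymm, hsymm, hRp, hRw]
  exact ⟨rfl, rfl⟩

/-- The form in which symmetry is used: unit vectors making the same angle with `w` have the same
joint statistics with it. The choice `w = 0` gives plain rotation invariance. -/
theorem integral_swap {p q w : EuclideanSpace ℝ (Fin d)} (hp : ‖p‖ = 1)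
    (hq : ‖q‖ = 1) (hw : ⟪p, w⟫_ℝ = ⟪q, w⟫_ℝ) (F : ℝ → ℝ → ℝ) :
    ∫ x, F ⟪w, (x : EuclideanSpace ℝ (Fin d))⟫_ℝ ⟪p, (x : EuclideanSpace ℝ (Fin d))⟫_ℝ
      ∂uniformSphere d =
    ∫ x, F ⟪w, (x : EuclideanSpace ℝ (Fin d))⟫_ℝ ⟪q, (x : EuclideanSpace ℝ (Fin d))⟫_ℝ
      ∂uniformSphere d := by
  obtain ⟨f, hf, h⟩ := exists_measurePreserving_swap hp hq hw
  rw [← hf.integral_comp f.measurableEmbedding]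
  simp only [(h _).1, (h _).2]

theorem abs_inner_sphere_le {w : EuclideanSpace ℝ (Fin d)} (hw : ‖w‖ = 1) (x : Sphere d) :
    |⟪w, (x : EuclideanSpace ℝ (Fin d))⟫_ℝ| ≤ 1 := by
  have := abs_real_inner_le_norm w (x : EuclideanSpace ℝ (Fin d))
  simpa [hw] using this

theorem continuous_inner_sphere (w : EuclideanSpace ℝ (Fin d)) :
    Continuous fun x : Sphere d => ⟪w, (x : EuclideanSpace ℝ (Fin d))⟫_ℝ :=
  continuous_const.inner continuous_subtype_val

theorem integrable_weight_mul {ν : Measure (Sphere d)} [IsFiniteMeasure ν]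
    {h : ℝ → ℝ} (hh : Measurable h) (hh0 : ∀ t, 0 ≤ h t) (hh1 : ∀ t, h t ≤ 1)
    (w : EuclideanSpace ℝ (Fin d)) {g : Sphere d → ℝ} (hg : Continuous g) :
    Integrable (fun x : Sphere d => h ⟪w, (x : EuclideanSpace ℝ (Fin d))⟫_ℝ * g x) ν := by
  have hgi : Integrable g ν := by
    refine hg.integrable_of_hasCompactSupport ?_
    exact HasCompactSupport.of_compactSpace g
  refine hgi.bdd_mul (c := 1) (hh.comp (continuous_inner_sphere w).measurable).aestronglyMeasurable ?_
  exact Filter.Eventually.of_forall fun x => by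
    rw [Real.norm_eq_abs, abs_of_nonneg (hh0 _)]; exact hh1 _

end PassivePerceptron


/-! ### Moments of a coordinate orthogonal to `w`, weighted by a function of `w·x`. -/

namespace PassivePerceptron

open scoped InnerProductSpace

variable {d : ℕ}

/-- The ambient Euclidean space. -/
abbrev Vec (d : ℕ) : Type := EuclideanSpace ℝ (Fin d)

/-- The inner product of a vector with a point of the sphere. -/
noncomputable abbrev ip (w : Vec d) (x : Sphere d) : ℝ := ⟪w, (x : Vec d)⟫_ℝ

theorem exists_orthonormalBasis_extending (hd : 3 ≤ d) {w : Vec d} (hw : ‖w‖ = 1) :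
    ∃ e : OrthonormalBasis (Fin d) ℝ (Vec d), e ⟨0, by omega⟩ = w := by
  have := Orthonormal.exists_orthonormalBasis_extension_of_card_eq (𝕜 := ℝ) (E := Vec d)
    (ι := Fin d) (by simp) (v := fun _ => w) (s := {⟨0, by omega⟩})
    (by
      constructor
      · rintro ⟨i, hi⟩; simpa using hw
      · rintro ⟨i, hi⟩ ⟨j, hj⟩ hij
        exact absurd (Subtype.ext ((Set.mem_singleton_iff.1 hi).trans
          (Set.mem_singleton_iff.1 hj).symm)) hij)
  obtain ⟨e, he⟩ := this
  exact ⟨e, he _ rfl⟩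

theorem sum_erase_sq_ip {e : OrthonormalBasis (Fin d) ℝ (Vec d)} (i₀ : Fin d) (x : Sphere d) :
    ∑ i ∈ Finset.univ.erase i₀, ip (e i) x ^ 2 = 1 - ip (e i₀) x ^ 2 := by
  have h := e.sum_sq_norm_inner_right (x : Vec d)
  rw [norm_eq_of_mem_sphere, ← Finset.add_sum_erase _ _ (Finset.mem_univ i₀)] at h
  simp only [Real.norm_eq_abs, sq_abs] at h
  linarith

section Moments

variable [IsProbabilityMeasure (uniformSphere d)] {h : ℝ → ℝ}

/-- All directions orthogonal to `w` have the same second moment, and in an orthonormal basis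
containing `w` the other squares add up to `1 - (w·x)²`. -/
theorem secondMoment (hd : 3 ≤ d) (hh : Measurable h) (hh0 : ∀ t, 0 ≤ h t) (hh1 : ∀ t, h t ≤ 1)
    {w v : Vec d} (hw : ‖w‖ = 1) (hv : ‖v‖ = 1) (hwv : ⟪v, w⟫_ℝ = 0) :
    (d - 1 : ℝ) * ∫ x, h (ip w x) * ip v x ^ 2 ∂uniformSphere d =
      ∫ x, h (ip w x) * (1 - ip w x ^ 2) ∂uniformSphere d := by
  obtain ⟨e, he⟩ := exists_orthonormalBasis_extending hd hw
  set i₀ : Fin d := ⟨0, by omega⟩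
  have h1 : ∀ i ∈ Finset.univ.erase i₀, ∫ x, h (ip w x) * ip (e i) x ^ 2 ∂uniformSphere d =
      ∫ x, h (ip w x) * ip v x ^ 2 ∂uniformSphere d := fun i hi =>
    integral_swap (e.norm_eq_one i) hv (by
      rw [hwv, ← he]; exact e.inner_eq_zero (Finset.ne_of_mem_erase hi)) fun s t => h s * t ^ 2
  have h2 : ∫ x, h (ip w x) * (1 - ip w x ^ 2) ∂uniformSphere d =
      ∑ i ∈ Finset.univ.erase i₀, ∫ x, h (ip w x) * ip (e i) x ^ 2 ∂uniformSphere d := by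
    rw [← integral_finsetSum]
    · refine integral_congr_ae (Filter.Eventually.of_forall fun x => ?_)
      simp only
      rw [← Finset.mul_sum, sum_erase_sq_ip, he]
    · exact fun i _ => integrable_weight_mul hh hh0 hh1 w ((continuous_inner_sphere _).pow 2)
  rw [h2, Finset.sum_congr rfl h1, Finset.sum_const, Finset.card_erase_of_mem (Finset.mem_univ _),
    Finset.card_univ, Fintype.card_fin, nsmul_eq_mul, Nat.cast_sub (by omega), Nat.cast_one]

/-- The unit vectors `(v ± v')/√2` have the same fourth moment as `v` and `v'`. The sum of their
fourth powers is `v⁴/2 + 3 v² v'² + v'⁴/2`, and comparing expectations gives the claim. -/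
theorem mixedMoment (hh : Measurable h) (hh0 : ∀ t, 0 ≤ h t) (hh1 : ∀ t, h t ≤ 1)
    {w v v' : Vec d} (hv : ‖v‖ = 1) (hv' : ‖v'‖ = 1) (hwv : ⟪v, w⟫_ℝ = 0)
    (hwv' : ⟪v', w⟫_ℝ = 0) (hvv' : ⟪v, v'⟫_ℝ = 0) :
    3 * ∫ x, h (ip w x) * (ip v x ^ 2 * ip v' x ^ 2) ∂uniformSphere d =
      ∫ x, h (ip w x) * ip v x ^ 4 ∂uniformSphere d := by
  set a : ℝ := (√2)⁻¹ with ha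
  have ha2 : a ^ 2 = 1 / 2 := by rw [ha, inv_pow, Real.sq_sqrt (by norm_num)]; norm_num
  have ha4 : a ^ 4 = 1 / 4 := by rw [show a ^ 4 = (a ^ 2) ^ 2 by ring, ha2]; norm_num
  have hn : ∀ s : ℝ, s ^ 2 = 1 → ‖a • (v + s • v')‖ = 1 := by
    intro s hs
    rw [← sq_eq_sq₀ (norm_nonneg _) zero_le_one, norm_smul, mul_pow, Real.norm_eq_abs, sq_abs, ha2,
      norm_add_sq_real, norm_smul, mul_pow, Real.norm_eq_abs, sq_abs, hs, hv, hv',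
      inner_smul_right, hvv']
    norm_num
  have ho : ∀ s : ℝ, ⟪a • (v + s • v'), w⟫_ℝ = 0 := by
    intro s
    simp [inner_smul_left, inner_add_left, hwv, hwv']
  have hI : ∀ s : ℝ, s ^ 2 = 1 → ∫ x, h (ip w x) * ip (a • (v + s • v')) x ^ 4 ∂uniformSphere d =
      ∫ x, h (ip w x) * ip v x ^ 4 ∂uniformSphere d := fun s hs =>
    integral_swap (hn s hs) hv (by rw [ho, hwv]) fun s t => h s * t ^ 4
  have hI' : ∫ x, h (ip w x) * ip v' x ^ 4 ∂uniformSphere d =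
      ∫ x, h (ip w x) * ip v x ^ 4 ∂uniformSphere d :=
    integral_swap hv' hv (by rw [hwv', hwv]) fun s t => h s * t ^ 4
  have hint : ∀ {g : Sphere d → ℝ}, Continuous g →
      Integrable (fun x => h (ip w x) * g x) (uniformSphere d) := fun hg =>
    integrable_weight_mul hh hh0 hh1 w hg
  have c1 : ∀ u : Vec d, Continuous fun x : Sphere d => ip u x := continuous_inner_sphere
  have key : ∫ x, h (ip w x) * ip (a • (v + (1 : ℝ) • v')) x ^ 4 ∂uniformSphere d +
      ∫ x, h (ip w x) * ip (a • (v + (-1 : ℝ) • v')) x ^ 4 ∂uniformSphere d =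
      (1 / 2) * ∫ x, h (ip w x) * ip v x ^ 4 ∂uniformSphere d +
      3 * ∫ x, h (ip w x) * (ip v x ^ 2 * ip v' x ^ 2) ∂uniformSphere d +
      (1 / 2) * ∫ x, h (ip w x) * ip v' x ^ 4 ∂uniformSphere d := by
    have i4 : ∀ u : Vec d, Integrable (fun x => h (ip w x) * ip u x ^ 4) (uniformSphere d) :=
      fun u => hint ((c1 u).pow 4)
    have i22 : Integrable (fun x => h (ip w x) * (ip v x ^ 2 * ip v' x ^ 2)) (uniformSphere d) :=
      hint (((c1 v).pow 2).mul ((c1 v').pow 2))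
    have i5 : Integrable (fun x => 1 / 2 * (h (ip w x) * ip v x ^ 4) +
        3 * (h (ip w x) * (ip v x ^ 2 * ip v' x ^ 2))) (uniformSphere d) :=
      ((i4 v).const_mul _).add (i22.const_mul _)
    rw [← integral_add (i4 _) (i4 _), ← integral_const_mul, ← integral_const_mul,
      ← integral_const_mul, ← integral_add ((i4 v).const_mul _) (i22.const_mul _),
      ← integral_add i5 ((i4 v').const_mul _)]
    refine integral_congr_ae (Filter.Eventually.of_forall fun x => ?_)
    simp only [ip, inner_smul_left, inner_add_left, mul_pow, ha4, conj_trivial]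
    ring
  rw [hI 1 (by norm_num), hI (-1) (by norm_num), hI'] at key
  linarith

/-- Expand `(1 - (w·x)²)² ≤ 1` as a double sum over the basis. The `d - 1` diagonal terms equal `M`
and the others `M/3` by `mixedMoment`, for a total of `(d² - 1) M / 3`. -/
theorem fourthMoment (hd : 3 ≤ d) (hh : Measurable h) (hh0 : ∀ t, 0 ≤ h t) (hh1 : ∀ t, h t ≤ 1)
    {w v : Vec d} (hw : ‖w‖ = 1) (hv : ‖v‖ = 1) (hwv : ⟪v, w⟫_ℝ = 0) :
    ((d : ℝ) ^ 2 - 1) * ∫ x, h (ip w x) * ip v x ^ 4 ∂uniformSphere d ≤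
      3 * ∫ x, h (ip w x) ∂uniformSphere d := by
  obtain ⟨e, he⟩ := exists_orthonormalBasis_extending hd hw
  set i₀ : Fin d := ⟨0, by omega⟩
  set M := ∫ x, h (ip w x) * ip v x ^ 4 ∂uniformSphere d with hM
  have hint : ∀ {g : Sphere d → ℝ}, Continuous g →
      Integrable (fun x => h (ip w x) * g x) (uniformSphere d) := fun hg =>
    integrable_weight_mul hh hh0 hh1 w hg
  have c1 : ∀ u : Vec d, Continuous fun x : Sphere d => ip u x := continuous_inner_sphere
  have ho : ∀ i ∈ Finset.univ.erase i₀, ⟪e i, w⟫_ℝ = 0 := fun i hi => by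
    rw [← he]; exact e.inner_eq_zero (Finset.ne_of_mem_erase hi)
  have h1 : ∀ i ∈ Finset.univ.erase i₀, ∫ x, h (ip w x) * ip (e i) x ^ 4 ∂uniformSphere d = M :=
    fun i hi => integral_swap (e.norm_eq_one i) hv (by rw [hwv, ho i hi]) fun s t => h s * t ^ 4
  have h2 : ∀ i ∈ Finset.univ.erase i₀, ∀ j ∈ Finset.univ.erase i₀,
      ∫ x, h (ip w x) * (ip (e i) x ^ 2 * ip (e j) x ^ 2) ∂uniformSphere d =
        M / 3 + if i = j then 2 * M / 3 else 0 := by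
    intro i hi j hj
    split_ifs with hij
    · subst hij
      rw [← h1 i hi, show ∀ y : ℝ, y / 3 + 2 * y / 3 = y by intro y; ring]
      congr 1
      ext x
      ring
    · have := mixedMoment hh hh0 hh1 (e.norm_eq_one i) (e.norm_eq_one j) (ho i hi) (ho j hj)
        (e.inner_eq_zero hij)
      rw [h1 i hi] at this
      linarith
  have h3 : ∫ x, h (ip w x) * (1 - ip w x ^ 2) ^ 2 ∂uniformSphere d =
      ∑ i ∈ Finset.univ.erase i₀, ∑ j ∈ Finset.univ.erase i₀,
        ∫ x, h (ip w x) * (ip (e i) x ^ 2 * ip (e j) x ^ 2) ∂uniformSphere d := by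
    have hi2 : ∀ i j, Integrable (fun x => h (ip w x) * (ip (e i) x ^ 2 * ip (e j) x ^ 2))
        (uniformSphere d) := fun i j => hint (((c1 _).pow 2).mul ((c1 _).pow 2))
    rw [Finset.sum_congr rfl fun i _ => (integral_finsetSum _ fun j _ => hi2 i j).symm,
      ← integral_finsetSum _ fun i _ => integrable_finsetSum _ fun j _ => hi2 i j]
    refine integral_congr_ae (Filter.Eventually.of_forall fun x => ?_)
    simp only
    simp_rw [← Finset.mul_sum]
    rw [← Finset.sum_mul, sum_erase_sq_ip, he]
    ring
  have hcard : ((Finset.univ.erase i₀).card : ℝ) = d - 1 := by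
    rw [Finset.card_erase_of_mem (Finset.mem_univ _), Finset.card_univ, Fintype.card_fin,
      Nat.cast_sub (by omega), Nat.cast_one]
  have h4 : ∫ x, h (ip w x) * (1 - ip w x ^ 2) ^ 2 ∂uniformSphere d =
      (d - 1) * ((d - 1) * (M / 3) + 2 * M / 3) := by
    rw [h3, Finset.sum_congr rfl fun i hi => Finset.sum_congr rfl (h2 i hi)]
    have : ∀ i ∈ Finset.univ.erase i₀, (∑ j ∈ Finset.univ.erase i₀,
        (M / 3 + if i = j then 2 * M / 3 else 0)) = (d - 1) * (M / 3) + 2 * M / 3 := by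
      intro i hi
      rw [Finset.sum_add_distrib, Finset.sum_const, nsmul_eq_mul, hcard, Finset.sum_ite_eq,
        if_pos hi]
    rw [Finset.sum_congr rfl this, Finset.sum_const, nsmul_eq_mul, hcard]
  have h5 : ∫ x, h (ip w x) * (1 - ip w x ^ 2) ^ 2 ∂uniformSphere d ≤
      ∫ x, h (ip w x) ∂uniformSphere d := by
    have hone : Integrable (fun x => h (ip w x)) (uniformSphere d) := by
      simpa using hint (g := fun _ => 1) continuous_const
    refine integral_mono (hint ((continuous_const.sub ((c1 _).pow 2)).pow 2)) hone fun x => ?_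
    have hx := abs_le.1 (abs_inner_sphere_le hw x)
    have h6 : ip w x ^ 2 ≤ 1 := by nlinarith
    have h7 : (1 - ip w x ^ 2) ^ 2 ≤ 1 := by nlinarith [sq_nonneg (ip w x)]
    exact mul_le_of_le_one_right (hh0 _) h7
  rw [h4] at h5
  nlinarith

/-- The difference of the two sides is half of `z (τz - 1)² (τz + 2)` with `z = |y|`. This minorant,
tangent to `|y|` at `1/τ`, lets second and fourth moments bound a first absolute moment. -/
theorem abs_lower_bound {τ y : ℝ} (hτ : 0 ≤ τ) :
    (3 / 2) * τ * y ^ 2 - (1 / 2) * τ ^ 3 * y ^ 4 ≤ |y| := by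
  set z := |y| with hz
  have hz0 : 0 ≤ z := abs_nonneg _
  have e2 : y ^ 2 = z ^ 2 := (sq_abs y).symm
  have e4 : y ^ 4 = z ^ 4 := by rw [show y ^ 4 = (y ^ 2) ^ 2 by ring, e2]; ring
  rw [e2, e4]
  have : 0 ≤ z * ((τ * z - 1) ^ 2 * (τ * z + 2)) := by positivity
  nlinarith

theorem abs_moment_lower_bound (hd : 3 ≤ d) (hh : Measurable h) (hh0 : ∀ t, 0 ≤ h t)
    (hh1 : ∀ t, h t ≤ 1) {w v : Vec d} (hw : ‖w‖ = 1) (hv : ‖v‖ = 1) (hwv : ⟪v, w⟫_ℝ = 0)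
    {b : ℝ} (hb : d * b ^ 2 ≤ 1 / 100) (hsupp : ∀ t, h t ≠ 0 → t ^ 2 ≤ b ^ 2) :
    1 / (2 * √d) * ∫ x, h (ip w x) ∂uniformSphere d ≤
      ∫ x, h (ip w x) * |ip v x| ∂uniformSphere d := by
  have hint : ∀ {g : Sphere d → ℝ}, Continuous g →
      Integrable (fun x => h (ip w x) * g x) (uniformSphere d) := fun hg =>
    integrable_weight_mul hh hh0 hh1 w hg
  have c1 : ∀ u : Vec d, Continuous fun x : Sphere d => ip u x := continuous_inner_sphere
  have hd3 : (3 : ℝ) ≤ d := by exact_mod_cast hd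
  set J := ∫ x, h (ip w x) ∂uniformSphere d with hJ
  have hJ0 : 0 ≤ J := integral_nonneg fun x => hh0 _
  set M₂ := ∫ x, h (ip w x) * ip v x ^ 2 ∂uniformSphere d with hM₂
  set M₄ := ∫ x, h (ip w x) * ip v x ^ 4 ∂uniformSphere d with hM₄
  have h2 : (1 - b ^ 2) * J ≤ (d - 1) * M₂ := by
    rw [hM₂, secondMoment hd hh hh0 hh1 hw hv hwv, hJ, ← integral_const_mul]
    have hone : Integrable (fun x => h (ip w x)) (uniformSphere d) := by
      simpa using hint (g := fun _ => 1) continuous_const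
    refine integral_mono (hone.const_mul _) (hint (continuous_const.sub ((c1 _).pow 2)))
      fun x => ?_
    simp only
    by_cases hx : h (ip w x) = 0
    · simp [hx]
    · have := hsupp _ hx
      nlinarith [hh0 (ip w x)]
  have h4 : ((d : ℝ) ^ 2 - 1) * M₄ ≤ 3 * J := fourthMoment hd hh hh0 hh1 hw hv hwv
  set τ := √(d / 3) with hτ
  have hτ0 : 0 ≤ τ := Real.sqrt_nonneg _
  have hτ2 : τ ^ 2 = d / 3 := Real.sq_sqrt (by positivity)
  have hlow : (3 / 2) * τ * M₂ - (1 / 2) * τ ^ 3 * M₄ ≤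
      ∫ x, h (ip w x) * |ip v x| ∂uniformSphere d := by
    have i2 : Integrable (fun x => h (ip w x) * ip v x ^ 2) (uniformSphere d) :=
      hint ((c1 v).pow 2)
    have i4 : Integrable (fun x => h (ip w x) * ip v x ^ 4) (uniformSphere d) :=
      hint ((c1 v).pow 4)
    rw [hM₂, hM₄, ← integral_const_mul, ← integral_const_mul,
      ← integral_sub (i2.const_mul _) (i4.const_mul _)]
    refine integral_mono ((i2.const_mul _).sub (i4.const_mul _)) (hint (c1 _).abs) fun x => ?_
    simp only
    have := mul_le_mul_of_nonneg_left (abs_lower_bound (y := ip v x) hτ0) (hh0 (ip w x))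
    nlinarith
  refine le_trans ?_ hlow
  have hb2 : b ^ 2 ≤ 1 / 300 := by nlinarith [sq_nonneg b]
  have hM2 : (1 - 1 / 300) * J / d ≤ M₂ := by
    rw [div_le_iff₀ (by positivity)]
    have : 0 ≤ M₂ := integral_nonneg fun x => mul_nonneg (hh0 _) (sq_nonneg _)
    nlinarith
  -- `27/8 = 3 · 9/8`, since `d² - 1 ≥ 8d²/9` for `d ≥ 3`.
  have hM4 : M₄ ≤ 27 / 8 * J / d ^ 2 := by
    rw [le_div_iff₀ (by positivity)]
    have : 0 ≤ M₄ := integral_nonneg fun x => mul_nonneg (hh0 _) (by positivity)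
    have h9 : 0 ≤ ((d : ℝ) ^ 2 - 9) * M₄ := mul_nonneg (by nlinarith) this
    linarith
  -- `3/2 · 299/300 - 9/16` exceeds `9/10`; together with `τ ≥ 5√d/9` this yields the factor `1/2`.
  have hcalc : τ * (J / d) * (9 / 10) ≤ (3 / 2) * τ * M₂ - (1 / 2) * τ ^ 3 * M₄ := by
    have e : τ ^ 3 = τ * (d / 3) := by rw [← hτ2]; ring
    have h5 : (d / 3) * M₄ ≤ 9 / 8 * (J / d) := by
      calc (d / 3 : ℝ) * M₄ ≤ d / 3 * (27 / 8 * J / d ^ 2) := by gcongr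
        _ = 9 / 8 * (J / d) := by field_simp; ring
    have h6 : (1 - 1 / 300) * (J / d) ≤ M₂ := by rw [← mul_div_assoc]; exact hM2
    have h7 : 0 ≤ J / d := by positivity
    rw [e]
    have : 0 ≤ τ * ((3 / 2) * M₂ - (1 / 2) * (d / 3 * M₄) - 9 / 10 * (J / d)) :=
      mul_nonneg hτ0 (by linarith)
    nlinarith
  refine le_trans ?_ hcalc
  have hs : √(d : ℝ) ^ 2 = d := Real.sq_sqrt (by positivity)
  have hs0 : 0 < √(d : ℝ) := Real.sqrt_pos.2 (by positivity)
  have hτs : 5 / 9 * √(d : ℝ) ≤ τ := by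
    rw [hτ]
    refine Real.le_sqrt_of_sq_le ?_
    rw [mul_pow, hs]
    nlinarith
  calc 1 / (2 * √(d : ℝ)) * J = 5 / 9 * √(d : ℝ) * (J / √(d : ℝ) ^ 2) * (9 / 10) := by
        field_simp; ring
    _ = 5 / 9 * √(d : ℝ) * (J / d) * (9 / 10) := by rw [hs]
    _ ≤ τ * (J / d) * (9 / 10) := by gcongr

end Moments

end PassivePerceptron


/-! ### Masses of lunes and bands. -/

namespace PassivePerceptron

open scoped InnerProductSpace

variable {d : ℕ}

theorem exists_unit_orthogonal (hd : 3 ≤ d) {w : Vec d} (hw : ‖w‖ = 1) :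
    ∃ v : Vec d, ‖v‖ = 1 ∧ ⟪v, w⟫_ℝ = 0 := by
  obtain ⟨e, he⟩ := exists_orthonormalBasis_extending hd hw
  refine ⟨e ⟨1, by omega⟩, e.norm_eq_one _, ?_⟩
  rw [← he]
  exact e.inner_eq_zero (by simp)

section Lune

theorem measurable_halfspace (w : Vec d) : Measurable (halfspace w) := by
  unfold halfspace sgn
  exact Measurable.ite (measurableSet_le measurable_const (continuous_inner_sphere w).measurable)
    measurable_const measurable_const

theorem halfspace_eq_iff {v w : Vec d} {x : Sphere d} :
    halfspace v x = halfspace w x ↔ (0 ≤ ip v x ↔ 0 ≤ ip w x) := by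
  have h : ¬ (1 : Label) = -1 := by decide
  have h' : ¬ (-1 : Label) = 1 := by decide
  unfold halfspace sgn
  by_cases h1 : 0 ≤ ip v x <;> by_cases h2 : 0 ≤ ip w x <;> simp [h1, h2, h, h']

/-- Doubling the angle: let `v'` be the mirror image of `v` in the line of `u`. The regions where
`v`, respectively `v'`, disagrees with `u` have equal mass, are disjoint, and lie in the region
where `v` and `v'` disagree. So halving the angle halves the bound. Starting from the trivial bound
`1` costs a factor `2` against the exact mass, which is harmless here. -/
theorem lune_real_le [IsProbabilityMeasure (uniformSphere d)] (j : ℕ) {u v : Vec d}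
    (hu : ‖u‖ = 1) (hv : ‖v‖ = 1) (h : Real.cos (Real.pi / 2 ^ (j + 1)) ≤ ⟪u, v⟫_ℝ) :
    (uniformSphere d).real {x | halfspace v x ≠ halfspace u x} ≤ (1 / 2) ^ j := by
  induction j generalizing u v with
  | zero => simp
  | succ j ih =>
    set c := ⟪u, v⟫_ℝ with hc
    have hα : Real.pi / 2 ^ (j + 1) = 2 * (Real.pi / 2 ^ (j + 1 + 1)) := by
      rw [pow_succ _ (j + 1)]; field_simp
    have hα2 : Real.pi / 2 ^ (j + 1 + 1) < Real.pi / 2 := by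
      refine div_lt_div_of_pos_left Real.pi_pos (by norm_num) ?_
      calc (2 : ℝ) = 2 ^ 1 := by norm_num
        _ < 2 ^ (j + 1 + 1) := pow_lt_pow_right₀ (by norm_num) (by omega)
    have hcos : 0 < Real.cos (Real.pi / 2 ^ (j + 1 + 1)) :=
      Real.cos_pos_of_mem_Ioo ⟨by have : 0 < Real.pi / 2 ^ (j + 1 + 1) := by positivity
                                  linarith [Real.pi_pos], hα2⟩
    have hc0 : 0 < c := hcos.trans_le h
    set v' : Vec d := (2 * c) • u - v with hv'
    have hv'u : ⟪v', u⟫_ℝ = c := by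
      rw [hv', inner_sub_left, inner_smul_left, real_inner_self_eq_norm_sq, hu,
        real_inner_comm u v, ← hc]
      simp; ring
    have hv'v : ⟪v', v⟫_ℝ = 2 * c ^ 2 - 1 := by
      rw [hv', inner_sub_left, inner_smul_left, real_inner_self_eq_norm_sq, hv, ← hc]
      simp; ring
    have hv'1 : ‖v'‖ = 1 := by
      rw [← sq_eq_sq₀ (norm_nonneg _) zero_le_one, hv', norm_sub_sq_real, norm_smul, mul_pow,
        inner_smul_left, hu, hv, ← hc, Real.norm_eq_abs, sq_abs]
      simp; ring
    obtain ⟨f, hf, hfx⟩ := exists_measurePreserving_swap (w := u) hv'1 hv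
      (by rw [hv'u, hc, real_inner_comm])
    have hA : MeasurableSet {x | halfspace v x ≠ halfspace u x} :=
      (measurableSet_eq_fun (measurable_halfspace v) (measurable_halfspace u)).compl
    have hB : MeasurableSet {x | halfspace v' x ≠ halfspace u x} :=
      (measurableSet_eq_fun (measurable_halfspace v') (measurable_halfspace u)).compl
    have hAB : (uniformSphere d).real {x | halfspace v' x ≠ halfspace u x} =
        (uniformSphere d).real {x | halfspace v x ≠ halfspace u x} := by
      rw [measureReal_def, measureReal_def, ← hf.measure_preimage hB.nullMeasurableSet]
      congr 2
      ext x
      simp only [Set.mem_preimage, Set.mem_ofPred_eq, ne_eq, halfspace_eq_iff, ip, (hfx x).1,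
        (hfx x).2]
    have hip : ∀ x : Sphere d, ip v x + ip v' x = 2 * c * ip u x := fun x => by
      simp only [ip, hv', inner_sub_left, inner_smul_left, conj_trivial]; ring
    have hcase : ∀ x : Sphere d, (halfspace v x = halfspace u x ∨ halfspace v' x = halfspace u x) := by
      intro x
      rw [halfspace_eq_iff, halfspace_eq_iff]
      have := hip x
      by_cases h1 : 0 ≤ ip v x <;> by_cases h2 : 0 ≤ ip v' x
      · have : 0 ≤ ip u x := nonneg_of_mul_nonneg_right (by linarith) (by positivity : 0 < 2 * c)
        tauto
      · tauto
      · tauto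
      · have : ip u x < 0 := by
          by_contra hneg
          have : 0 ≤ 2 * c * ip u x := mul_nonneg (by positivity) (not_lt.1 hneg)
          linarith
        have := not_le.2 this
        tauto
    have hdisj : Disjoint {x | halfspace v x ≠ halfspace u x}
        {x | halfspace v' x ≠ halfspace u x} := by
      rw [Set.disjoint_left]
      intro x h1 h2
      exact (hcase x).elim h1 h2
    have hsub : {x | halfspace v x ≠ halfspace u x} ∪ {x | halfspace v' x ≠ halfspace u x} ⊆
        {x | halfspace v x ≠ halfspace v' x} := by
      rintro x (h1 | h1) h2
      · exact (hcase x).elim h1 fun h3 => h1 (h2.trans h3)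
      · exact (hcase x).elim (fun h3 => h1 (h2.symm.trans h3)) h1
    have hle := measureReal_mono (μ := uniformSphere d) hsub
    rw [measureReal_union hdisj hB, hAB] at hle
    have h2 := ih hv'1 hv (by
      rw [hv'v, hα, Real.cos_two_mul]
      nlinarith)
    rw [pow_succ]
    linarith

end Lune

/-- In polar coordinates `(r, ψ)` the expression is `r cos (α - ψ)`, and the condition holds for `α`
between `ψ + arccos (b/r)` and `ψ + arccos (b/(2r))`. This interval has length at least `b/(2r)`
because `sin` is 1-Lipschitz. The range `(-π, 2π]` is chosen to contain it without wrapping around.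
-/
theorem volume_arc_lower_bound {p q b : ℝ} (hb : 0 < b) (hr : b ≤ √(p ^ 2 + q ^ 2)) :
    ENNReal.ofReal (b / (2 * √(p ^ 2 + q ^ 2))) ≤
      volume.restrict (Set.Ioc (-Real.pi) (2 * Real.pi))
        {α : ℝ | b / 2 ≤ Real.cos α * p + Real.sin α * q ∧ Real.cos α * p + Real.sin α * q ≤ b} := by
  set r := √(p ^ 2 + q ^ 2) with hrdef
  have hr0 : 0 < r := hb.trans_le hr
  set ψ := Complex.arg ⟨p, q⟩ with hψ
  have hn : ‖(⟨p, q⟩ : ℂ)‖ = r := by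
    rw [Complex.norm_eq_sqrt_sq_add_sq]
  have hp : p = r * Real.cos ψ := by
    have := Complex.norm_mul_cos_arg ⟨p, q⟩
    rw [hn] at this; exact this.symm
  have hq : q = r * Real.sin ψ := by
    have := Complex.norm_mul_sin_arg ⟨p, q⟩
    rw [hn] at this; exact this.symm
  have hψ1 : -Real.pi < ψ := Complex.neg_pi_lt_arg _
  have hψ2 : ψ ≤ Real.pi := Complex.arg_le_pi _
  have hbr : b / r ≤ 1 := (div_le_one hr0).2 hr
  have hbr0 : 0 < b / r := by positivity
  have hbr2 : b / (2 * r) = b / r / 2 := by rw [mul_comm, div_div]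
  have hA : Set.Icc (ψ + Real.arccos (b / r)) (ψ + Real.arccos (b / (2 * r))) ⊆
      {α : ℝ | b / 2 ≤ Real.cos α * p + Real.sin α * q ∧
        Real.cos α * p + Real.sin α * q ≤ b} ∩ Set.Ioc (-Real.pi) (2 * Real.pi) := by
    rintro α ⟨h1, h2⟩
    have h3 : 0 ≤ Real.arccos (b / r) := Real.arccos_nonneg _
    have h4 : Real.arccos (b / (2 * r)) ≤ Real.pi / 2 := Real.arccos_le_pi_div_two.2 (by positivity)
    have hrep : Real.cos α * p + Real.sin α * q = r * Real.cos (α - ψ) := by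
      rw [Real.cos_sub]
      conv_lhs => rw [hp, hq]
      ring
    have h5 : Real.cos (α - ψ) ≤ b / r := by
      rw [← Real.cos_arccos (by linarith : -1 ≤ b / r) hbr]
      exact Real.cos_le_cos_of_nonneg_of_le_pi h3 (by linarith [Real.pi_pos]) (by linarith)
    have h6 : b / (2 * r) ≤ Real.cos (α - ψ) := by
      rw [← Real.cos_arccos (by rw [hbr2]; linarith : -1 ≤ b / (2 * r)) (by rw [hbr2]; linarith)]
      exact Real.cos_le_cos_of_nonneg_of_le_pi (by linarith) (by linarith [Real.pi_pos])
        (by linarith)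
    refine ⟨⟨?_, ?_⟩, ?_, ?_⟩
    · rw [hrep]
      calc b / 2 = r * (b / (2 * r)) := by field_simp
        _ ≤ _ := by gcongr
    · rw [hrep]
      calc r * Real.cos (α - ψ) ≤ r * (b / r) := by gcongr
        _ = b := by field_simp
    · linarith
    · linarith [Real.pi_pos]
  have hlen : b / (2 * r) ≤ Real.arccos (b / (2 * r)) - Real.arccos (b / r) := by
    rw [Real.arccos, Real.arccos]
    have h1 : Real.arcsin (b / (2 * r)) ≤ Real.arcsin (b / r) :=
      Real.monotone_arcsin (by rw [hbr2]; linarith)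
    have h2 := Real.abs_sin_sub_sin_le (Real.arcsin (b / r)) (Real.arcsin (b / (2 * r)))
    rw [abs_of_nonneg (a := Real.arcsin (b / r) - _) (by linarith),
      Real.sin_arcsin (by linarith) hbr,
      Real.sin_arcsin (by rw [hbr2]; linarith) (by rw [hbr2]; linarith)] at h2
    have h3 := le_abs_self (b / r - b / (2 * r))
    rw [hbr2] at *
    linarith
  rw [Measure.restrict_apply' measurableSet_Ioc]
  refine le_trans ?_ (measure_mono hA)
  rw [Real.volume_Icc]
  exact ENNReal.ofReal_le_ofReal (by linarith)

/-- A minorant of `1/r` with only even powers of `r`, so that its mean needs only second and fourth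
moments. With `z = τ r` it rests on `(2/3)(z³ - z⁵/4) ≤ 1`, whose left side is largest at `z² =
12/5`. The term with `b²` makes the minorant nonpositive for `r ≤ b`, where the arc bound fails. -/
theorem inv_lower_bound {τ r b : ℝ} (hτ : 0 ≤ τ) (hr : 0 < r) :
    (2 / 3) * τ * (τ ^ 2 * r ^ 2 - τ ^ 4 * r ^ 4 / 4 - τ ^ 2 * b ^ 2) ≤ 1 / r := by
  rw [le_div_iff₀ hr]
  have h1 : (0 : ℝ) ≤ τ * r := by positivity
  have h2 : 0 ≤ τ ^ 3 * b ^ 2 * r := by positivity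
  have h3 : (2 / 3) * ((τ * r) ^ 3 - (τ * r) ^ 5 / 4) ≤ 1 := by
    set z := τ * r
    have h4 : 0 ≤ z * (z ^ 2 - 12 / 5) ^ 2 := by positivity
    have h5 : 0 ≤ (z - 31 / 20) ^ 2 * (z + 31 / 10) := by positivity
    nlinarith
  nlinarith

/-- Turn `w` by an angle `α` in the plane of `w` and `v` and integrate over `α`. By symmetry each
`α` contributes the same mass. By Fubini the total is the mean length of the set of `α` that put a
fixed `x` into the band, which is at least `b/(2r)` when the projection of `x` to the plane has
length `r ≥ b`. -/
theorem band_real_lower_bound [IsProbabilityMeasure (uniformSphere d)] (hd : 3 ≤ d) {w : Vec d}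
    (hw : ‖w‖ = 1) {b : ℝ} (hb : 0 < b) (hdb : d * b ^ 2 ≤ 1 / 100) :
    b * √d / 300 ≤ (uniformSphere d).real {x | b / 2 ≤ ip w x ∧ ip w x ≤ b} := by
  obtain ⟨v, hv, hvw⟩ := exists_unit_orthogonal hd hw
  have hd3 : (3 : ℝ) ≤ d := by exact_mod_cast hd
  set σ := uniformSphere d with hσ
  set P := σ.real {x | b / 2 ≤ ip w x ∧ ip w x ≤ b} with hP
  have c1 : ∀ u : Vec d, Continuous fun x : Sphere d => ip u x := continuous_inner_sphere
  -- averaging over the rotations of `w` in the plane of `w` and `v`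
  let wα : ℝ → Vec d := fun α => Real.cos α • w + Real.sin α • v
  have hwα : ∀ α, ‖wα α‖ = 1 := by
    intro α
    rw [← sq_eq_sq₀ (norm_nonneg _) zero_le_one, norm_add_sq_real, norm_smul, norm_smul, mul_pow,
      mul_pow, hw, hv, inner_smul_left, inner_smul_right, real_inner_comm, hvw,
      Real.norm_eq_abs, Real.norm_eq_abs, sq_abs, sq_abs]
    simp [Real.cos_sq_add_sin_sq]
  have hipα : ∀ α x, ip (wα α) x = Real.cos α * ip w x + Real.sin α * ip v x := by
    intro α x
    simp [ip, wα, inner_add_left, inner_smul_left]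
  set T : Set (ℝ × Sphere d) := {z | b / 2 ≤ Real.cos z.1 * ip w z.2 + Real.sin z.1 * ip v z.2 ∧
    Real.cos z.1 * ip w z.2 + Real.sin z.1 * ip v z.2 ≤ b} with hT
  have hcont : Continuous fun z : ℝ × Sphere d =>
      Real.cos z.1 * ip w z.2 + Real.sin z.1 * ip v z.2 :=
    ((Real.continuous_cos.comp continuous_fst).mul ((c1 w).comp continuous_snd)).add
      ((Real.continuous_sin.comp continuous_fst).mul ((c1 v).comp continuous_snd))
  have hTm : MeasurableSet T :=
    ((isClosed_le continuous_const hcont).inter (isClosed_le hcont continuous_const)).measurableSet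
  have hsec : ∀ α : ℝ, σ (Prod.mk α ⁻¹' T) = ENNReal.ofReal P := by
    intro α
    obtain ⟨f, hf, hfx⟩ := exists_measurePreserving_swap (w := 0) (hwα α) hw (by simp)
    have hm : MeasurableSet (Prod.mk α ⁻¹' T) := measurable_prodMk_left hTm
    rw [← hf.measure_preimage hm.nullMeasurableSet, hP, ofReal_measureReal]
    congr 1
    ext x
    simp only [hT, Set.mem_preimage, Set.mem_ofPred_eq, ← hipα]
    rw [show ip (wα α) (f x) = ip w x from (hfx x).1]
  have htot : ((volume.restrict (Set.Ioc (-Real.pi) (2 * Real.pi))).prod σ) T =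
      ENNReal.ofReal (3 * Real.pi * P) := by
    rw [Measure.prod_apply hTm]
    simp only [hsec]
    rw [lintegral_const, Measure.restrict_apply MeasurableSet.univ, Set.univ_inter,
      Real.volume_Ioc, ← ENNReal.ofReal_mul measureReal_nonneg]
    congr 1; ring
  -- With this choice the mean of the minorant's bracket is at least `1/2 - 27/128 - 1/400 > 7/25`.
  set τ := √(d / 4 : ℝ) with hτ
  have hτ0 : 0 ≤ τ := Real.sqrt_nonneg _
  have hτ2 : τ ^ 2 = d / 4 := Real.sq_sqrt (by positivity)
  let g : Sphere d → ℝ := fun x => b / 2 * (2 / 3 * τ * (τ ^ 2 * (ip w x ^ 2 + ip v x ^ 2) -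
    τ ^ 4 / 2 * (ip w x ^ 4 + ip v x ^ 4) - τ ^ 2 * b ^ 2))
  have hgc : Continuous g := by
    have := c1 w; have := c1 v; fun_prop
  have hgi : ∀ {g : Sphere d → ℝ}, Continuous g → Integrable g σ := fun hg =>
    hg.integrable_of_hasCompactSupport (HasCompactSupport.of_compactSpace _)
  have hip : ∀ (u : Vec d) (k : ℕ), Integrable (fun x : Sphere d => ip u x ^ k) σ :=
    fun u k => hgi ((c1 u).pow k)
  have hgi0 : Integrable (fun x => max (g x) 0) σ := hgi (hgc.max continuous_const)
  have hsec2 : ∀ x : Sphere d, ENNReal.ofReal (g x) ≤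
      volume.restrict (Set.Ioc (-Real.pi) (2 * Real.pi)) ((fun α => (α, x)) ⁻¹' T) := by
    intro x
    set r := √(ip w x ^ 2 + ip v x ^ 2) with hr
    have hr2 : r ^ 2 = ip w x ^ 2 + ip v x ^ 2 := Real.sq_sqrt (by positivity)
    -- This removes the mixed fourth moment of the two coordinates.
    have hr4 : r ^ 4 ≤ 2 * (ip w x ^ 4 + ip v x ^ 4) := by
      rw [show r ^ 4 = (r ^ 2) ^ 2 by ring, hr2]
      nlinarith [sq_nonneg (ip w x ^ 2 - ip v x ^ 2)]
    have hgle : g x ≤ b / 2 * (2 / 3 * τ * (τ ^ 2 * r ^ 2 - τ ^ 4 * r ^ 4 / 4 - τ ^ 2 * b ^ 2)) := by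
      simp only [g]
      rw [hr2]
      have : τ ^ 4 * r ^ 4 / 4 ≤ τ ^ 4 / 2 * (ip w x ^ 4 + ip v x ^ 4) := by
        have := mul_le_mul_of_nonneg_left hr4 (by positivity : 0 ≤ τ ^ 4)
        linarith
      gcongr
    by_cases hbr : b ≤ r
    · have hr0 : 0 < r := hb.trans_le hbr
      refine le_trans (ENNReal.ofReal_le_ofReal ?_) (volume_arc_lower_bound hb hbr)
      refine hgle.trans ?_
      calc _ ≤ b / 2 * (1 / r) := by gcongr; exact inv_lower_bound hτ0 hr0
        _ = _ := by rw [← hr]; field_simp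
    · rw [ENNReal.ofReal_of_nonpos]
      · exact zero_le
      · refine hgle.trans ?_
        have h1 : r ^ 2 ≤ b ^ 2 := by
          have : 0 ≤ r := Real.sqrt_nonneg _
          push Not at hbr
          gcongr
        have h2 : τ ^ 2 * r ^ 2 ≤ τ ^ 2 * b ^ 2 := by gcongr
        have h3 : 0 ≤ τ ^ 4 * r ^ 4 / 4 := by positivity
        refine mul_nonpos_of_nonneg_of_nonpos (by positivity) ?_
        exact mul_nonpos_of_nonneg_of_nonpos (by positivity) (by linarith)
  have hmain : ∫ x, g x ∂σ ≤ 3 * Real.pi * P := by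
    have h1 : ENNReal.ofReal (∫ x, max (g x) 0 ∂σ) ≤ ENNReal.ofReal (3 * Real.pi * P) := by
      rw [← htot, Measure.prod_apply_symm hTm, ofReal_integral_eq_lintegral_ofReal
        hgi0 (Filter.Eventually.of_forall fun x => le_max_right _ _)]
      refine lintegral_mono fun x => ?_
      rw [ENNReal.ofReal_max, ENNReal.ofReal_zero, max_eq_left zero_le]
      exact hsec2 x
    have hP0 : 0 ≤ P := measureReal_nonneg
    rw [ENNReal.ofReal_le_ofReal_iff (by have := Real.pi_pos; positivity)] at h1
    exact (integral_mono (hgi hgc) hgi0 fun x => le_max_left _ _).trans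
      h1
  -- the moments of the uniform distribution
  have hM : ∀ (k : ℕ), ∫ x, ip w x ^ k ∂σ = ∫ x, ip v x ^ k ∂σ := fun k =>
    integral_swap (w := 0) hw hv (by simp) fun _ t => t ^ k
  have hM2 : ∫ x, ip v x ^ 2 ∂σ = 1 / d := by
    have h := secondMoment (h := fun _ => 1) hd measurable_const (fun _ => zero_le_one)
      (fun _ => le_rfl) hw hv hvw
    simp only [one_mul] at h
    rw [integral_sub (integrable_const _) (hip w 2), hM 2] at h
    simp only [integral_const, probReal_univ, smul_eq_mul, mul_one] at h
    field_simp
    linarith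
  have hM4 : ∫ x, ip v x ^ 4 ∂σ ≤ 27 / 8 / d ^ 2 := by
    have h := fourthMoment (h := fun _ => 1) hd measurable_const (fun _ => zero_le_one)
      (fun _ => le_rfl) hw hv hvw
    simp only [one_mul, integral_const, probReal_univ, smul_eq_mul, mul_one] at h
    rw [le_div_iff₀ (by positivity)]
    have h0 : 0 ≤ ∫ x, ip v x ^ 4 ∂σ := integral_nonneg fun x => by positivity
    have h9 : 0 ≤ ((d : ℝ) ^ 2 - 9) * ∫ x, ip v x ^ 4 ∂σ := mul_nonneg (by nlinarith) h0
    linarith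
  have hg : ∫ x, g x ∂σ = b / 2 * (2 / 3 * τ * (τ ^ 2 * (2 * (1 / d)) -
      τ ^ 4 / 2 * (2 * ∫ x, ip v x ^ 4 ∂σ) - τ ^ 2 * b ^ 2)) := by
    simp only [g]
    have i2 : Integrable (fun x : Sphere d => ip w x ^ 2 + ip v x ^ 2) σ :=
      (hip w 2).add (hip v 2)
    have i4 : Integrable (fun x : Sphere d => ip w x ^ 4 + ip v x ^ 4) σ :=
      (hip w 4).add (hip v 4)
    have e2 : ∫ x, (ip w x ^ 2 + ip v x ^ 2) ∂σ = 2 * (1 / d) := by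
      rw [integral_add (hip w 2) (hip v 2), hM, hM2]; ring
    have e4 : ∫ x, (ip w x ^ 4 + ip v x ^ 4) ∂σ = 2 * ∫ x, ip v x ^ 4 ∂σ := by
      rw [integral_add (hip w 4) (hip v 4), hM]; ring
    have i24 : Integrable (fun x : Sphere d => τ ^ 2 * (ip w x ^ 2 + ip v x ^ 2) -
      τ ^ 4 / 2 * (ip w x ^ 4 + ip v x ^ 4)) σ := (i2.const_mul _).sub (i4.const_mul _)
    rw [integral_const_mul, integral_const_mul, integral_sub i24 (integrable_const _),
      integral_sub (i2.const_mul _) (i4.const_mul _), integral_const_mul, integral_const_mul,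
      e2, e4, integral_const, probReal_univ, one_smul]
  have hval : (7 / 25 : ℝ) ≤ τ ^ 2 * (2 * (1 / d)) -
      τ ^ 4 / 2 * (2 * ∫ x, ip v x ^ 4 ∂σ) - τ ^ 2 * b ^ 2 := by
    have e4 : τ ^ 4 = d ^ 2 / 16 := by rw [show τ ^ 4 = (τ ^ 2) ^ 2 by ring, hτ2]; ring
    have h1 : (d : ℝ) ^ 2 / 16 * ∫ x, ip v x ^ 4 ∂σ ≤ 27 / 128 := by
      calc (d : ℝ) ^ 2 / 16 * ∫ x, ip v x ^ 4 ∂σ ≤ (d : ℝ) ^ 2 / 16 * (27 / 8 / d ^ 2) := by gcongr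
        _ = 27 / 128 := by field_simp; norm_num
    have h2 : (d : ℝ) / 4 * (2 * (1 / d)) = 1 / 2 := by field_simp; norm_num
    rw [e4, hτ2, h2]
    linarith
  have hτs : τ = √d / 2 := by
    rw [hτ, Real.sqrt_div (by positivity), show (4 : ℝ) = 2 ^ 2 by norm_num,
      Real.sqrt_sq (by norm_num)]
  rw [hg] at hmain
  have h1 : b / 2 * (2 / 3 * τ * (7 / 25)) ≤ 3 * Real.pi * P := by
    refine le_trans ?_ hmain
    gcongr
  have hpi : Real.pi ≤ 3.15 := Real.pi_lt_d2.le
  have hP0 : 0 ≤ P := measureReal_nonneg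
  rw [hτs] at h1
  have h2 : Real.pi * P ≤ 3.15 * P := by gcongr
  have h3 : 0 ≤ b * √(d : ℝ) := by positivity
  linarith

end PassivePerceptron


/-! ### The drift of one update under bounded noise. -/

namespace PassivePerceptron

open scoped InnerProductSpace

variable {d : ℕ}

theorem exists_orthogonal_decomposition (hd : 3 ≤ d) {u w : Vec d} (hu : ‖u‖ = 1)
    (hw : ‖w‖ = 1) :
    ∃ v : Vec d, ‖v‖ = 1 ∧ ⟪v, w⟫_ℝ = 0 ∧ u = ⟪u, w⟫_ℝ • w + √(1 - ⟪u, w⟫_ℝ ^ 2) • v := by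
  set c := ⟪u, w⟫_ℝ with hc
  have hc1 : |c| ≤ 1 := by
    have := abs_real_inner_le_norm u w
    rwa [hu, hw, one_mul] at this
  have hc2 : 0 ≤ 1 - c ^ 2 := by have := (sq_le_one_iff_abs_le_one c).2 hc1; linarith
  have hn : ‖u - c • w‖ ^ 2 = 1 - c ^ 2 := by
    rw [norm_sub_sq_real, inner_smul_right, ← hc, norm_smul, mul_pow, Real.norm_eq_abs, sq_abs,
      hu, hw]
    ring
  have ho : ⟪u - c • w, w⟫_ℝ = 0 := by
    rw [inner_sub_left, inner_smul_left, real_inner_self_eq_norm_sq, hw, ← hc]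
    simp
  have hn' : ‖u - c • w‖ = √(1 - c ^ 2) := by rw [← hn, Real.sqrt_sq (norm_nonneg _)]
  -- If `u = ±w`, any unit vector orthogonal to `w` serves as `v`.
  rcases eq_or_ne (√(1 - c ^ 2)) 0 with h0 | h0
  · obtain ⟨v, hv, hvw⟩ := exists_unit_orthogonal hd hw
    refine ⟨v, hv, hvw, ?_⟩
    rw [h0] at hn' ⊢
    rw [zero_smul, add_zero]
    exact sub_eq_zero.1 (norm_eq_zero.1 hn')
  · refine ⟨(√(1 - c ^ 2))⁻¹ • (u - c • w), ?_, ?_, ?_⟩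
    · rw [norm_smul, hn', Real.norm_eq_abs, abs_of_nonneg (by positivity), inv_mul_cancel₀ h0]
    · rw [inner_smul_left, ho, mul_zero]
    · rw [smul_inv_smul₀ h0, add_sub_cancel]

theorem label_cases (y : Label) : y = 1 ∨ y = -1 := Int.units_eq_one_or y

theorem one_ne_neg_one_label : (1 : Label) ≠ -1 := by decide

open Classical in
/-- Under bounded noise, the contribution of the negative labels to a linear statistic. -/
theorem integral_negative_le {D : Measure (Example d)} [IsProbabilityMeasure D] {η : ℝ} {u : Vec d}
    (hu : ‖u‖ = 1) (hD : BoundedNoise D η u) {k : Sphere d → ℝ} (hk : Measurable k)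
    (hk0 : ∀ x, 0 ≤ k x) (hk1 : ∀ x, k x ≤ 1) :
    ∫ z, (if z.2 = -1 then k z.1 * ip u z.1 else 0) ∂D ≤
      ∫ x, k x * (1 / 2 * ip u x - (1 - 2 * η) / 2 * |ip u x|) ∂D.fst := by
  have hipm : Measurable (ip u) := (continuous_inner_sphere u).measurable
  have hbound : ∀ x, |k x * ip u x| ≤ 1 := fun x => by
    rw [abs_mul, abs_of_nonneg (hk0 x)]
    exact mul_le_one₀ (hk1 x) (abs_nonneg _) (abs_inner_sphere_le hu x)
  have hset : MeasurableSet {z : Example d | z.2 = -1} :=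
    measurable_snd (MeasurableSet.singleton (-1 : Label))
  have hint : Integrable (fun z : Example d => if z.2 = -1 then k z.1 * ip u z.1 else 0) D := by
    refine Integrable.of_bound (Measurable.ite hset ((hk.mul hipm).comp measurable_fst)
      measurable_const).aestronglyMeasurable 1 (Filter.Eventually.of_forall fun z => ?_)
    split_ifs
    · exact hbound _
    · simp
  have hdis : D.fst ⊗ₘ D.condKernel = D := Measure.disintegrate D D.condKernel
  rw [← hdis] at hint
  have hinner : ∀ x : Sphere d, ∫ y, (if y = -1 then k x * ip u x else 0) ∂D.condKernel x =
      k x * ip u x * (D.condKernel x).real {-1} := by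
    intro x
    have : (fun y : Label => if y = -1 then k x * ip u x else 0) =
        Set.indicator {-1} fun _ => k x * ip u x := by
      ext y; simp [Set.indicator_apply]
    rw [this, integral_indicator (MeasurableSet.singleton _), setIntegral_const, smul_eq_mul,
      mul_comm]
  conv_lhs => rw [← hdis]
  rw [Measure.integral_compProd hint]
  simp only [hinner]
  have hr1 : Integrable (fun x => k x * (1 / 2 * ip u x - (1 - 2 * η) / 2 * |ip u x|)) D.fst := by
    have hg : Continuous fun x : Sphere d => 1 / 2 * ip u x - (1 - 2 * η) / 2 * |ip u x| := by
      have := continuous_inner_sphere u; fun_prop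
    refine (hg.integrable_of_hasCompactSupport (HasCompactSupport.of_compactSpace _)).bdd_mul
      (c := 1) hk.aestronglyMeasurable (Filter.Eventually.of_forall fun x => ?_)
    rw [Real.norm_eq_abs, abs_of_nonneg (hk0 x)]
    exact hk1 x
  have hr2 : Integrable (fun x => k x * ip u x * (D.condKernel x).real {-1}) D.fst := by
    have : Integrable (fun x => ∫ y, (if y = -1 then k x * ip u x else 0) ∂D.condKernel x)
      D.fst := hint.integral_compProd
    simpa only [hinner] using this
  refine integral_mono_ae hr2 hr1 ?_
  filter_upwards [hD] with x hx
  rw [mul_assoc]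
  refine mul_le_mul_of_nonneg_left ?_ (hk0 x)
  -- For `u·x ≥ 0` the label `-1` is wrong and has probability at most `η = 1/2 - (1-2η)/2`. For
  -- `u·x < 0` it is right and has probability at least `1 - η = 1/2 + (1-2η)/2`, and the factor
  -- `u·x` is negative. Both cases give the same upper bound.
  by_cases h : 0 ≤ ip u x
  · have hs : {y : Label | y ≠ halfspace u x} = {-1} := by
      have : halfspace u x = 1 := by simp [halfspace, sgn, h]
      ext y
      rcases label_cases y with rfl | rfl <;> simp [this,
        one_ne_neg_one_label.symm]
    rw [hs] at hx
    rw [abs_of_nonneg h]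
    nlinarith
  · have hs : {y : Label | y ≠ halfspace u x} = {-1}ᶜ := by
      have : halfspace u x = -1 := by simp [halfspace, sgn, h]
      rw [this]; rfl
    rw [hs, probReal_compl_eq_one_sub (MeasurableSet.singleton _)] at hx
    rw [abs_of_neg (not_le.1 h)]
    nlinarith [not_le.1 h]

/-- The increase of `1 - ⟪u, w⟫` caused by the update of `w` on the example `z`. -/
noncomputable def increment (u w : Vec d) (z : Example d) : ℝ :=
  open Classical in if z.2 = -1 then 2 * ip w z.1 * ip u z.1 else 0

theorem inner_step {u w : Vec d} {b : ℝ} (hb : 0 < b) {z : Example d} (hz : InBand b w z) :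
    1 - ⟪u, step w z⟫_ℝ = 1 - ⟪u, w⟫_ℝ + increment u w z := by
  have hpos : 0 < ip w z.1 := by have := hz.1; linarith
  unfold step increment
  rcases label_cases z.2 with h | h
  · have h1 : ¬ ((z.2 : ℤ) : ℝ) * ip w z.1 < 0 := by rw [h]; simp [hpos.le]
    rw [if_neg h1, if_neg (by rw [h]; exact one_ne_neg_one_label), add_zero]
  · have h1 : ((z.2 : ℤ) : ℝ) * ip w z.1 < 0 := by rw [h]; simpa using hpos
    rw [if_pos h1, if_pos h, inner_sub_right, inner_smul_right]
    ring

theorem measurable_increment (u w : Vec d) : Measurable (increment u w) := by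
  have h1 : ∀ v : Vec d, Measurable fun z : Example d => ip v z.1 := fun v =>
    (continuous_inner_sphere v).measurable.comp measurable_fst
  exact Measurable.ite (measurable_snd (MeasurableSet.singleton (-1 : Label)))
    (((h1 w).const_mul 2).mul (h1 u)) measurable_const

theorem real_inBand_eq {D : Measure (Example d)} {w : Vec d} {b : ℝ} (hD : D.fst = uniformSphere d) :
    D.real {z | InBand b w z} =
      (uniformSphere d).real {x | b / 2 ≤ ip w x ∧ ip w x ≤ b} := by
  have hm : MeasurableSet {x : Sphere d | b / 2 ≤ ip w x ∧ ip w x ≤ b} :=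
    (measurableSet_le measurable_const (continuous_inner_sphere w).measurable).inter
      (measurableSet_le (continuous_inner_sphere w).measurable measurable_const)
  rw [measureReal_def, measureReal_def, ← hD, Measure.fst_apply hm]
  rfl

section Drift

variable {D : Measure (Example d)} [IsProbabilityMeasure D] {η : ℝ} {u w : Vec d} {b : ℝ}

/-- The symmetric half of the bound in `integral_negative_le` contributes at most `b²` per unit of
band mass, as the part along `v` cancels. The noise half uses `|u·x| ≥ s |v·x| - b` and `w·x ≥ b/2`
on the band, together with `abs_moment_lower_bound`. -/
theorem integral_increment_le (hd : 3 ≤ d) (hfst : D.fst = uniformSphere d) (hη0 : 0 ≤ η)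
    (hη : η < 1 / 2) (hnoise : BoundedNoise D η u) (hu : ‖u‖ = 1) (hw : ‖w‖ = 1) (hb : 0 < b)
    (hdb : d * b ^ 2 ≤ 1 / 100) :
    ∫ z in {z | InBand b w z}, increment u w z ∂D ≤
      D.real {z | InBand b w z} *
        (2 * b ^ 2 - (1 - 2 * η) * b * √(1 - ⟪u, w⟫_ℝ ^ 2) / (4 * √d)) := by
  classical
  have hσ : IsProbabilityMeasure (uniformSphere d) := by rw [← hfst]; infer_instance
  obtain ⟨v, hv, hvw, hdec⟩ := exists_orthogonal_decomposition hd hu hw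
  set c := ⟪u, w⟫_ℝ with hc
  set s := √(1 - c ^ 2) with hs
  have hs0 : 0 ≤ s := Real.sqrt_nonneg _
  have hc1 : |c| ≤ 1 := by
    have := abs_real_inner_le_norm u w
    rwa [hu, hw, one_mul] at this
  have hd3 : (3 : ℝ) ≤ d := by exact_mod_cast hd
  -- Keeps the weight `2 (w·x)` on the band below `1`, as `integral_negative_le` requires.
  have hb1 : b ≤ 1 / 2 := by nlinarith
  set h : ℝ → ℝ := Set.indicator (Set.Icc (b / 2) b) fun _ => 1 with hh
  have hhm : Measurable h := measurable_const.indicator measurableSet_Icc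
  have hh0 : ∀ t, 0 ≤ h t := fun t => Set.indicator_nonneg (fun _ _ => zero_le_one) t
  have hh1 : ∀ t, h t ≤ 1 := fun t => Set.indicator_le_self' (fun _ _ => zero_le_one) t
  have hh2 : ∀ t, h t * t ≤ h t * b ∧ h t * (b / 2) ≤ h t * t ∧ 0 ≤ h t * t := by
    intro t
    by_cases ht : t ∈ Set.Icc (b / 2) b
    · simp only [hh, Set.indicator_of_mem ht, one_mul]
      exact ⟨ht.2, ht.1, by have := ht.1; linarith⟩
    · simp [hh, Set.indicator_of_notMem ht]
  have hint : ∀ {g : Sphere d → ℝ}, Continuous g →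
      Integrable (fun x => h (ip w x) * g x) (uniformSphere d) := fun hg =>
    integrable_weight_mul hhm hh0 hh1 w hg
  have c1 : ∀ u : Vec d, Continuous fun x : Sphere d => ip u x := continuous_inner_sphere
  set P := D.real {z | InBand b w z} with hP
  have hPh : ∫ x, h (ip w x) ∂uniformSphere d = P := by
    rw [hP, real_inBand_eq hfst, ← integral_indicator_one]
    · rfl
    · exact (measurableSet_le measurable_const (c1 w).measurable).inter
        (measurableSet_le (c1 w).measurable measurable_const)
  have hipu : ∀ x, ip u x = c * ip w x + s * ip v x := by
    intro x
    conv_lhs => rw [ip, hdec]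
    simp [ip, inner_add_left, inner_smul_left]
  -- reduction to the uniform distribution
  set k : Sphere d → ℝ := fun x => 2 * (h (ip w x) * ip w x) with hk
  have h1 : ∫ z in {z | InBand b w z}, increment u w z ∂D =
      ∫ z, (if z.2 = -1 then k z.1 * ip u z.1 else 0) ∂D := by
    rw [← integral_indicator (measurableSet_inBand b w)]
    congr 1
    ext z
    by_cases hz : InBand b w z
    · have hz' : ip w z.1 ∈ Set.Icc (b / 2) b := hz
      rw [Set.indicator_of_mem (by exact hz)]
      simp only [increment, hk, hh, Set.indicator_of_mem hz']
      split_ifs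
      · ring
      · rfl
    · have hz' : ip w z.1 ∉ Set.Icc (b / 2) b := hz
      rw [Set.indicator_of_notMem (by exact hz)]
      simp [hk, hh, Set.indicator_of_notMem hz']
  have h2 := integral_negative_le hu hnoise (k := k)
    (((hhm.comp (c1 w).measurable).mul (c1 w).measurable).const_mul 2)
    (fun x => by have := (hh2 (ip w x)).2.2; simp only [hk]; linarith)
    (fun x => by
      have := (hh2 (ip w x)).1
      have := mul_le_mul (hh1 (ip w x)) hb1 hb.le zero_le_one
      simp only [hk]; linarith)
  rw [h1]
  refine h2.trans ?_
  rw [hfst]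
  have i1 : Integrable (fun x => h (ip w x) * (ip w x * ip u x)) (uniformSphere d) :=
    hint ((c1 w).mul (c1 u))
  have i2 : Integrable (fun x => h (ip w x) * (ip w x * |ip u x|)) (uniformSphere d) :=
    hint ((c1 w).mul (c1 u).abs)
  have h3 : ∫ x, k x * (1 / 2 * ip u x - (1 - 2 * η) / 2 * |ip u x|) ∂uniformSphere d =
      ∫ x, h (ip w x) * (ip w x * ip u x) ∂uniformSphere d -
        (1 - 2 * η) * ∫ x, h (ip w x) * (ip w x * |ip u x|) ∂uniformSphere d := by
    rw [← integral_const_mul, ← integral_sub i1 (i2.const_mul _)]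
    congr 1
    ext x
    simp only [hk]
    ring
  rw [h3]
  have h4 : ∫ x, h (ip w x) * (ip w x * ip u x) ∂uniformSphere d ≤ b ^ 2 * P := by
    -- Replacing `v` by `-v` is a symmetry that fixes `w`.
    have hodd : ∫ x, h (ip w x) * (ip w x * ip v x) ∂uniformSphere d = 0 := by
      have := integral_swap (p := v) (q := -v) (w := w) hv (by rwa [norm_neg])
        (by rw [inner_neg_left, hvw, neg_zero]) fun s t => h s * (s * t)
      have h5 : ∀ x : Sphere d, h ⟪w, (x : Vec d)⟫_ℝ * (⟪w, (x : Vec d)⟫_ℝ * ⟪-v, (x : Vec d)⟫_ℝ) =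
          -(h (ip w x) * (ip w x * ip v x)) := fun x => by
        simp only [ip, inner_neg_left]; ring
      simp only [h5, integral_neg] at this
      have h6 : ∫ x, h (ip w x) * (ip w x * ip v x) ∂uniformSphere d =
        -∫ x, h (ip w x) * (ip w x * ip v x) ∂uniformSphere d := this
      linarith
    have i3 : Integrable (fun x => h (ip w x) * (ip w x * ip v x)) (uniformSphere d) :=
      hint ((c1 w).mul (c1 v))
    have i4 : Integrable (fun x => h (ip w x) * ip w x ^ 2) (uniformSphere d) :=
      hint ((c1 w).pow 2)
    have h5 : ∫ x, h (ip w x) * (ip w x * ip u x) ∂uniformSphere d =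
        c * ∫ x, h (ip w x) * ip w x ^ 2 ∂uniformSphere d +
          s * ∫ x, h (ip w x) * (ip w x * ip v x) ∂uniformSphere d := by
      rw [← integral_const_mul, ← integral_const_mul,
        ← integral_add (i4.const_mul _) (i3.const_mul _)]
      congr 1
      ext x
      rw [hipu]
      ring
    have h6 : ∫ x, h (ip w x) * ip w x ^ 2 ∂uniformSphere d ≤ b ^ 2 * P := by
      rw [← hPh, ← integral_const_mul]
      have i5 : Integrable (fun x => b ^ 2 * h (ip w x)) (uniformSphere d) := by
        have := (hint (g := fun _ => 1) continuous_const).const_mul (b ^ 2)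
        simpa using this
      refine integral_mono i4 i5 fun x => ?_
      have h7 := hh2 (ip w x)
      simp only
      by_cases ht : ip w x ∈ Set.Icc (b / 2) b
      · simp only [hh, Set.indicator_of_mem ht, one_mul, mul_one]
        exact pow_le_pow_left₀ (by have := ht.1; linarith) ht.2 2
      · simp [hh, Set.indicator_of_notMem ht]
    have h7 : 0 ≤ ∫ x, h (ip w x) * ip w x ^ 2 ∂uniformSphere d :=
      integral_nonneg fun x => mul_nonneg (hh0 _) (sq_nonneg _)
    rw [h5, hodd, mul_zero, add_zero]
    have := (abs_le.1 hc1).2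
    nlinarith
  have h5 : b / 2 * (s * (1 / (2 * √d) * P) - b * P) ≤
      ∫ x, h (ip w x) * (ip w x * |ip u x|) ∂uniformSphere d := by
    have h6 := abs_moment_lower_bound hd hhm hh0 hh1 hw hv hvw hdb (fun t ht => by
      have ht' : t ∈ Set.Icc (b / 2) b := Set.mem_of_indicator_ne_zero ht
      exact pow_le_pow_left₀ (by have := ht'.1; linarith) ht'.2 2)
    rw [hPh] at h6
    have i3 : Integrable (fun x => h (ip w x) * |ip v x|) (uniformSphere d) := hint (c1 v).abs
    have i5 : Integrable (fun x => h (ip w x)) (uniformSphere d) := by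
      simpa using hint (g := fun _ => 1) continuous_const
    calc b / 2 * (s * (1 / (2 * √d) * P) - b * P) ≤
        b / 2 * (s * ∫ x, h (ip w x) * |ip v x| ∂uniformSphere d -
          b * ∫ x, h (ip w x) ∂uniformSphere d) := by
          rw [hPh]; gcongr
      _ = ∫ x, b / 2 * (s * (h (ip w x) * |ip v x|) - b * h (ip w x)) ∂uniformSphere d := by
          rw [integral_const_mul, integral_sub (i3.const_mul _) (i5.const_mul _),
            integral_const_mul, integral_const_mul]
      _ ≤ _ := by
          refine integral_mono (((i3.const_mul _).sub (i5.const_mul _)).const_mul _) i2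
            fun x => ?_
          simp only
          by_cases ht : ip w x ∈ Set.Icc (b / 2) b
          · simp only [hh, Set.indicator_of_mem ht, one_mul, mul_one]
            have h7 : s * |ip v x| - b ≤ |ip u x| := by
              have h8 : s * ip v x = ip u x - c * ip w x := by rw [hipu]; ring
              have h9 : s * |ip v x| = |ip u x - c * ip w x| := by
                rw [← h8, abs_mul, abs_of_nonneg hs0]
              have h10 : |c * ip w x| ≤ b := by
                rw [abs_mul, abs_of_nonneg (by have := ht.1; linarith : 0 ≤ ip w x)]
                calc |c| * ip w x ≤ 1 * b := mul_le_mul hc1 ht.2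
                      (by have := ht.1; linarith) zero_le_one
                  _ = b := one_mul b
              have := abs_sub (ip u x) (c * ip w x)
              linarith
            calc b / 2 * (s * |ip v x| - b) ≤ b / 2 * |ip u x| := by gcongr
              _ ≤ ip w x * |ip u x| := by gcongr; exact ht.1
          · simp [hh, Set.indicator_of_notMem ht]
  have hP0 : 0 ≤ P := measureReal_nonneg
  have h6 : (1 - 2 * η) * (b / 2 * (s * (1 / (2 * √d) * P) - b * P)) ≤
      (1 - 2 * η) * ∫ x, h (ip w x) * (ip w x * |ip u x|) ∂uniformSphere d :=
    mul_le_mul_of_nonneg_left h5 (by linarith)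
  have h7 : (1 - 2 * η) * (b / 2 * (s * (1 / (2 * √d) * P) - b * P)) =
      P * ((1 - 2 * η) * b * s / (4 * √d)) - (1 - 2 * η) / 2 * (b ^ 2 * P) := by
    field_simp; ring
  have h8 : (1 - 2 * η) / 2 * (b ^ 2 * P) ≤ 1 * (b ^ 2 * P) := by gcongr; linarith
  rw [h7] at h6
  linarith

theorem abs_increment_le (hu : ‖u‖ = 1) (hw : ‖w‖ = 1) (hd : 3 ≤ d) (hb : 0 < b) {z : Example d}
    (hz : InBand b w z) : |increment u w z| ≤ 2 * b * (b + √(1 - ⟪u, w⟫_ℝ ^ 2)) := by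
  obtain ⟨v, hv, hvw, hdec⟩ := exists_orthogonal_decomposition hd hu hw
  have hc1 : |⟪u, w⟫_ℝ| ≤ 1 := by
    have := abs_real_inner_le_norm u w
    rwa [hu, hw, one_mul] at this
  set s := √(1 - ⟪u, w⟫_ℝ ^ 2) with hs
  have hs0 : 0 ≤ s := Real.sqrt_nonneg _
  have hpos : 0 ≤ ip w z.1 := by have := hz.1; linarith
  have hle : ip w z.1 ≤ b := hz.2
  have hipu : ip u z.1 = ⟪u, w⟫_ℝ * ip w z.1 + s * ip v z.1 := by
    conv_lhs => rw [ip, hdec]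
    simp [ip, inner_add_left, inner_smul_left]
  have h1 : |ip u z.1| ≤ b + s := by
    rw [hipu]
    refine (abs_add_le _ _).trans ?_
    rw [abs_mul, abs_mul, abs_of_nonneg hs0, abs_of_nonneg hpos]
    refine add_le_add ?_ (mul_le_of_le_one_right hs0 (abs_inner_sphere_le hv z.1))
    calc |⟪u, w⟫_ℝ| * ip w z.1 ≤ 1 * b := mul_le_mul hc1 hle hpos zero_le_one
      _ = b := one_mul b
  unfold increment
  split_ifs
  · rw [abs_mul, abs_mul, abs_of_nonneg hpos, abs_two]
    gcongr
  · rw [abs_zero]; positivity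

/-- The potential `exp (lam (1 - ⟪u, w⟫))`. -/
noncomputable def potential (u : Vec d) (lam : ℝ) (w : Vec d) : ℝ :=
  Real.exp (lam * (1 - ⟪u, w⟫_ℝ))

theorem potential_step {lam : ℝ} (hb : 0 < b) {z : Example d} (hz : InBand b w z) :
    potential u lam (step w z) = potential u lam w * Real.exp (lam * increment u w z) := by
  rw [potential, inner_step hb hz, mul_add, Real.exp_add, potential]

theorem integrableOn_increment_exp (hu : ‖u‖ = 1) (hw : ‖w‖ = 1) (hd : 3 ≤ d) (hb : 0 < b)
    {F : ℝ → ℝ} (hF : Continuous F) :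
    IntegrableOn (fun z => F (increment u w z)) {z | InBand b w z} D := by
  set M := 2 * b * (b + √(1 - ⟪u, w⟫_ℝ ^ 2)) with hM
  obtain ⟨C, hC⟩ := (isCompact_Icc (a := -M) (b := M)).exists_bound_of_continuousOn hF.continuousOn
  refine Measure.integrableOn_of_bounded (M := C) (measure_ne_top _ _)
    (hF.measurable.comp (measurable_increment u w)).aestronglyMeasurable ?_
  filter_upwards [ae_restrict_mem (measurableSet_inBand b w)] with z hz
  exact hC _ (abs_le.1 (abs_increment_le hu hw hd hb hz))

/-- Apply `exp t ≤ 1 + t + t²` for `|t| ≤ 1` to `t = lam · increment`: the linear term is the drift,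
and the quadratic one is bounded uniformly by `abs_increment_le`. -/
theorem integral_potential_step_le (hd : 3 ≤ d) (hfst : D.fst = uniformSphere d) (hη0 : 0 ≤ η)
    (hη : η < 1 / 2) (hnoise : BoundedNoise D η u) (hu : ‖u‖ = 1) (hw : ‖w‖ = 1) (hb : 0 < b)
    (hdb : d * b ^ 2 ≤ 1 / 100) {lam : ℝ} (hlam : 0 ≤ lam)
    (hsmall : lam * (2 * b * (b + √(1 - ⟪u, w⟫_ℝ ^ 2))) ≤ 1) :
    ∫ z in {z | InBand b w z}, potential u lam (step w z) ∂D ≤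
      D.real {z | InBand b w z} * (potential u lam w *
        (1 + lam * (2 * b ^ 2 - (1 - 2 * η) * b * √(1 - ⟪u, w⟫_ℝ ^ 2) / (4 * √d)) +
          (lam * (2 * b * (b + √(1 - ⟪u, w⟫_ℝ ^ 2)))) ^ 2)) := by
  set M := 2 * b * (b + √(1 - ⟪u, w⟫_ℝ ^ 2)) with hM
  have hBm := measurableSet_inBand b w
  set B := {z : Example d | InBand b w z} with hB
  have h1 : ∫ z in B, potential u lam (step w z) ∂D =
      potential u lam w * ∫ z in B, Real.exp (lam * increment u w z) ∂D := by
    rw [← integral_const_mul]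
    exact setIntegral_congr_fun hBm fun z hz => potential_step hb hz
  have i0 : IntegrableOn (fun z => Real.exp (lam * increment u w z)) B D :=
    integrableOn_increment_exp hu hw hd hb (F := fun t => Real.exp (lam * t)) (by fun_prop)
  have i1 : IntegrableOn (fun z => lam * increment u w z) B D :=
    integrableOn_increment_exp hu hw hd hb (F := fun t => lam * t) (by fun_prop)
  have i2 : IntegrableOn (fun _ : Example d => 1 + (lam * M) ^ 2) B D := integrableOn_const
  have h2 : ∫ z in B, Real.exp (lam * increment u w z) ∂D ≤
      ∫ z in B, (lam * increment u w z + (1 + (lam * M) ^ 2)) ∂D := by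
    refine setIntegral_mono_on i0 (i1.add i2) hBm fun z hz => ?_
    have h3 : |lam * increment u w z| ≤ lam * M := by
      rw [abs_mul, abs_of_nonneg hlam]
      exact mul_le_mul_of_nonneg_left (abs_increment_le hu hw hd hb hz) hlam
    have h4 := (abs_le.1 (Real.abs_exp_sub_one_sub_id_le (h3.trans hsmall))).2
    have h5 : (lam * increment u w z) ^ 2 ≤ (lam * M) ^ 2 := by
      rw [← sq_abs]
      exact pow_le_pow_left₀ (abs_nonneg _) h3 2
    linarith
  rw [integral_add i1 i2, integral_const_mul, setIntegral_const, smul_eq_mul] at h2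
  have h3 := integral_increment_le hd hfst hη0 hη hnoise hu hw hb hdb
  have h4 := mul_le_mul_of_nonneg_left h3 hlam
  have hpos : 0 ≤ potential u lam w := (Real.exp_pos _).le
  rw [h1]
  calc potential u lam w * ∫ z in B, Real.exp (lam * increment u w z) ∂D
      ≤ potential u lam w * (lam * (D.real B * (2 * b ^ 2 - (1 - 2 * η) * b *
          √(1 - ⟪u, w⟫_ℝ ^ 2) / (4 * √d))) + D.real B * (1 + (lam * M) ^ 2)) := by
        refine mul_le_mul_of_nonneg_left ?_ hpos
        linarith
    _ = _ := by ring

end Drift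

end PassivePerceptron


/-! ### The potential within one epoch. -/

namespace PassivePerceptron

open scoped InnerProductSpace

variable {d : ℕ}

theorem integrableOn_potential_step {D : Measure (Example d)} [IsProbabilityMeasure D]
    {u w : Vec d} {b lam : ℝ} (hu : ‖u‖ = 1) (hw : ‖w‖ = 1) (hd : 3 ≤ d) (hb : 0 < b) :
    IntegrableOn (fun z => potential u lam (step w z)) {z | InBand b w z} D := by
  have h := (integrableOn_increment_exp (D := D) hu hw hd hb
    (F := fun t => Real.exp (lam * t)) (by fun_prop)).const_mul (potential u lam w)
  exact IntegrableOn.congr_fun h (fun z hz => (potential_step hb hz).symm)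
    (measurableSet_inBand b w)

open Classical in
/-- One epoch: if the potential contracts on average up to an additive error as long as
`1 - ⟪u, w⟫` stays below `smax`, then `m` iterations lead from `κ ≤ ⟪u, w⟫` to `κ' ≤ ⟪u, w⟫`. -/
theorem FailBound.epoch {D : Measure (Example d)} [IsProbabilityMeasure D] (hd : 3 ≤ d)
    {G : Set (Vec d)} (hG : MeasurableSet G) {μ b : ℝ} {bs : List ℝ} {u : Vec d} (hu : ‖u‖ = 1)
    (hb : 0 < b) {β κ κ' lam r B smax δ' : ℝ} (hβ : 0 ≤ β) (hr0 : 0 ≤ r) (hr1 : r ≤ 1)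
    (hB : 0 ≤ B) (hlam : 0 ≤ lam)
    (h : FailBound D G μ bs fun w => if κ' ≤ ⟪u, w⟫_ℝ then ENNReal.ofReal β else 1)
    (hμ : ∀ w, ‖w‖ = 1 → 2 * μ ≤ D.real {z | InBand b w z})
    (hstep : ∀ w, ‖w‖ = 1 → 1 - ⟪u, w⟫_ℝ < smax →
      ∫ z in {z | InBand b w z}, potential u lam (step w z) ∂D ≤
        D.real {z | InBand b w z} * ((1 - r) * potential u lam w + B)) (m : ℕ)
    (hδ' : ((1 - r) ^ m * Real.exp (lam * (1 - κ)) + m * B) / Real.exp (lam * (1 - κ')) +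
      (Real.exp (lam * (1 - κ)) + m * B) / Real.exp (lam * smax) ≤ δ') :
    FailBound D G μ (List.replicate m b ++ bs)
      fun w => if κ ≤ ⟪u, w⟫_ℝ then ENNReal.ofReal (β + δ') else 1 := by
  set Xt := Real.exp (lam * (1 - κ')) with hXt
  set Xm := Real.exp (lam * smax) with hXm
  have hXt0 : 0 < Xt := Real.exp_pos _
  have hXm0 : 0 < Xm := Real.exp_pos _
  have hr2 : 0 ≤ 1 - r := by linarith
  -- With `n` iterations of the epoch left, failure has probability at most `a n · potential + c n`,
  -- apart from the term for the draws. The summand `(1 - r)^n / Xt` is Markov's inequality for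
  -- ending short of `κ'`. The summand `1 / Xm` is for reaching `smax` at any time, and so it does
  -- not contract. The sequence `c` collects the additive errors `B` and the failure probability `β`
  -- of the later epochs.
  set a : ℕ → ℝ := fun n => (1 - r) ^ n / Xt + 1 / Xm with ha
  set c : ℕ → ℝ := fun n => β + n * B * (1 / Xt + 1 / Xm) with hc
  have ha0 : ∀ n, 0 ≤ a n := fun n => by simp only [ha]; positivity
  have hc0 : ∀ n, 0 ≤ c n := fun n => by simp only [hc]; positivity
  have hpot : ∀ w, 0 < potential u lam w := fun w => Real.exp_pos _
  have key : ∀ n, FailBound D G μ (List.replicate n b ++ bs)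
      fun w => ENNReal.ofReal (a n * potential u lam w + c n) := by
    intro n
    induction n with
    | zero =>
      rw [List.replicate_zero, List.nil_append]
      refine h.mono fun w _ => ?_
      by_cases hκ : κ' ≤ ⟪u, w⟫_ℝ
      · left
        rw [if_pos hκ]
        refine ENNReal.ofReal_le_ofReal ?_
        have := mul_nonneg (ha0 0) (hpot w).le
        simp only [hc]
        simp
        exact this
      · right
        rw [← ENNReal.ofReal_one]
        refine ENNReal.ofReal_le_ofReal ?_
        have h1 : Xt ≤ potential u lam w := by
          rw [hXt, potential]
          gcongr
          exact (not_le.1 hκ).le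
        have h2 : 1 / Xt * Xt ≤ a 0 * potential u lam w := by
          refine mul_le_mul ?_ h1 hXt0.le (ha0 0)
          simp only [ha, pow_zero]
          have : 0 < 1 / Xm := by positivity
          linarith
        rw [one_div, inv_mul_cancel₀ hXt0.ne'] at h2
        linarith [hc0 0]
    | succ n ih =>
      rw [List.replicate_succ, List.cons_append]
      refine ih.cons hG hμ fun w hw => ?_
      -- From `smax` on, contraction is not assumed, but there the claimed bound is already at least
      -- `1`.
      rcases le_or_gt smax (1 - ⟪u, w⟫_ℝ) with hs | hs
      · left
        rw [← ENNReal.ofReal_one]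
        refine ENNReal.ofReal_le_ofReal ?_
        have h1 : Xm ≤ potential u lam w := by
          rw [hXm, potential]
          gcongr
        have h2 : 1 / Xm * Xm ≤ a (n + 1) * potential u lam w := by
          refine mul_le_mul ?_ h1 hXm0.le (ha0 _)
          simp only [ha]
          have : 0 ≤ (1 - r) ^ (n + 1) / Xt := by positivity
          linarith
        rw [one_div, inv_mul_cancel₀ hXm0.ne'] at h2
        linarith [hc0 (n + 1)]
      · right
        have i0 := integrableOn_potential_step (D := D) (lam := lam) hu hw hd hb
        have i1 : IntegrableOn (fun _ : Example d => c n) {z | InBand b w z} D := integrableOn_const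
        have i2 : IntegrableOn (fun z => a n * potential u lam (step w z)) {z | InBand b w z} D :=
          i0.const_mul (a n)
        have i3 : IntegrableOn (fun z => a n * potential u lam (step w z) + c n)
            {z | InBand b w z} D := i2.add i1
        rw [← ofReal_integral_eq_lintegral_ofReal i3
          (Filter.Eventually.of_forall fun z => by
            have := mul_nonneg (ha0 n) (hpot (step w z)).le
            have := hc0 n
            simp only [Pi.zero_apply]
            linarith), ← ofReal_measureReal, ← ENNReal.ofReal_mul measureReal_nonneg]
        refine ENNReal.ofReal_le_ofReal ?_
        rw [integral_add i2 i1, integral_const_mul, setIntegral_const, smul_eq_mul]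
        have h1 := mul_le_mul_of_nonneg_left (hstep w hw hs) (ha0 n)
        set P := D.real {z | InBand b w z} with hP
        have hP0 : 0 ≤ P := measureReal_nonneg
        set X := potential u lam w with hX
        have hX0 : 0 < X := hpot w
        have h2 : a n * ((1 - r) * X + B) + c n ≤ a (n + 1) * X + c (n + 1) := by
          have e1 : a n * (1 - r) ≤ a (n + 1) := by
            simp only [ha, pow_succ]
            have : 1 / Xm * (1 - r) ≤ 1 / Xm := mul_le_of_le_one_right (by positivity) (by linarith)
            have e : ((1 - r) ^ n / Xt + 1 / Xm) * (1 - r) =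
              (1 - r) ^ n * (1 - r) / Xt + 1 / Xm * (1 - r) := by ring
            rw [e]; linarith
          have e2 : a n * B ≤ B * (1 / Xt + 1 / Xm) := by
            rw [mul_comm]
            refine mul_le_mul_of_nonneg_left ?_ hB
            simp only [ha]
            have : (1 - r) ^ n ≤ 1 := pow_le_one₀ hr2 (by linarith)
            gcongr
          have e3 : c (n + 1) = c n + B * (1 / Xt + 1 / Xm) := by
            simp only [hc]; push_cast; ring
          have e4 := mul_le_mul_of_nonneg_right e1 hX0.le
          rw [e3]
          linarith
        have h3 := mul_le_mul_of_nonneg_left h2 hP0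
        linarith
  refine (key m).mono fun w _ => ?_
  by_cases hκ : κ ≤ ⟪u, w⟫_ℝ
  · left
    rw [if_pos hκ]
    refine ENNReal.ofReal_le_ofReal ?_
    have h1 : potential u lam w ≤ Real.exp (lam * (1 - κ)) := by
      rw [potential]
      gcongr
    have h2 := mul_le_mul_of_nonneg_left h1 (ha0 m)
    have h3 : a m * Real.exp (lam * (1 - κ)) + c m = β +
        (((1 - r) ^ m * Real.exp (lam * (1 - κ)) + m * B) / Xt +
      (Real.exp (lam * (1 - κ)) + m * B) / Xm) := by
      simp only [ha, hc]; ring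
    linarith
  · right
    rw [if_neg hκ]

set_option maxHeartbeats 400000 in
/-- The contraction of the potential in an epoch that starts with the angle `φ`; here
`S = 1 - cos φ` and the band width is `b = g φ / (√d L K)` with `g = 1 - 2 η`. -/
theorem potential_contraction {D : Measure (Example d)} [IsProbabilityMeasure D] (hd : 3 ≤ d)
    (hfst : D.fst = uniformSphere d) {η : ℝ} (hη0 : 0 ≤ η) (hη : η < 1 / 2) {u w : Vec d}
    (hnoise : BoundedNoise D η u) (hu : ‖u‖ = 1) (hw : ‖w‖ = 1) {b S φ L K : ℝ}
    (hS0 : 0 < S) (hS1 : S ≤ 1) (hφ : 0 < φ) (hφS : φ ^ 2 ≤ 5 * S) (hL : 1 ≤ L) (hK : 10 ^ 6 ≤ K)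
    (hb : b = (1 - 2 * η) * φ / (√d * L * K)) (hw' : 1 - ⟪u, w⟫_ℝ < 3 / 2 * S) :
    ∫ z in {z | InBand b w z}, potential u (8 * L / S) (step w z) ∂D ≤
      D.real {z | InBand b w z} *
        ((1 - (1 - 2 * η) ^ 2 * φ / (4 * √S * d * K)) * potential u (8 * L / S) w +
          3 * Real.exp L) := by
  set g := 1 - 2 * η with hg
  have hg0 : 0 < g := by rw [hg]; linarith
  have hg1 : g ≤ 1 := by rw [hg]; linarith
  have hd3 : (3 : ℝ) ≤ d := by exact_mod_cast hd
  set D' := √(d : ℝ) with hD'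
  have hD2 : D' ^ 2 = d := Real.sq_sqrt (by positivity)
  have hD1 : 1 ≤ D' := Real.one_le_sqrt.2 (by linarith)
  set σ := √S with hσ
  have hσ2 : σ ^ 2 = S := Real.sq_sqrt hS0.le
  have hσ0 : 0 < σ := Real.sqrt_pos.2 hS0
  -- `9/4` is a rational upper bound for `√5`.
  have hφσ : φ ≤ 9 / 4 * σ := by
    refine abs_le_of_sq_le_sq' ?_ (by positivity) |>.2
    rw [mul_pow, hσ2]; linarith
  have hb0 : 0 < b := by rw [hb]; positivity
  have hbL : b * L * D' * K = g * φ := by rw [hb]; field_simp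
  -- the only property of the band width that is needed
  have hbσ : b * L * D' ≤ g * σ * (9 / 4 / 10 ^ 6) := by
    have h1 : b * L * D' * 10 ^ 6 ≤ b * L * D' * K := by gcongr
    have h2 : g * φ ≤ g * (9 / 4 * σ) := by gcongr
    linarith
  have hbD : b * D' ≤ g * σ * (9 / 4 / 10 ^ 6) := by
    refine le_trans ?_ hbσ
    have : b * 1 * D' ≤ b * L * D' := by gcongr
    linarith
  have hbs : b ≤ σ * (9 / 4 / 10 ^ 6) := by
    have h1 : b * 1 ≤ b * D' := by gcongr
    have h2 : g * σ ≤ 1 * σ := by gcongr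
    linarith
  have hσ1 : σ ≤ 1 := Real.sqrt_le_one.2 hS1
  have hdb : d * b ^ 2 ≤ 1 / 100 := by
    have h1 : b * D' ≤ 1 / 10 := by
      have h2 : g * σ ≤ 1 * 1 := mul_le_mul hg1 hσ1 hσ0.le zero_le_one
      linarith
    have h2 : (b * D') ^ 2 ≤ (1 / 10) ^ 2 := pow_le_pow_left₀ (by positivity) h1 2
    rw [mul_pow, hD2] at h2
    linarith
  set lam := 8 * L / S with hlam
  have hlam0 : 0 < lam := by rw [hlam]; positivity
  have hlamσ : lam * σ ^ 2 = 8 * L := by rw [hσ2, hlam]; field_simp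
  clear_value lam D' σ
  set c := ⟪u, w⟫_ℝ with hc
  set y := √(1 - c ^ 2) with hy
  have hc1 : |c| ≤ 1 := by
    have := abs_real_inner_le_norm u w
    rwa [hu, hw, one_mul] at this
  obtain ⟨hc2, hc3⟩ := abs_le.1 hc1
  have hy0 : 0 ≤ y := Real.sqrt_nonneg _
  have hy2 : y ^ 2 = (1 - c) * (1 + c) := by
    rw [hy, Real.sq_sqrt (by nlinarith)]; ring
  have hyσ : y ≤ 2 * σ := by
    refine abs_le_of_sq_le_sq' ?_ (by positivity) |>.2
    rw [hy2, mul_pow, hσ2]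
    nlinarith
  have hM : 2 * b * (b + y) ≤ 6 * b * σ := by
    have : b + y ≤ 3 * σ := by linarith
    calc 2 * b * (b + y) ≤ 2 * b * (3 * σ) := by gcongr
      _ = _ := by ring
  have hM0 : 0 ≤ 2 * b * (b + y) := by positivity
  have hlb : lam * (b * σ) ≤ g / D' * (8 * (9 / 4 / 10 ^ 6)) := by
    rw [div_mul_eq_mul_div, le_div_iff₀ (by positivity)]
    have h1 : lam * (b * σ) * D' * σ = 8 * (b * L * D') := by
      calc lam * (b * σ) * D' * σ = lam * σ ^ 2 * (b * D') := by ring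
        _ = _ := by rw [hlamσ]; ring
    have h2 : lam * (b * σ) * D' * σ ≤ g * (8 * (9 / 4 / 10 ^ 6)) * σ := by
      rw [h1]; linarith
    exact le_of_mul_le_mul_right h2 hσ0
  have hgD : g / D' ≤ 1 := (div_le_one (by positivity)).2 (hg1.trans hD1)
  have hlM : lam * (2 * b * (b + y)) ≤ 6 * (lam * (b * σ)) := by
    have := mul_le_mul_of_nonneg_left hM hlam0.le
    linarith
  have hsmall : lam * (2 * b * (b + y)) ≤ 1 := by
    refine hlM.trans ?_
    linarith
  have hmain := integral_potential_step_le hd hfst hη0 hη hnoise hu hw hb0 hdb hlam0.le hsmall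
  rw [← hg, ← hc, ← hD', ← hy] at hmain
  refine hmain.trans (mul_le_mul_of_nonneg_left ?_ measureReal_nonneg)
  have hpot : 0 < potential u lam w := Real.exp_pos _
  -- The common scale: the drift will be at least `t/16` and each of the two error terms at most
  -- `t/64`, which leaves the contraction rate `t/32`.
  set t := lam * (b * σ) * (g / D') with ht
  have ht0 : 0 ≤ t := by positivity
  have hr : g ^ 2 * φ / (4 * σ * d * K) = t / 32 := by
    have h1 : lam = 8 * L / σ ^ 2 := by rw [hσ2, hlam]
    rw [ht, h1, ← hD2, hb]
    field_simp; ring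
  have hr1 : t / 32 ≤ 1 := by
    have : t ≤ g / D' * (8 * (9 / 4 / 10 ^ 6)) * 1 := mul_le_mul hlb hgD (by positivity)
      (by positivity)
    linarith
  have hdrift0 : 0 ≤ lam * (g * b * y / (4 * D')) := by positivity
  have hb2 : lam * (2 * b ^ 2) ≤ t / 64 := by
    have h1 : b ≤ g / D' * σ * (1 / 128) := by
      rw [div_mul_eq_mul_div, div_mul_eq_mul_div, le_div_iff₀ (by positivity)]
      have : 0 ≤ g * σ := by positivity
      linarith
    calc lam * (2 * b ^ 2) = lam * 2 * b * b := by ring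
      _ ≤ lam * 2 * b * (g / D' * σ * (1 / 128)) := by gcongr
      _ = t / 64 := by rw [ht]; ring
  rw [hr]
  -- Near `u` the drift may vanish, but the potential is at most `exp L` and grows at most
  -- threefold, which the additive term covers. Otherwise the sine `y` of the angle is at least
  -- `σ/4`, and the drift dominates.
  rcases lt_or_ge (1 - c) (S / 8) with hs | hs
  · have hX : potential u lam w ≤ Real.exp L := by
      rw [potential]
      gcongr
      calc lam * (1 - c) ≤ lam * (S / 8) := by gcongr
        _ = L := by rw [hlam]; field_simp
    have hfac : 1 + lam * (2 * b ^ 2 - g * b * y / (4 * D')) + (lam * (2 * b * (b + y))) ^ 2 ≤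
        3 := by
      have h1 : (lam * (2 * b * (b + y))) ^ 2 ≤ 1 := by
        exact pow_le_one₀ (mul_nonneg hlam0.le hM0) hsmall
      linarith
    have h2 : potential u lam w * (1 + lam * (2 * b ^ 2 - g * b * y / (4 * D')) +
        (lam * (2 * b * (b + y))) ^ 2) ≤ potential u lam w * 3 := by gcongr
    have h3 : 0 ≤ (1 - t / 32) * potential u lam w := mul_nonneg (by linarith) hpot.le
    linarith
  · have hyl : σ / 4 ≤ y := by
      refine abs_le_of_sq_le_sq' ?_ hy0 |>.2
      rw [hy2, div_pow, hσ2]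
      -- `1 + c ≥ 1/2` because `1 - c < 3S/2 ≤ 3/2`: staying below the level `3S/2` keeps `w` away
      -- from `-u`.
      have h1 : (1 - c) * (1 / 2) ≤ (1 - c) * (1 + c) := by gcongr; linarith
      linarith
    have h1 : t / 16 ≤ lam * (g * b * y / (4 * D')) := by
      calc t / 16 = lam * (g * b * (σ / 4) / (4 * D')) := by rw [ht]; field_simp; ring
        _ ≤ _ := by gcongr
    have h2 : (lam * (2 * b * (b + y))) ^ 2 ≤ t / 64 := by
      have h3 : (lam * (2 * b * (b + y))) ^ 2 ≤ (6 * (lam * (b * σ))) ^ 2 :=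
        pow_le_pow_left₀ (by positivity) hlM 2
      have h4 : lam * (b * σ) * (lam * (b * σ)) ≤
          lam * (b * σ) * (g / D' * (8 * (9 / 4 / 10 ^ 6))) := by gcongr
      have h5 : lam * (b * σ) * (g / D' * (8 * (9 / 4 / 10 ^ 6))) =
        t * (8 * (9 / 4 / 10 ^ 6)) := by rw [ht]; ring
      have h6 : (6 * (lam * (b * σ))) ^ 2 = 36 * (lam * (b * σ) * (lam * (b * σ))) := by ring
      linarith
    have h3 : 1 + lam * (2 * b ^ 2 - g * b * y / (4 * D')) + (lam * (2 * b * (b + y))) ^ 2 ≤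
        1 - t / 32 := by linarith
    have h4 := mul_le_mul_of_nonneg_left h3 hpot.le
    have := Real.exp_pos L
    linarith

end PassivePerceptron


/-! ### Halving the angle in one epoch. -/

namespace PassivePerceptron

open scoped InnerProductSpace

variable {d : ℕ}

-- The potential starts at most at `exp (8L)`. Missing the target puts it above `exp (2L)`, because
-- `1 - cos (φ/2) ≥ S/4`, and escaping means `exp (12L)`. The `m` contractions reduce `exp (8L)` to
-- at most `exp L`, so either event has probability at most `(1 + 3m) exp (-L)`; finally `2 (1 + 3m)
-- ≤ m²` for `m ≥ 8`.
open Classical in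
theorem FailBound.halve_angle {D : Measure (Example d)} [IsProbabilityMeasure D] (hd : 3 ≤ d)
    (hfst : D.fst = uniformSphere d) {η : ℝ} (hη0 : 0 ≤ η) (hη : η < 1 / 2) {u : Vec d}
    (hnoise : BoundedNoise D η u) (hu : ‖u‖ = 1) {G : Set (Vec d)} (hG : MeasurableSet G)
    {μ b φ L K β δ' : ℝ} {bs : List ℝ} {m : ℕ} (hφ : 0 < φ) (hφ' : φ ≤ Real.pi / 2) (hL : 1 ≤ L)
    (hK : 10 ^ 6 ≤ K) (hb : b = (1 - 2 * η) * φ / (√d * L * K)) (hβ : 0 ≤ β)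
    (h : FailBound D G μ bs fun w =>
      if Real.cos (φ / 2) ≤ ⟪u, w⟫_ℝ then ENNReal.ofReal β else 1)
    (hμ : ∀ w, ‖w‖ = 1 → 2 * μ ≤ D.real {z | InBand b w z})
    (hm : 8 ≤ m) (hmL : 7 * L ≤ (1 - 2 * η) ^ 2 / (4 * d * K) * m)
    (hδ : Real.exp (-L) = δ' / (m : ℝ) ^ 2) :
    FailBound D G μ (List.replicate m b ++ bs)
      fun w => if Real.cos φ ≤ ⟪u, w⟫_ℝ then ENNReal.ofReal (β + δ') else 1 := by
  set g := 1 - 2 * η with hg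
  have hg0 : 0 < g := by rw [hg]; linarith
  have hg1 : g ≤ 1 := by rw [hg]; linarith
  have hd3 : (3 : ℝ) ≤ d := by exact_mod_cast hd
  have hpi := Real.pi_pos
  set S := 1 - Real.cos φ with hS
  have hS1 : S ≤ 1 := by
    have := Real.cos_nonneg_of_mem_Icc (x := φ) ⟨by linarith, hφ'⟩
    rw [hS]; linarith
  have hφS : φ ^ 2 ≤ 5 * S := by
    -- This gives `1 - cos φ ≥ 2φ²/π²`, and `π² ≤ 10` yields the constant `5`.
    have h1 := Real.cos_le_one_sub_mul_cos_sq (x := φ) (by rw [abs_of_pos hφ]; linarith)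
    have h2 : 2 / Real.pi ^ 2 * φ ^ 2 ≤ S := by rw [hS]; linarith
    rw [div_mul_eq_mul_div, div_le_iff₀ (by positivity)] at h2
    have h3 : Real.pi ^ 2 ≤ 10 := by
      have := Real.pi_lt_d2
      nlinarith
    have h4 : 0 ≤ S := by rw [hS]; linarith [Real.cos_le_one φ]
    nlinarith
  have hS0 : 0 < S := by have : 0 < φ ^ 2 := by positivity
                         linarith
  have hSφ : √S ≤ φ := by
    rw [Real.sqrt_le_left hφ.le]
    have := Real.one_sub_sq_div_two_le_cos (x := φ)
    have : 0 ≤ φ ^ 2 := sq_nonneg φ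
    rw [hS]; linarith
  set σ := √S with hσ
  have hσ0 : 0 < σ := Real.sqrt_pos.2 hS0
  have hσ2 : σ ^ 2 = S := Real.sq_sqrt hS0.le
  have hφσ : φ ≤ 9 / 4 * σ := by
    refine abs_le_of_sq_le_sq' ?_ (by positivity) |>.2
    rw [mul_pow, hσ2]; linarith
  have hhalf : S / 4 ≤ 1 - Real.cos (φ / 2) := by
    have h1 : Real.cos φ = 2 * Real.cos (φ / 2) ^ 2 - 1 := by
      rw [← Real.cos_two_mul]; congr 1; ring
    have h2 := Real.cos_le_one (φ / 2)
    rw [hS, h1]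
    nlinarith
  have hb0 : 0 < b := by rw [hb]; positivity
  set r := g ^ 2 * φ / (4 * σ * d * K) with hr
  have hr0 : 0 ≤ r := by positivity
  have hr1 : r ≤ 1 := by
    rw [hr, div_le_one (by positivity)]
    have h1 : g ^ 2 * φ ≤ 1 * φ := by gcongr; exact pow_le_one₀ hg0.le hg1
    have h2 : 4 * σ * 3 * 10 ^ 6 ≤ 4 * σ * d * K := by gcongr
    linarith
  have hrm : 7 * L ≤ r * m := by
    refine hmL.trans (mul_le_mul_of_nonneg_right ?_ (Nat.cast_nonneg m))
    calc g ^ 2 / (4 * d * K) = g ^ 2 * σ / (4 * σ * d * K) := by field_simp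
      _ ≤ r := by rw [hr]; gcongr
  have hlamS : ∀ x : ℝ, 8 * L / S * (x * S) = 8 * L * x := fun x => by field_simp
  have hm8 : (8 : ℝ) ≤ m := by exact_mod_cast hm
  refine h.epoch hd hG hu hb0 (r := r) (B := 3 * Real.exp L) (smax := 3 / 2 * S)
    (lam := 8 * L / S) hβ hr0 hr1 (by positivity) (by positivity) hμ
    (fun w hw hs => potential_contraction hd hfst hη0 hη hnoise hu hw hS0 hS1 hφ hφS hL hK hb hs)
    m ?_
  rw [← hS]
  have e8 : 8 * L / S * S = 8 * L := by field_simp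
  have e12 : 8 * L / S * (3 / 2 * S) = 12 * L := by rw [hlamS]; ring
  have e2 : Real.exp (2 * L) ≤ Real.exp (8 * L / S * (1 - Real.cos (φ / 2))) := by
    refine Real.exp_le_exp.2 ?_
    calc 2 * L = 8 * L / S * (1 / 4 * S) := by rw [hlamS]; ring
      _ ≤ _ := by gcongr; linarith
  rw [e8, e12]
  have hpow : (1 - r) ^ m ≤ Real.exp (-(7 * L)) := by
    calc (1 - r) ^ m ≤ (Real.exp (-r)) ^ m := by
          have := Real.one_sub_le_exp_neg r
          have : 0 ≤ 1 - r := by linarith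
          gcongr
      _ = Real.exp (-(r * m)) := by rw [← Real.exp_nat_mul]; congr 1; ring
      _ ≤ _ := by gcongr
  have h1 : ((1 - r) ^ m * Real.exp (8 * L) + m * (3 * Real.exp L)) /
      Real.exp (8 * L / S * (1 - Real.cos (φ / 2))) ≤ (1 + 3 * m) * Real.exp (-L) := by
    have h2 : (1 - r) ^ m * Real.exp (8 * L) ≤ Real.exp L := by
      calc (1 - r) ^ m * Real.exp (8 * L) ≤ Real.exp (-(7 * L)) * Real.exp (8 * L) := by gcongr
        _ = Real.exp L := by rw [← Real.exp_add]; congr 1; ring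
    rw [div_le_iff₀ (Real.exp_pos _)]
    calc (1 - r) ^ m * Real.exp (8 * L) + m * (3 * Real.exp L)
        ≤ (1 + 3 * m) * Real.exp L := by linarith
      _ = (1 + 3 * m) * Real.exp (-L) * Real.exp (2 * L) := by
          rw [mul_assoc, ← Real.exp_add]; congr 2; ring
      _ ≤ _ := by gcongr
  have h2 : (Real.exp (8 * L) + m * (3 * Real.exp L)) / Real.exp (12 * L) ≤
      (1 + 3 * m) * Real.exp (-L) := by
    rw [div_le_iff₀ (Real.exp_pos _)]
    have h3 : Real.exp L ≤ Real.exp (8 * L) := Real.exp_le_exp.2 (by linarith)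
    have h4 : Real.exp (8 * L) ≤ Real.exp (-L) * Real.exp (12 * L) := by
      rw [← Real.exp_add]; exact Real.exp_le_exp.2 (by linarith)
    calc Real.exp (8 * L) + m * (3 * Real.exp L)
        ≤ Real.exp (8 * L) + m * (3 * Real.exp (8 * L)) := by gcongr
      _ = (1 + 3 * m) * Real.exp (8 * L) := by ring
      _ ≤ (1 + 3 * m) * (Real.exp (-L) * Real.exp (12 * L)) := by gcongr
      _ = _ := by ring
  have hδ0 : 0 ≤ δ' := by
    have := Real.exp_pos (-L)
    rw [hδ] at this
    by_contra hneg
    have := div_nonpos_of_nonpos_of_nonneg (not_le.1 hneg).le (sq_nonneg (m : ℝ))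
    linarith
  refine (add_le_add h1 h2).trans ?_
  rw [hδ, ← add_mul, mul_div_assoc', div_le_iff₀ (by positivity),
    mul_comm]
  exact mul_le_mul_of_nonneg_left (by nlinarith) hδ0

/-! ### Estimates for the two schedules. -/

section Schedule

variable {η δ : ℝ} {k : ℕ}

/-- The factor `(3200 π)³ d / (1 - 2 η)²` of the sample schedule. -/
noncomputable def scaleFactor (d : ℕ) (η : ℝ) : ℝ := (3200 * Real.pi) ^ 3 * d / (1 - 2 * η) ^ 2

/-- The logarithmic factor of the sample schedule. -/
noncomputable def scheduleLog (d : ℕ) (η δ : ℝ) (k : ℕ) : ℝ :=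
  Real.log (scaleFactor d η) + Real.log (k * (k + 1) / δ)

/-- The logarithm in the band width schedule. -/
noncomputable def bandLog (d : ℕ) (η δ : ℝ) (k : ℕ) : ℝ :=
  Real.log ((sampleSchedule d η δ k : ℝ) ^ 2 * (k * (k + 1)) / δ)

theorem sampleSchedule_eq : sampleSchedule d η δ k = ⌈scaleFactor d η * scheduleLog d η δ k⌉₊ := rfl

theorem bandSchedule_eq : bandSchedule d η δ k =
    (1 - 2 * η) * (Real.pi / 2 ^ k) / (√d * bandLog d η δ k * (2 * (600 * Real.pi) ^ 2)) := by
  unfold bandSchedule bandLog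
  rw [one_div, one_div, inv_pow]
  simp only [div_eq_mul_inv, mul_inv]
  ring

theorem scaleFactor_ge (hd : 3 ≤ d) (hη0 : 0 ≤ η) (hη : η < 1 / 2) :
    10 ^ 6 ≤ scaleFactor d η := by
  have hd3 : (3 : ℝ) ≤ d := by exact_mod_cast hd
  have hpi := Real.pi_gt_three
  have hg : 0 < (1 - 2 * η) ^ 2 := pow_pos (by linarith) 2
  have hg1 : (1 - 2 * η) ^ 2 ≤ 1 := pow_le_one₀ (by linarith) (by linarith)
  rw [scaleFactor, le_div_iff₀ hg]
  calc (10 : ℝ) ^ 6 * (1 - 2 * η) ^ 2 ≤ 10 ^ 6 * 1 := by gcongr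
    _ ≤ (3200 * 3) ^ 3 * 3 := by norm_num
    _ ≤ _ := by gcongr

theorem one_le_ratio (hk : 1 ≤ k) (hδ0 : 0 < δ) (hδ1 : δ < 1) :
    1 ≤ (k * (k + 1) / δ : ℝ) := by
  have hk1 : (1 : ℝ) ≤ k := by exact_mod_cast hk
  rw [le_div_iff₀ hδ0]
  nlinarith

theorem one_le_log_of_le {x : ℝ} (hx : 10 ^ 6 ≤ x) : 1 ≤ Real.log x := by
  rw [Real.le_log_iff_exp_le (by linarith)]
  have := Real.exp_one_lt_d9
  linarith

/-- The ranges of the parameters of the schedules. -/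
structure Admissible (d : ℕ) (η δ : ℝ) (k : ℕ) : Prop where
  dim : 3 ≤ d
  noise_nonneg : 0 ≤ η
  noise_lt : η < 1 / 2
  epoch : 1 ≤ k
  conf_pos : 0 < δ
  conf_lt : δ < 1

theorem one_le_scheduleLog (h : Admissible d η δ k) : 1 ≤ scheduleLog d η δ k :=
  (one_le_log_of_le (scaleFactor_ge h.dim h.noise_nonneg h.noise_lt)).trans
    (le_add_of_nonneg_right (Real.log_nonneg (one_le_ratio h.epoch h.conf_pos h.conf_lt)))

theorem scaleFactor_mul_le (d : ℕ) (η δ : ℝ) (k : ℕ) : scaleFactor d η * scheduleLog d η δ k ≤ sampleSchedule d η δ k :=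
  Nat.le_ceil _

theorem sampleSchedule_ge (h : Admissible d η δ k) : (10 ^ 6 : ℝ) ≤ sampleSchedule d η δ k := by
  obtain ⟨hd, hη0, hη, hk, hδ0, hδ1⟩ := id h
  have h1 := scaleFactor_mul_le d η δ k
  have h2 := one_le_scheduleLog h
  have h3 := scaleFactor_ge hd hη0 hη
  nlinarith

theorem sampleSchedule_le (h : Admissible d η δ k) :
    (sampleSchedule d η δ k : ℝ) ≤ 2 * scaleFactor d η * scheduleLog d η δ k := by
  obtain ⟨hd, hη0, hη, hk, hδ0, hδ1⟩ := id h
  have h2 := one_le_scheduleLog h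
  have h3 := scaleFactor_ge hd hη0 hη
  have h4 : 1 ≤ scaleFactor d η * scheduleLog d η δ k := by nlinarith
  have h1 := (Nat.ceil_lt_add_one (zero_le_one.trans h4)).le
  rw [sampleSchedule_eq]
  linarith

theorem bandLog_eq (h : Admissible d η δ k) : bandLog d η δ k =
    2 * Real.log (sampleSchedule d η δ k) + Real.log (k * (k + 1) / δ) := by
  obtain ⟨hd, hη0, hη, hk, hδ0, hδ1⟩ := id h
  have hm := sampleSchedule_ge h
  have hr := one_le_ratio hk hδ0 hδ1
  rw [bandLog, mul_div_assoc, Real.log_mul (by positivity) (by linarith), Real.log_pow]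
  norm_num

theorem one_le_bandLog (h : Admissible d η δ k) : 1 ≤ bandLog d η δ k := by
  obtain ⟨hd, hη0, hη, hk, hδ0, hδ1⟩ := id h
  have h1 := one_le_log_of_le (sampleSchedule_ge h)
  have h2 := Real.log_nonneg (one_le_ratio hk hδ0 hδ1)
  rw [bandLog_eq h]
  linarith

/-- The sample size enters the band width only through its logarithm, where the factor `scheduleLog`
of `m_k` costs only `log ℓ ≤ ℓ - 1`. So the two logarithms agree up to a constant. -/
theorem bandLog_le (h : Admissible d η δ k) : bandLog d η δ k ≤ 5 * scheduleLog d η δ k := by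
  obtain ⟨hd, hη0, hη, hk, hδ0, hδ1⟩ := id h
  have hm := sampleSchedule_ge h
  have hA := scaleFactor_ge hd hη0 hη
  have hl := one_le_scheduleLog h
  have h1 : Real.log (sampleSchedule d η δ k) ≤
      Real.log (2 * scaleFactor d η * scheduleLog d η δ k) :=
    Real.log_le_log (by linarith) (sampleSchedule_le h)
  rw [Real.log_mul (by positivity) (by positivity), Real.log_mul (by norm_num) (by positivity)] at h1
  have h2 := Real.log_le_sub_one_of_pos (zero_lt_one.trans_le hl)
  have h3 := Real.log_le_sub_one_of_pos (x := 2) (by norm_num)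
  have h4 := Real.log_nonneg (one_le_ratio hk hδ0 hδ1)
  have h5 := one_le_log_of_le hA
  rw [bandLog_eq h]
  have h6 : scheduleLog d η δ k = Real.log (scaleFactor d η) + Real.log (k * (k + 1) / δ) := rfl
  linarith

/-- The factor `m_k²` inside the logarithm pays for the `2 (1 + 3m)` lost in `FailBound.halve_angle`
and leaves `δ/(k(k+1))` for the epoch. -/
theorem exp_neg_bandLog (h : Admissible d η δ k) : Real.exp (-bandLog d η δ k) =
    δ / (k * (k + 1)) / (sampleSchedule d η δ k : ℝ) ^ 2 := by
  obtain ⟨hd, hη0, hη, hk, hδ0, hδ1⟩ := id h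
  have hm := sampleSchedule_ge h
  have hk1 : (1 : ℝ) ≤ k := by exact_mod_cast hk
  rw [Real.exp_neg, bandLog, Real.exp_log (by positivity)]
  field_simp

/-- This is the condition that `m_k` contractions shrink the potential by `exp (-7L)`. After
cancellation it reads `35 ≤ 3200³ π / (8 · 600²)`, which holds with ample room. -/
theorem seven_mul_bandLog_le (h : Admissible d η δ k) : 7 * bandLog d η δ k ≤
    (1 - 2 * η) ^ 2 / (4 * d * (2 * (600 * Real.pi) ^ 2)) * sampleSchedule d η δ k := by
  obtain ⟨hd, hη0, hη, hk, hδ0, hδ1⟩ := id h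
  have hd3 : (3 : ℝ) ≤ d := by exact_mod_cast hd
  have hpi := Real.pi_gt_three
  have hg : 0 < 1 - 2 * η := by linarith
  have hl := one_le_scheduleLog h
  calc 7 * bandLog d η δ k ≤ 7 * (5 * scheduleLog d η δ k) := by
        gcongr; exact bandLog_le h
    _ = 35 * scheduleLog d η δ k := by ring
    _ ≤ (3200 ^ 3 / (8 * 600 ^ 2) * Real.pi) * scheduleLog d η δ k := by
        gcongr
        linarith
    _ = (1 - 2 * η) ^ 2 / (4 * d * (2 * (600 * Real.pi) ^ 2)) *
        (scaleFactor d η * scheduleLog d η δ k) := by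
        rw [scaleFactor]
        field_simp
        ring
    _ ≤ _ := by
        gcongr
        exact scaleFactor_mul_le d η δ k

theorem scheduleLog_mono {k' : ℕ} (hδ0 : 0 < δ) (hk : 1 ≤ k) (hkk : k ≤ k') :
    scheduleLog d η δ k ≤ scheduleLog d η δ k' := by
  have hk1 : (1 : ℝ) ≤ k := by exact_mod_cast hk
  have hkk' : (k : ℝ) ≤ k' := by exact_mod_cast hkk
  unfold scheduleLog
  gcongr

end Schedule

end PassivePerceptron


/-! ### All epochs together, and the complexity bounds. -/

namespace PassivePerceptron

open scoped InnerProductSpace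

variable {d : ℕ}

/-- The unit vectors at an angle of at most `θ` with `u`, for `0 ≤ θ ≤ π`. -/
def cap (u : Vec d) (θ : ℝ) : Set (Vec d) := {w | ‖w‖ = 1 ∧ Real.cos θ ≤ ⟪u, w⟫_ℝ}

theorem measurableSet_cap (u : Vec d) (θ : ℝ) : MeasurableSet (cap u θ) := by
  have h1 : IsClosed {w : Vec d | ‖w‖ = 1} := isClosed_eq continuous_norm continuous_const
  have h2 : IsClosed {w : Vec d | Real.cos θ ≤ ⟪u, w⟫_ℝ} :=
    isClosed_le continuous_const (by fun_prop)
  exact (h1.inter h2).measurableSet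

-- Backward induction over the epochs: epoch `k` starts within angle `π/2^k` and should end within
-- `π/2^(k+1)`. The failure probabilities `δ/(k(k+1))` telescope.
open Classical in
theorem failBound_widths {D : Measure (Example d)} [IsProbabilityMeasure D] (hd : 3 ≤ d)
    (hfst : D.fst = uniformSphere d) {η δ : ℝ} (hη0 : 0 ≤ η) (hη : η < 1 / 2) {u : Vec d}
    (hnoise : BoundedNoise D η u) (hu : ‖u‖ = 1) (hδ0 : 0 < δ) (hδ1 : δ < 1) {μ : ℝ} {K : ℕ}
    (hμ : ∀ k, 1 ≤ k → k ≤ K → ∀ w : Vec d, ‖w‖ = 1 →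
      2 * μ ≤ D.real {z | InBand (bandSchedule d η δ k) w z}) (n k : ℕ) (hk : 1 ≤ k)
    (hkn : k + n = K + 1) :
    FailBound D (cap u (Real.pi / 2 ^ (K + 1))) μ
      (widths (sampleSchedule d η δ) (bandSchedule d η δ) (List.range' k n))
      fun w => if Real.cos (Real.pi / 2 ^ k) ≤ ⟪u, w⟫_ℝ then
        ENNReal.ofReal (δ / k - δ / (K + 1)) else 1 := by
  induction n generalizing k with
  | zero =>
    obtain rfl : k = K + 1 := by omega
    refine FailBound.nil _ _ _ _ fun w hw hG => ?_
    rw [if_neg fun h => hG ⟨hw, h⟩]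
  | succ n ih =>
    have hadm : Admissible d η δ k := ⟨hd, hη0, hη, hk, hδ0, hδ1⟩
    have hk1 : (1 : ℝ) ≤ k := by exact_mod_cast hk
    have hkK : (k : ℝ) + 1 ≤ K + 1 := by
      have : k ≤ K := by omega
      have : (k : ℝ) ≤ K := by exact_mod_cast this
      linarith
    have h := ih (k + 1) (by omega) (by omega)
    have hhalf : Real.pi / 2 ^ (k + 1) = Real.pi / 2 ^ k / 2 := by rw [pow_succ, div_div]
    have hangle : Real.pi / 2 ^ k ≤ Real.pi / 2 := by
      have : (2 : ℝ) ^ 1 ≤ 2 ^ k := pow_le_pow_right₀ (by norm_num) hk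
      rw [pow_one] at this
      have := Real.pi_pos
      gcongr
    have hβ : 0 ≤ δ / ((k + 1 : ℕ) : ℝ) - δ / (K + 1) := by
      push_cast
      rw [sub_nonneg]
      gcongr
    have hm := sampleSchedule_ge hadm
    have hmN : 8 ≤ sampleSchedule d η δ k := by
      have : (8 : ℝ) ≤ sampleSchedule d η δ k := by linarith
      exact_mod_cast this
    have hK6 : (10 : ℝ) ^ 6 ≤ 2 * (600 * Real.pi) ^ 2 := by
      have := Real.pi_gt_three
      calc (10 : ℝ) ^ 6 ≤ 2 * (600 * 3) ^ 2 := by norm_num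
        _ ≤ _ := by gcongr
    rw [hhalf] at h
    have hres := FailBound.halve_angle hd hfst hη0 hη hnoise hu (measurableSet_cap u _)
      (by positivity) hangle (one_le_bandLog hadm) hK6 bandSchedule_eq hβ h
      (hμ k hk (by omega)) hmN (seven_mul_bandLog_le hadm) (exp_neg_bandLog hadm)
    have e : δ / ((k + 1 : ℕ) : ℝ) - δ / (K + 1) + δ / (k * (k + 1)) = δ / k - δ / (K + 1) := by
      push_cast
      field_simp
      ring
    rw [e] at hres
    rw [List.range'_succ, widths, List.flatMap_cons]
    exact hres

theorem bandSchedule_pos {η δ : ℝ} {k : ℕ} (h : Admissible d η δ k) :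
    0 < bandSchedule d η δ k := by
  have h1 := one_le_bandLog h
  have h2 : 0 < 1 - 2 * η := by linarith [h.noise_lt]
  have h3 : (0 : ℝ) < d := by exact_mod_cast (by have := h.dim; omega : 0 < d)
  have := Real.pi_pos
  rw [bandSchedule_eq]
  positivity

theorem bandSchedule_mul_sqrt {η δ : ℝ} {k : ℕ} (h : Admissible d η δ k) :
    bandSchedule d η δ k * √d =
      (1 - 2 * η) * (Real.pi / 2 ^ k) / (bandLog d η δ k * (2 * (600 * Real.pi) ^ 2)) := by
  have h1 := one_le_bandLog h
  have h3 : (0 : ℝ) < d := by exact_mod_cast (by have := h.dim; omega : 0 < d)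
  rw [bandSchedule_eq]
  field_simp

/-- Both `2^k` and the logarithm grow with `k`, so the value at the last epoch `K` serves all
epochs. The constant is `3000 = 300 · 5 · 2`, from `band_real_lower_bound`, `bandLog_le` and the
band width. -/
theorem inBand_real_lower_bound {D : Measure (Example d)} [IsProbabilityMeasure D]
    (hfst : D.fst = uniformSphere d) {η δ : ℝ} {k K : ℕ} (h : Admissible d η δ k) (hkK : k ≤ K)
    {w : Vec d} (hw : ‖w‖ = 1) :
    (1 - 2 * η) * Real.pi / (2 ^ K * scheduleLog d η δ K * (3000 * (600 * Real.pi) ^ 2)) ≤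
      D.real {z | InBand (bandSchedule d η δ k) w z} := by
  have hσ : IsProbabilityMeasure (uniformSphere d) := by rw [← hfst]; infer_instance
  have hb := bandSchedule_pos h
  have hs := bandSchedule_mul_sqrt h
  have h1 := one_le_bandLog h
  have hpi := Real.pi_gt_three
  have hg : 0 < 1 - 2 * η := by linarith [h.noise_lt]
  have hg1 : 1 - 2 * η ≤ 1 := by linarith [h.noise_nonneg]
  have hsmall : bandSchedule d η δ k * √d ≤ 1 / 10 := by
    rw [hs, div_le_div_iff₀ (by positivity) (by norm_num)]
    have e1 : Real.pi / 2 ^ k ≤ Real.pi := div_le_self (by positivity) (one_le_pow₀ (by norm_num))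
    have e2 : (1 - 2 * η) * (Real.pi / 2 ^ k) ≤ 1 * Real.pi := by gcongr
    have e3 : 1 * (2 * (600 * Real.pi) ^ 2) ≤ bandLog d η δ k * (2 * (600 * Real.pi) ^ 2) := by
      gcongr
    nlinarith
  have hdb : d * bandSchedule d η δ k ^ 2 ≤ 1 / 100 := by
    have h2 : (bandSchedule d η δ k * √d) ^ 2 ≤ (1 / 10) ^ 2 :=
      pow_le_pow_left₀ (by positivity) hsmall 2
    rw [mul_pow, Real.sq_sqrt (Nat.cast_nonneg d)] at h2
    linarith
  rw [real_inBand_eq hfst]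
  refine le_trans ?_ (band_real_lower_bound h.dim hw hb hdb)
  rw [hs, div_div]
  have hl : 1 ≤ scheduleLog d η δ k := one_le_scheduleLog h
  have hlK := scheduleLog_mono (d := d) (η := η) h.conf_pos h.epoch hkK
  have h2 : bandLog d η δ k ≤ 5 * scheduleLog d η δ K := (bandLog_le h).trans (by linarith)
  have h3 : (2 : ℝ) ^ k ≤ 2 ^ K := pow_le_pow_right₀ (by norm_num) hkK
  calc (1 - 2 * η) * Real.pi / (2 ^ K * scheduleLog d η δ K * (3000 * (600 * Real.pi) ^ 2))
      = (1 - 2 * η) * (Real.pi / 2 ^ K) /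
        (5 * scheduleLog d η δ K * (2 * (600 * Real.pi) ^ 2) * 300) := by
        field_simp; ring
    _ ≤ _ := by gcongr

theorem cast_length_widths (m : ℕ → ℕ) (b : ℕ → ℝ) (l : List ℕ) :
    (widths m b l).length = (l.map m).sum := by
  simp [widths, List.length_flatMap]

/-- Bounds for the number of epochs. -/
theorem epochs_bounds {ε : ℝ} (hε0 : 0 < ε) (hε1 : ε < 1) :
    1 ≤ ⌈Real.logb 2 (1 / ε)⌉₊ ∧ 1 / ε ≤ 2 ^ ⌈Real.logb 2 (1 / ε)⌉₊ ∧
      (2 : ℝ) ^ ⌈Real.logb 2 (1 / ε)⌉₊ ≤ 2 / ε ∧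
      (⌈Real.logb 2 (1 / ε)⌉₊ : ℝ) + 1 ≤ 2 * (1 + Real.log (1 / ε)) := by
  have h1 : 1 < 1 / ε := (one_lt_div hε0).2 hε1
  have hpos : 0 < Real.logb 2 (1 / ε) := Real.logb_pos (by norm_num) h1
  have hlog : 0 < Real.log (1 / ε) := Real.log_pos h1
  set K := ⌈Real.logb 2 (1 / ε)⌉₊ with hK
  have hK1 : Real.logb 2 (1 / ε) ≤ K := Nat.le_ceil _
  have hK2 : (K : ℝ) < Real.logb 2 (1 / ε) + 1 := Nat.ceil_lt_add_one hpos.le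
  have hrpow : (2 : ℝ) ^ Real.logb 2 (1 / ε) = 1 / ε :=
    Real.rpow_logb (by norm_num) (by norm_num) (by linarith)
  refine ⟨Nat.ceil_pos.2 hpos, ?_, ?_, ?_⟩
  · rw [← Real.rpow_natCast]
    nth_rewrite 1 [← hrpow]
    exact Real.rpow_le_rpow_of_exponent_le (by norm_num) hK1
  · rw [← Real.rpow_natCast]
    calc (2 : ℝ) ^ (K : ℝ) ≤ 2 ^ (Real.logb 2 (1 / ε) + 1) :=
          Real.rpow_le_rpow_of_exponent_le (by norm_num) hK2.le
      _ = 2 / ε := by rw [Real.rpow_add (by norm_num), hrpow, Real.rpow_one]; ring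
  · have h2 : 1 / 2 ≤ Real.log 2 := by have := Real.log_two_gt_d9; linarith
    have h3 : Real.logb 2 (1 / ε) ≤ 2 * Real.log (1 / ε) := by
      rw [Real.logb, div_le_iff₀ (by linarith)]
      nlinarith
    linarith

/-- The sum of the logarithms in the complexity bounds. -/
noncomputable def logSum (d : ℕ) (η ε δ : ℝ) : ℝ :=
  Real.log (d / (1 - 2 * η) ^ 2) + Real.log (1 / δ) + Real.log (1 + Real.log (1 / ε))

/-- `d ≥ 3 > e` gives `logSum ≥ 1`, so additive constants can be absorbed into the factor. -/
theorem scheduleLog_le {η ε δ : ℝ} (hd : 3 ≤ d) (hη0 : 0 ≤ η) (hη : η < 1 / 2) (hε0 : 0 < ε)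
    (hε1 : ε < 1) (hδ0 : 0 < δ) (hδ1 : δ < 1) :
    scheduleLog d η δ ⌈Real.logb 2 (1 / ε)⌉₊ ≤
      (Real.log ((3200 * Real.pi) ^ 3) + 4) * logSum d η ε δ := by
  obtain ⟨hK1, -, -, hK⟩ := epochs_bounds hε0 hε1
  set K := ⌈Real.logb 2 (1 / ε)⌉₊
  have hK1' : (1 : ℝ) ≤ K := by exact_mod_cast hK1
  have hd3 : (3 : ℝ) ≤ d := by exact_mod_cast hd
  have hpi := Real.pi_gt_three
  have hg : 0 < 1 - 2 * η := by linarith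
  have hg1 : (1 - 2 * η) ^ 2 ≤ 1 := pow_le_one₀ hg.le (by linarith)
  have hlogε : 0 < Real.log (1 / ε) := Real.log_pos ((one_lt_div hε0).2 hε1)
  have hc : 0 ≤ Real.log ((3200 * Real.pi) ^ 3) :=
    Real.log_nonneg (one_le_pow₀ (by linarith))
  have h1 : 1 ≤ Real.log (d / (1 - 2 * η) ^ 2) := by
    rw [Real.le_log_iff_exp_le (by positivity), le_div_iff₀ (by positivity)]
    have := Real.exp_one_lt_d9
    nlinarith [Real.exp_pos 1]
  have h2 : 0 ≤ Real.log (1 / δ) := Real.log_nonneg ((one_lt_div hδ0).2 hδ1).le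
  have h3 : 0 ≤ Real.log (1 + Real.log (1 / ε)) := Real.log_nonneg (by linarith)
  have e1 : Real.log (scaleFactor d η) =
      Real.log ((3200 * Real.pi) ^ 3) + Real.log (d / (1 - 2 * η) ^ 2) := by
    rw [scaleFactor, mul_div_assoc, Real.log_mul (by positivity) (by positivity)]
  have e2 : Real.log (K * (K + 1) / δ) ≤
      2 + 2 * Real.log (1 + Real.log (1 / ε)) + Real.log (1 / δ) := by
    have h4 : Real.log (K + 1) ≤ 1 + Real.log (1 + Real.log (1 / ε)) := by
      refine (Real.log_le_log (by positivity) hK).trans ?_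
      rw [Real.log_mul (by norm_num) (by positivity)]
      have := Real.log_two_lt_d9
      linarith
    have h5 : Real.log K ≤ Real.log (K + 1) := Real.log_le_log (by positivity) (by linarith)
    rw [div_eq_mul_one_div, Real.log_mul (by positivity) (by positivity),
      Real.log_mul (by positivity) (by positivity)]
    linarith
  have hsum : 1 ≤ logSum d η ε δ := by unfold logSum; linarith
  have hle : scheduleLog d η δ K ≤ Real.log ((3200 * Real.pi) ^ 3) + 2 + 2 * logSum d η ε δ := by
    unfold scheduleLog logSum
    linarith
  nlinarith

/-- The absolute constant in the bound for the number of examples. -/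
noncomputable def drawConstant : ℝ :=
  432000 * (3200 * Real.pi) ^ 3 * (600 * Real.pi) ^ 2 / Real.pi * 4 *
    (Real.log ((3200 * Real.pi) ^ 3) + 4) ^ 2

theorem drawConstant_pos : 0 < drawConstant := by
  have hpi := Real.pi_gt_three
  have hc : 0 ≤ Real.log ((3200 * Real.pi) ^ 3) :=
    Real.log_nonneg (one_le_pow₀ (by linarith))
  unfold drawConstant
  positivity

theorem err_le {D : Measure (Example d)} [IsProbabilityMeasure D]
    (hfst : D.fst = uniformSphere d) (u v : Vec d) :
    err D (halfspace v) ≤ err D (halfspace u) +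
      (uniformSphere d).real {x | halfspace v x ≠ halfspace u x} := by
  have hm : MeasurableSet {x : Sphere d | halfspace v x ≠ halfspace u x} :=
    (measurableSet_eq_fun (measurable_halfspace v) (measurable_halfspace u)).compl
  have h1 : (uniformSphere d).real {x | halfspace v x ≠ halfspace u x} =
      D.real {z : Example d | halfspace v z.1 ≠ halfspace u z.1} := by
    rw [measureReal_def, ← hfst, Measure.fst_apply hm]
    rfl
  rw [h1]
  refine (measureReal_mono ?_).trans (measureReal_union_le _ _)
  intro z hz
  by_cases h : halfspace u z.1 = z.2
  · exact Or.inr fun h' => hz (h'.trans h)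
  · exact Or.inl h

end PassivePerceptron

open PassivePerceptron in
theorem mainTheorem6 :
    ∃ C : ℝ, 0 < C ∧
      ∀ (d : ℕ), 3 ≤ d →
      ∀ (D : Measure (PassivePerceptron.Example d)) [IsProbabilityMeasure D]
        (u v₀ : PassivePerceptron.Sphere d) (η ε δ : ℝ),
        D.fst = PassivePerceptron.uniformSphere d →
        0 ≤ η → η < 1 / 2 →
        PassivePerceptron.BoundedNoise D η u →
        InnerProductGeometry.angle (v₀ : EuclideanSpace ℝ (Fin d)) u ≤ Real.pi / 2 →
        0 < ε → ε < 1 → 0 < δ → δ < 1 →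
        ENNReal.ofReal (1 - δ) ≤
          Measure.infinitePi (fun _ : ℕ => D)
            {ω | ∃ r : PassivePerceptron.Outcome (EuclideanSpace ℝ (Fin d)),
              PassivePerceptron.passivePerceptron (v₀ : EuclideanSpace ℝ (Fin d)) ε
                (PassivePerceptron.sampleSchedule d η δ)
                (PassivePerceptron.bandSchedule d η δ) ω = some r ∧
              ‖r.val‖ = 1 ∧
              PassivePerceptron.err D (PassivePerceptron.halfspace r.val) ≤
                PassivePerceptron.err D (PassivePerceptron.halfspace u) + ε ∧
              (r.draws : ℝ) ≤
                C * (d / ((1 - 2 * η) ^ 3 * ε)) * PassivePerceptron.logFactor d η ε δ ∧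
              (r.time : ℝ) ≤
                C * ((d : ℝ) ^ 2 / ((1 - 2 * η) ^ 3 * ε)) *
                  PassivePerceptron.logFactor d η ε δ} := by
  refine ⟨17 * drawConstant, by have := drawConstant_pos; positivity, ?_⟩
  intro d hd D _ u v₀ η ε δ hfst hη0 hη hnoise hangle hε0 hε1 hδ0 hδ1
  have hσ : IsProbabilityMeasure (uniformSphere d) := by rw [← hfst]; infer_instance
  have hu : ‖(u : EuclideanSpace ℝ (Fin d))‖ = 1 := norm_eq_of_mem_sphere u
  have hv₀ : ‖(v₀ : EuclideanSpace ℝ (Fin d))‖ = 1 := norm_eq_of_mem_sphere v₀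
  have hd3 : (3 : ℝ) ≤ d := by exact_mod_cast hd
  have hpi := Real.pi_gt_three
  have hg : 0 < 1 - 2 * η := by linarith
  obtain ⟨hK1, hK2, hK3, hK4⟩ := epochs_bounds hε0 hε1
  have hlogle := scheduleLog_le hd hη0 hη hε0 hε1 hδ0 hδ1
  set K := ⌈Real.logb 2 (1 / ε)⌉₊ with hK
  have hadm : ∀ k, 1 ≤ k → Admissible d η δ k := fun k hk => ⟨hd, hη0, hη, hk, hδ0, hδ1⟩
  set ℓ := scheduleLog d η δ K with hℓ
  have hℓ1 : 1 ≤ ℓ := one_le_scheduleLog (hadm K hK1)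
  set A := scaleFactor d η with hA
  have hA6 : 10 ^ 6 ≤ A := scaleFactor_ge hd hη0 hη
  -- Half of the lower bound for the acceptance probability, as `FailBound.cons` requires.
  set μ := (1 - 2 * η) * Real.pi / (2 ^ K * ℓ * (6000 * (600 * Real.pi) ^ 2)) with hμdef
  have hμ0 : 0 < μ := by positivity
  have hμ2 : 2 * μ = (1 - 2 * η) * Real.pi / (2 ^ K * ℓ * (3000 * (600 * Real.pi) ^ 2)) := by
    rw [hμdef]; field_simp; norm_num
  set bs := widths (sampleSchedule d η δ) (bandSchedule d η δ) (List.range' 1 K) with hbs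
  set M : ℕ := bs.length with hM
  have hMsum : M = ((List.range' 1 K).map (sampleSchedule d η δ)).sum := cast_length_widths _ _ _
  -- bounds for the total number of iterations
  have hMK : sampleSchedule d η δ K ≤ M := by
    rw [hMsum]
    refine List.single_le_sum (by simp) _ (List.mem_map_of_mem ?_)
    rw [List.mem_range'_1]; omega
  have hKM : K ≤ M := by
    have h := List.card_nsmul_le_sum ((List.range' 1 K).map (sampleSchedule d η δ)) 1 (by
      intro x hx
      obtain ⟨k, hk, rfl⟩ := List.mem_map.1 hx
      rw [List.mem_range'_1] at hk
      have := sampleSchedule_ge (hadm k hk.1)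
      have h1 : (1 : ℝ) ≤ sampleSchedule d η δ k := by linarith
      exact_mod_cast h1)
    rw [hMsum]
    simpa using h
  have hMle : (M : ℝ) ≤ K * (2 * A * ℓ) := by
    have h1 : ∀ x ∈ (List.range' 1 K).map (sampleSchedule d η δ), x ≤ ⌊2 * A * ℓ⌋₊ := by
      intro x hx
      obtain ⟨k, hk, rfl⟩ := List.mem_map.1 hx
      rw [List.mem_range'_1] at hk
      refine Nat.le_floor ((sampleSchedule_le (hadm k hk.1)).trans ?_)
      have := scheduleLog_mono (d := d) (η := η) hδ0 hk.1 (by omega : k ≤ K)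
      gcongr
    have h2 := List.sum_le_card_nsmul _ _ h1
    rw [← hMsum, List.length_map, List.length_range', smul_eq_mul] at h2
    calc (M : ℝ) ≤ ((K * ⌊2 * A * ℓ⌋₊ : ℕ) : ℝ) := by exact_mod_cast h2
      _ = K * (⌊2 * A * ℓ⌋₊ : ℝ) := by push_cast; ring
      _ ≤ _ := by gcongr; exact Nat.floor_le (by positivity)
  -- Twice the `M / μ` draws at which the exponent `M - μ N` vanishes, so that it becomes at most
  -- `-M`.
  set N : ℕ := ⌈2 * M / μ⌉₊ with hN
  have hN1 : 2 * M ≤ μ * N := by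
    have : 2 * M / μ ≤ N := Nat.le_ceil _
    rw [div_le_iff₀ hμ0] at this
    linarith
  have hK1' : (1 : ℝ) ≤ K := by exact_mod_cast hK1
  have hM1 : (1 : ℝ) ≤ M := hK1'.trans (by exact_mod_cast hKM)
  have hμ1 : μ ≤ 1 := by
    have h := inBand_real_lower_bound hfst (hadm K hK1) le_rfl hu
    rw [← hℓ, ← hμ2] at h
    have := h.trans measureReal_le_one
    linarith
  -- the number of examples
  have hNle : (N : ℝ) ≤ drawConstant * (d / ((1 - 2 * η) ^ 3 * ε)) * logFactor d η ε δ := by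
    have h1 : (N : ℝ) ≤ 3 * (M / μ) := by
      have h2 : (N : ℝ) ≤ 2 * M / μ + 1 := (Nat.ceil_lt_add_one (by positivity)).le
      have h3 : 1 ≤ M / μ := by rw [le_div_iff₀ hμ0]; linarith
      have h4 : 2 * (M : ℝ) / μ = 2 * (M / μ) := by ring
      linarith
    have hL : logFactor d η ε δ = logSum d η ε δ ^ 2 * (1 + Real.log (1 / ε)) := rfl
    have hlogε : 0 < Real.log (1 / ε) := Real.log_pos ((one_lt_div hε0).2 hε1)
    have h5 : ℓ ^ 2 ≤ ((Real.log ((3200 * Real.pi) ^ 3) + 4) * logSum d η ε δ) ^ 2 :=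
      pow_le_pow_left₀ (by linarith) hlogle 2
    calc (N : ℝ) ≤ 3 * (M / μ) := h1
      _ ≤ 3 * (K * (2 * A * ℓ) / μ) := by gcongr
      _ = 36000 * (3200 * Real.pi) ^ 3 * (600 * Real.pi) ^ 2 / Real.pi *
          (d / (1 - 2 * η) ^ 3) * (K * 2 ^ K * ℓ ^ 2) := by
          rw [hμdef, hA, scaleFactor]
          field_simp
          ring
      _ ≤ 36000 * (3200 * Real.pi) ^ 3 * (600 * Real.pi) ^ 2 / Real.pi *
          (d / (1 - 2 * η) ^ 3) * (2 * (1 + Real.log (1 / ε)) * (2 / ε) *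
            ((Real.log ((3200 * Real.pi) ^ 3) + 4) * logSum d η ε δ) ^ 2) := by
          gcongr
          linarith
      _ ≤ 432000 * (3200 * Real.pi) ^ 3 * (600 * Real.pi) ^ 2 / Real.pi *
          (d / (1 - 2 * η) ^ 3) * (2 * (1 + Real.log (1 / ε)) * (2 / ε) *
            ((Real.log ((3200 * Real.pi) ^ 3) + 4) * logSum d η ε δ) ^ 2) := by
          gcongr
          norm_num
      _ = _ := by
          rw [hL, drawConstant]
          field_simp
          ring
  -- the probability of failure
  have hfail := failBound_widths hd hfst hη0 hη hnoise hu hδ0 hδ1 (μ := μ) (K := K)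
    (fun k hk hkK w hw => by
      rw [hμ2]; exact inBand_real_lower_bound hfst (hadm k hk) hkK hw) K 1 le_rfl
    (by omega) N v₀ hv₀
  rw [← hbs] at hfail
  have hstart : Real.cos (Real.pi / 2 ^ 1) ≤
      inner ℝ (u : EuclideanSpace ℝ (Fin d)) (v₀ : EuclideanSpace ℝ (Fin d)) := by
    rw [pow_one, Real.cos_pi_div_two, real_inner_comm]
    rw [← InnerProductGeometry.cos_angle_mul_norm_mul_norm]
    have h0 := InnerProductGeometry.angle_nonneg (v₀ : EuclideanSpace ℝ (Fin d)) u
    exact mul_nonneg (Real.cos_nonneg_of_mem_Icc ⟨by linarith, hangle⟩) (by positivity)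
  beta_reduce at hfail
  rw [if_pos hstart, ← hM] at hfail
  -- `M` is at least the last sample size, hence at least `log (K(K+1)/δ)`; the result fits the
  -- share `δ/(K+1)` left over by the telescoping sum.
  have hexp : Real.exp (M - μ * N) ≤ δ / (K + 1) := by
    have h1 : Real.log (K * (K + 1) / δ) ≤ M := by
      have h2 := scaleFactor_mul_le d η δ K
      rw [← hA, ← hℓ] at h2
      have h3 : (sampleSchedule d η δ K : ℝ) ≤ M := by exact_mod_cast hMK
      have h4 : Real.log (K * (K + 1) / δ) ≤ ℓ := by
        have := one_le_log_of_le hA6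
        rw [hℓ, scheduleLog, ← hA]
        linarith
      nlinarith
    calc Real.exp (M - μ * N) ≤ Real.exp (-Real.log (K * (K + 1) / δ)) := by
          gcongr; linarith
      _ = δ / (K * (K + 1)) := by
          rw [Real.exp_neg, Real.exp_log (by positivity), inv_div]
      _ ≤ δ / (1 * (K + 1)) := by gcongr
      _ = _ := by rw [one_mul]
  have hfail' : Measure.infinitePi (fun _ : ℕ => D)
      {ω | Fails (cap (u : EuclideanSpace ℝ (Fin d)) (Real.pi / 2 ^ (K + 1))) N bs v₀ ω} ≤
      ENNReal.ofReal δ := by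
    refine hfail.trans ?_
    have h0 : 0 ≤ δ / ((1 : ℕ) : ℝ) - δ / (K + 1) := by
      rw [Nat.cast_one, div_one, sub_nonneg]
      exact div_le_self hδ0.le (by linarith)
    rw [← ENNReal.ofReal_add h0 (Real.exp_pos _).le]
    refine ENNReal.ofReal_le_ofReal ?_
    rw [Nat.cast_one, div_one]
    linarith
  -- the runs that do not fail
  set F := {ω | Fails (cap (u : EuclideanSpace ℝ (Fin d)) (Real.pi / 2 ^ (K + 1))) N bs v₀ ω}
    with hF
  have hFm : MeasurableSet F :=
    measurable_prodMk_left (measurableSet_fails (measurableSet_cap _ _) N bs)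
  have hcompl : ENNReal.ofReal (1 - δ) ≤ Measure.infinitePi (fun _ : ℕ => D) Fᶜ := by
    rw [prob_compl_eq_one_sub hFm, ENNReal.ofReal_sub _ hδ0.le, ENNReal.ofReal_one]
    gcongr
  -- Monotonicity holds for arbitrary sets, so measurability is needed only for `F`, not for the
  -- success event.
  refine hcompl.trans (measure_mono fun ω hω => ?_)
  obtain ⟨n, hnN, v, ⟨hv1, hvu⟩, hreach⟩ := exists_reaches_of_not_fails hω
  obtain ⟨t, ht, hrun⟩ := hreach.passivePerceptron
  rw [← hK] at ht
  have hdraws : (n : ℝ) ≤ drawConstant * (d / ((1 - 2 * η) ^ 3 * ε)) * logFactor d η ε δ :=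
    (Nat.cast_le.2 hnN).trans hNle
  have hn0 : (0 : ℝ) ≤ n := Nat.cast_nonneg n
  refine ⟨⟨v, n, t⟩, hrun, hv1, ?_, ?_, ?_⟩
  · refine (err_le hfst u v).trans ?_
    have h1 := lune_real_le K hu hv1 hvu
    have h2 : (1 / 2 : ℝ) ^ K ≤ ε := by
      rw [one_div, inv_pow, inv_le_comm₀ (by positivity) hε0, ← one_div]
      exact hK2
    linarith
  · simp only
    linarith
  · simp only
    -- Every epoch accepts at least one example, so `1 ≤ K ≤ n` and `6K + 3 ≤ 9n`. The remaining
    -- `17n` is at most `6dn` because `d ≥ 3`.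
    have hKn : K ≤ n := hKM.trans hreach.le_length
    have h1 : t ≤ 17 * d * n := by
      have h2 : 17 * n ≤ 6 * d * n := Nat.mul_le_mul_right n (by omega)
      have h3 : (11 * d + 8) * n = 11 * d * n + 8 * n := by ring
      have h4 : 17 * d * n = 11 * d * n + 6 * d * n := by ring
      omega
    calc (t : ℝ) ≤ 17 * d * n := by exact_mod_cast h1
      _ ≤ 17 * d * (drawConstant * (d / ((1 - 2 * η) ^ 3 * ε)) * logFactor d η ε δ) := by gcongr
      _ = _ := by ring
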